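/- **Setting.** A Goal-POMDP $\langle S,A,Z,G,T,O,c,b_0\rangle$ has finite non-empty sets $S,A,Z$ of states, actions and observations, goal states $G\subseteq S$, transition probabilities $T(s,a,s')=p(s'\mid s,a)$, observation probabilities $O(s',a,z)=p(z\mid s',a)$, costs $c(s,a)\ge 0$, and an initial belief $b_0$ (a probability distribution on $S$). Goal states are cost-free, absorbing and fully observable: there is $z_g\in Z$ such that for all $g\in G$, $s\notin G$ and $a$, $c(g,a)=0$, $T(g,a,g)=1$, $O(g,a,z_g)=1$, $O(s,a,z_g)=0$. Assume $c(s,a)>0$ for all $s\notin G$ and all $a$. For a belief $b$ put $b_a(s)=\sum_{s'}T(s',a,s)b(s')$, $b_a(z)=\sum_s b_a(s)O(s,a,z)$, $b_a^z(s)=O(s,a,z)b_a(s)/b_a(z)$ if $b_a(z)\ne0$, and $c(b,a)=\sum_s c(s,a)b(s)$. A belief is a goal belief if it vanishes off $G$. In the belief MDP, action $a$ leads from $b$ to $b_a^z$ with probability $b_a(z)$ at cost $c(b,a)$. For a belief policy $\pi$ (a map from beliefs to actions), $V^\pi(b)\in[0,\infty]$ is the expected total cost from $b$ until a goal belief is reached;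 $V^*(b)=\inf_\pi V^\pi(b)$ and $Q^*(b,a)=c(b,a)+\sum_z b_a(z)V^*(b_a^z)$. A belief is reachable if some actions lead to it from $b_0$ with positive probability. Assume $V^*(b)<\infty$ for every reachable $b$. **Planners.** Both planners keep a value $V(b)$ (initially $\mathrm{heur}(b)$, and $0$ for goal beliefs), Q-values $Q(b,a)$ (initially $\hat Q_{init}(b,a)$), and a set of evaluated pairs $(b,a)$ (initially empty). A fixed rule $\operatorname{argmin}$, arbitrary up to the choice among ties, selects the best action at $b$, that is, an action minimising $Q(b,\cdot)$. *Updating the Q-values at $b$* means setting $Q(b,a):=c(b,a)+\sum_z b_a(z)V(b_a^z)$ for all actions $a$ evaluated from $b$. The *lazy loop at $b$* is: let $a$ be the best action; mark $(b,a)$ as evaluated; update the Q-values at $b$; repeat until the best action after the update is still $a$; finally set $V(b):=Q(b,a)$. *Lazy RTDP-Bel* repeats trials forever. A trial starts at $b=b_0$ with a state $s$ sampled from $b_0$; while $b$ is not a goal belief, it runs the lazy loop at $b$, which ends with an action $a$, samples $s'\sim T(s,a,\cdot)$ and $z\sim O(s',a,\cdot)$, and sets $b:=b_a^z$, $s:=s'$.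 *Lazy LAO\** with tolerance $\varepsilon>0$ keeps a solution graph $G^*$, initially $\{b_0\}$. The current best solution graph consists of the beliefs reached from $b_0$ by following best actions as long as these have been evaluated, each expanded belief being marked with its best action. A non-terminal tip is a non-goal belief of $G^*$ with no evaluated action or whose best action is unevaluated. (1) While there is a tip, it picks any tip $b$, runs the lazy loop at $b$, runs ImproveValues on $b$ and its ancestors in $G^*$, and sets $G^*$ to the current best solution graph. (2) When there is no tip, it runs ImproveValues on $G^*$; if $G^*$ is the current best solution graph, markings included, it returns $G^*$, otherwise it sets $G^*$ to the current best solution graph and goes back to (1). ImproveValues on a set of beliefs sweeps through its non-goal beliefs, in any order, until the largest change of a value in a sweep is at most $\varepsilon$; at each $b$ it updates the Q-values at $b$, returns at once if the best action $a$ at $b$ is unevaluated, and otherwise sets $V(b):=Q(b,a)$. **Theorem.** Suppose that $\hat Q_{init}(b,a)\le Q^*(b,a)$ and $\mathrm{heur}(b)\le V^*(b)$ for all beliefs $b$ and actions $a$ (with $\hat Q_{init}$ and $\mathrm{heur}$ real-valued). Then both planners converge to the optimal policy of the belief MDP, in the following sense. *(i) Lazy RTDP-Bel.* * If $\mathrm{heur}$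 and $\hat Q_{init}$ are bounded below on the reachable beliefs, then almost surely, for every belief $b$ visited infinitely often, the current $V(b)$ converges to $V^*(b)$, and from some time on the best action $a$ at $b$ satisfies $Q^*(b,a)=V^*(b)$. * If the set of reachable beliefs is finite, then almost surely goal beliefs are reached infinitely often (so every trial ends), the current $V(b_0)$ converges to $V^*(b_0)$, and from some time on the policy $\pi$ that takes the current best action at each belief satisfies $V^{\pi}(b_0)=V^*(b_0)$. *(ii) Lazy LAO\*.* Call a solution graph complete if it contains $b_0$, has an action marked at each of its non-goal beliefs, and is closed under the transitions of the marked actions. * For every $\delta>0$ there is $\varepsilon_0>0$ such that for every $0<\varepsilon<\varepsilon_0$, any graph returned by a run is complete, and every policy $\pi$ that follows its marked actions satisfies $V^\pi(b_0)\le V^*(b_0)+\delta$. * If the set of reachable beliefs is finite, there is $\varepsilon_0>0$ such that for every $0<\varepsilon<\varepsilon_0$ and every run: no call of ImproveValues and no lazy loop runs forever; from some time on (in particular when the planner returns) $G^*$ is complete and every policy $\pi$ that follows its marked actions satisfies $V^\pi(b_0)=V^*(b_0)$; and if every reachable non-goal belief has only one action $a$ with $Q^*(b,a)=V^*(b)$,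 then the planner returns. -/

import Mathlib

open MeasureTheory ProbabilityTheory Filter Topology
open scoped ENNReal NNReal

/-- A discrete Goal-POMDP with state space `S`, action space `A` and observation space `Z`
(all three are taken finite below): goal states `G`, transition model `T s a s' = p(s' | s, a)`,
observation model `O s' a z = p(z | s', a)`, nonnegative costs `c`, the goal observation `zG`, and
the starting belief `b₀`.  Goal states are cost-free, absorbing and fully observable. -/
structure GoalPOMDP (S A Z : Type*) where
  G : Set S
  T : S → A → PMF S
  O : S → A → PMF Z
  c : S → A → ℝ≥0
  b₀ : PMF S
  zG : Z
  goal_cost : ∀ g ∈ G, ∀ a, c g a = 0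
  goal_absorbing : ∀ g ∈ G, ∀ a, T g a g = 1
  goal_observed : ∀ g ∈ G, ∀ a, O g a zG = 1
  goal_observed_only : ∀ s ∉ G, ∀ a, O s a zG = 0

/-- The data kept by both planners: the value table `V`, the table `Q` of Q-values, and the set
`ev` of the pairs `(b, a)` for which the action `a` has been evaluated from the belief `b`. -/
structure Tables (S A : Type*) where
  V : PMF S → ℝ
  Q : PMF S → A → ℝ
  ev : Set (PMF S × A)

/-- A configuration of Lazy RTDP-Bel: the tables, the current belief `b` of the current trial, and
the current (hidden) simulated state `s`. -/
structure RTDPConfig (S A : Type*) where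
  tab : Tables S A
  b : PMF S
  s : S

/-- All sets of configurations are events; only countably many configurations are ever reached. -/
instance RTDPConfig.instMeasurableSpace {S A : Type*} : MeasurableSpace (RTDPConfig S A) := ⊤

/-- A partial solution graph: its set of beliefs, and the action marked at each expanded belief. The
edges are the belief transitions of the marked actions. -/
@[ext]
structure SolGraph (S A : Type*) where
  nodes : Set (PMF S)
  act : PMF S → Option A

/-- The control state of Lazy LAO*: at the head of the main loop, inside the do-while loop that
expands the tip `b`, inside ImproveValues on the set `B` (`final` tells whether this is the final
call, on the whole solution graph; `todo` are the beliefs still to be processed in the current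
sweep, `err` is the largest change of a value made so far in this sweep), or returned. -/
inductive LAOPhase (S : Type*) where
  | main : LAOPhase S
  | expand (b : PMF S) : LAOPhase S
  | improve (final : Bool) (B : Set (PMF S)) (todo : List (PMF S)) (err : ℝ) : LAOPhase S
  | returned : LAOPhase S

/-- A configuration of Lazy LAO*: the tables, the current solution graph and the control state. -/
structure LAOConfig (S A : Type*) where
  tab : Tables S A
  graph : SolGraph S A
  phase : LAOPhase S

namespace GoalPOMDP

noncomputable section

open scoped Classical

variable {S A Z : Type*} [Fintype S] (M : GoalPOMDP S A Z)

/-! ### The belief MDP -/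

/-- `b_a(s) = ∑ s', T(s', a, s) b(s')`. -/
def pred (b : PMF S) (a : A) (s : S) : ℝ≥0∞ := ∑ s', M.T s' a s * b s'

/-- `b_a(z) = ∑ s, b_a(s) O(s, a, z)`. -/
def obsProb (b : PMF S) (a : A) (z : Z) : ℝ≥0∞ := ∑ s, M.pred b a s * M.O s a z

theorem tsum_pred_mul (b : PMF S) (a : A) (z : Z) :
    ∑' s, M.O s a z * M.pred b a s = M.obsProb b a z := by
  rw [tsum_fintype]
  exact Finset.sum_congr rfl fun s _ => mul_comm _ _

theorem obsProb_ne_top (b : PMF S) (a : A) (z : Z) : M.obsProb b a z ≠ ∞ :=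
  ENNReal.sum_ne_top.2 fun _ _ => ENNReal.mul_ne_top
    (ENNReal.sum_ne_top.2 fun _ _ => ENNReal.mul_ne_top (PMF.apply_ne_top _ _)
      (PMF.apply_ne_top _ _)) (PMF.apply_ne_top _ _)

/-- `b_a^z(s) = O(s, a, z) b_a(s) / b_a(z)` if `b_a(z) ≠ 0`. If `b_a(z) = 0` there is no such
belief; the value `b` given then always carries probability zero. -/
def succ (b : PMF S) (a : A) (z : Z) : PMF S :=
  if h : M.obsProb b a z ≠ 0 then
    PMF.normalize (fun s => M.O s a z * M.pred b a s)
      (by rw [M.tsum_pred_mul]; exact h) (by rw [M.tsum_pred_mul]; exact M.obsProb_ne_top b a z)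
  else b

/-- `c(b, a) = ∑ s, c(s, a) b(s)`. -/
def cost (b : PMF S) (a : A) : ℝ≥0∞ := ∑ s, (M.c s a : ℝ≥0∞) * b s

def IsGoal (b : PMF S) : Prop := ∀ s, s ∉ M.G → b s = 0

/-- The beliefs that can be reached from `b₀` with positive probability, by any actions. -/
inductive Reachable : PMF S → Prop
  | start : Reachable M.b₀
  | step (b : PMF S) (a : A) (z : Z) (hb : Reachable b) (hz : M.obsProb b a z ≠ 0) :
      Reachable (M.succ b a z)

variable [Fintype Z]

/-- The expected cost, over the first `n` steps or until a goal belief is reached, of the belief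
policy `π` started in a given belief. -/
def costUpTo (π : PMF S → A) : ℕ → PMF S → ℝ≥0∞
  | 0, _ => 0
  | n + 1, b => if M.IsGoal b then 0 else
      M.cost b (π b) + ∑ z, M.obsProb b (π b) z * costUpTo π n (M.succ b (π b) z)

/-- The expected total cost of the belief policy `π` from `b` until a goal belief is reached. -/
def policyCost (π : PMF S → A) (b : PMF S) : ℝ≥0∞ := ⨆ n, M.costUpTo π n b

/-- `V*(b)`: the least expected total cost of a belief policy from `b`. -/
def optCost (b : PMF S) : ℝ≥0∞ := ⨅ π : PMF S → A, M.policyCost π b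

/-- `Q*(b, a)`. -/
def optQ (b : PMF S) (a : A) : ℝ≥0∞ :=
  M.cost b a + ∑ z, M.obsProb b a z * M.optCost (M.succ b a z)

/-! ### The operations common to both planners

`sel b q` is the action `argmin_a q(a)` chosen at the belief `b`; it encodes how ties are broken. -/

/-- The tables at the start: a belief that has not been met yet carries the Q-values `Qinit` and the
value `heur`, nothing has been evaluated, and goal beliefs have the value `0`. -/
def startTables (Qinit : PMF S → A → ℝ) (heur : PMF S → ℝ) : Tables S A where
  V b := if M.IsGoal b then 0 else heur b
  Q := Qinit
  ev := ∅

/-- The action of least Q-value at `b`. -/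
def best (sel : PMF S → (A → ℝ) → A) (t : Tables S A) (b : PMF S) : A := sel b (t.Q b)

/-- `c(b, a) + ∑ z, P(z | b, a) V(b_a^z)`. -/
def backup (t : Tables S A) (b : PMF S) (a : A) : ℝ :=
  (M.cost b a).toReal + ∑ z, (M.obsProb b a z).toReal * t.V (M.succ b a z)

/-- The routine Update Q-values at `b`: the Q-values of the evaluated actions are recomputed. -/
def updateQ (t : Tables S A) (b : PMF S) : Tables S A :=
  { t with Q := Function.update t.Q b fun a => if (b, a) ∈ t.ev then M.backup t b a else t.Q b a }

/-- Evaluate `a` from `b`. -/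
def evaluate (t : Tables S A) (b : PMF S) (a : A) : Tables S A :=
  { t with ev := insert (b, a) t.ev }

/-- The body of the do-while loop at `b`: the best action is evaluated if it has not been evaluated
before, and the Q-values at `b` are updated. -/
def lazyBody (sel : PMF S → (A → ℝ) → A) (t : Tables S A) (b : PMF S) : Tables S A :=
  M.updateQ (evaluate t b (best sel t b)) b

/-- `V(b) := Q(b, a)`. -/
def setV (t : Tables S A) (b : PMF S) (a : A) : Tables S A :=
  { t with V := Function.update t.V b (t.Q b a) }

/-! ### Lazy RTDP-Bel -/

/-- One step of Lazy RTDP-Bel. At a goal belief the trial ends, and a new one is started from `b₀`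
with a fresh state sampled from `b₀`. At another belief the body of the do-while loop is run once;
if the best action has changed, the loop is repeated from the same belief, otherwise the value of
the belief is updated and a next state and an observation are sampled. -/
def rtdpStep (sel : PMF S → (A → ℝ) → A) (x : RTDPConfig S A) : PMF (RTDPConfig S A) :=
  if M.IsGoal x.b then
    M.b₀.map fun s => { tab := x.tab, b := M.b₀, s := s }
  else if best sel (M.lazyBody sel x.tab x.b) x.b ≠ best sel x.tab x.b then
    PMF.pure { tab := M.lazyBody sel x.tab x.b, b := x.b, s := x.s }
  else
    (M.T x.s (best sel x.tab x.b)).bind fun s' =>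
      (M.O s' (best sel x.tab x.b)).map fun z =>
        { tab := setV (M.lazyBody sel x.tab x.b) x.b (best sel x.tab x.b)
          b := M.succ x.b (best sel x.tab x.b) z
          s := s' }

/-- The first configuration of the first trial. -/
def rtdpStart (Qinit : PMF S → A → ℝ) (heur : PMF S → ℝ) : PMF (RTDPConfig S A) :=
  M.b₀.map fun s => { tab := M.startTables Qinit heur, b := M.b₀, s := s }

/-- The transition kernel of Lazy RTDP-Bel at time `n`, as a function of the history. -/
def rtdpKernel (sel : PMF S → (A → ℝ) → A) (n : ℕ) :
    Kernel ((i : Finset.Iic n) → (fun _ : ℕ => RTDPConfig S A) i) (RTDPConfig S A) where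
  toFun h := (M.rtdpStep sel (h ⟨n, Finset.mem_Iic.2 le_rfl⟩)).toMeasure
  measurable' := (measurable_from_top (f := fun x : RTDPConfig S A =>
    (M.rtdpStep sel x).toMeasure)).comp (measurable_pi_apply _)

instance rtdpKernel_isMarkov (sel : PMF S → (A → ℝ) → A) (n : ℕ) :
    IsMarkovKernel (M.rtdpKernel sel n) :=
  ⟨fun h => PMF.toMeasure.isProbabilityMeasure (M.rtdpStep sel (h ⟨n, Finset.mem_Iic.2 le_rfl⟩))⟩

/-- The law of the sequence of configurations of Lazy RTDP-Bel when its trials are repeated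
forever. -/
def rtdpLaw (sel : PMF S → (A → ℝ) → A) (Qinit : PMF S → A → ℝ) (heur : PMF S → ℝ) :
    Measure (ℕ → RTDPConfig S A) :=
  Kernel.trajMeasure (X := fun _ => RTDPConfig S A) (M.rtdpStart Qinit heur).toMeasure
    (M.rtdpKernel sel)

/-! ### Lazy LAO* -/

/-- The beliefs reached from `b₀` when the best actions are followed as long as these have been
evaluated. -/
inductive BestReach (sel : PMF S → (A → ℝ) → A) (t : Tables S A) : PMF S → Prop
  | start : BestReach sel t M.b₀
  | step (b : PMF S) (z : Z) (hb : BestReach sel t b) (hg : ¬ M.IsGoal b)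
      (he : (b, best sel t b) ∈ t.ev) (hz : M.obsProb b (best sel t b) z ≠ 0) :
      BestReach sel t (M.succ b (best sel t b) z)

/-- The current best solution graph. -/
def bestGraph (sel : PMF S → (A → ℝ) → A) (t : Tables S A) : SolGraph S A where
  nodes := {b | M.BestReach sel t b}
  act b := if M.BestReach sel t b ∧ ¬ M.IsGoal b ∧ (b, best sel t b) ∈ t.ev
    then some (best sel t b) else none

/-- A non-terminal tip: a non-goal belief of the graph with no evaluated action, or whose best
action has not been evaluated. -/
def IsTip (sel : PMF S → (A → ℝ) → A) (t : Tables S A) (g : SolGraph S A) (b : PMF S) : Prop :=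
  b ∈ g.nodes ∧ ¬ M.IsGoal b ∧ ((∀ a, (b, a) ∉ t.ev) ∨ (b, best sel t b) ∉ t.ev)

/-- There is an edge from `b` to `b'` in the graph. -/
def Edge (g : SolGraph S A) (b b' : PMF S) : Prop :=
  b ∈ g.nodes ∧ ∃ a z, g.act b = some a ∧ M.obsProb b a z ≠ 0 ∧ M.succ b a z = b'

/-- `b` and its ancestors in the graph. -/
def withAncestors (g : SolGraph S A) (b : PMF S) : Set (PMF S) :=
  {b' | Relation.ReflTransGen (M.Edge g) b' b}

/-- `l` lists the non-goal beliefs of `B`, in some order (goal beliefs keep the value `0`). -/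
def IsSweep (B : Set (PMF S)) (l : List (PMF S)) : Prop :=
  l.Nodup ∧ ∀ b, b ∈ l ↔ b ∈ B ∧ ¬ M.IsGoal b

/-- What is done when ImproveValues returns: the solution graph is updated and the main loop is
resumed, except that the planner returns when the final call has left the graph unchanged. -/
def afterImprove (sel : PMF S → (A → ℝ) → A) (final : Bool) (t : Tables S A) (g : SolGraph S A) :
    LAOConfig S A :=
  if final = true ∧ g = M.bestGraph sel t then { tab := t, graph := g, phase := .returned }
  else { tab := t, graph := M.bestGraph sel t, phase := .main }

/-- The steps of Lazy LAO*. The choice of the tip and the order of each sweep are free. -/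
inductive LAOStep (sel : PMF S → (A → ℝ) → A) (ε : ℝ) : LAOConfig S A → LAOConfig S A → Prop
  /-- Identify a non-terminal tip. -/
  | pick (t : Tables S A) (g : SolGraph S A) (b : PMF S) (hb : M.IsTip sel t g b) :
      LAOStep sel ε ⟨t, g, .main⟩ ⟨t, g, .expand b⟩
  /-- The do-while loop is repeated, as the best action has changed. -/
  | again (t : Tables S A) (g : SolGraph S A) (b : PMF S)
      (h : best sel (M.lazyBody sel t b) b ≠ best sel t b) :
      LAOStep sel ε ⟨t, g, .expand b⟩ ⟨M.lazyBody sel t b, g, .expand b⟩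
  /-- The do-while loop ends, the value of the tip is updated, and ImproveValues is called on the
  tip and its ancestors. -/
  | expanded (t : Tables S A) (g : SolGraph S A) (b : PMF S) (l : List (PMF S))
      (h : best sel (M.lazyBody sel t b) b = best sel t b)
      (hl : M.IsSweep (M.withAncestors g b) l) :
      LAOStep sel ε ⟨t, g, .expand b⟩
        ⟨setV (M.lazyBody sel t b) b (best sel t b), g, .improve false (M.withAncestors g b) l 0⟩
  /-- No tip is left, and ImproveValues is called on the whole graph. -/
  | noTip (t : Tables S A) (g : SolGraph S A) (l : List (PMF S))
      (h : ∀ b, ¬ M.IsTip sel t g b) (hl : M.IsSweep g.nodes l) :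
      LAOStep sel ε ⟨t, g, .main⟩ ⟨t, g, .improve true g.nodes l 0⟩
  /-- A backup in ImproveValues. -/
  | backup (t : Tables S A) (g : SolGraph S A) (final : Bool) (B : Set (PMF S)) (b : PMF S)
      (l : List (PMF S)) (err : ℝ)
      (h : (b, best sel (M.updateQ t b) b) ∈ t.ev) :
      LAOStep sel ε ⟨t, g, .improve final B (b :: l) err⟩
        ⟨setV (M.updateQ t b) b (best sel (M.updateQ t b) b), g,
          .improve final B l
            (max err |(M.updateQ t b).Q b (best sel (M.updateQ t b) b) - t.V b|)⟩
  /-- ImproveValues returns, as the best action has become an unevaluated one. -/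
  | cutOff (t : Tables S A) (g : SolGraph S A) (final : Bool) (B : Set (PMF S)) (b : PMF S)
      (l : List (PMF S)) (err : ℝ)
      (h : (b, best sel (M.updateQ t b) b) ∉ t.ev) :
      LAOStep sel ε ⟨t, g, .improve final B (b :: l) err⟩
        (M.afterImprove sel final (M.updateQ t b) g)
  /-- The error exceeds `ε` after a sweep: another sweep is made. -/
  | sweepAgain (t : Tables S A) (g : SolGraph S A) (final : Bool) (B : Set (PMF S))
      (l : List (PMF S)) (err : ℝ) (h : ε < err) (hl : M.IsSweep B l) :
      LAOStep sel ε ⟨t, g, .improve final B [] err⟩ ⟨t, g, .improve final B l 0⟩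
  /-- The error is at most `ε` after a sweep: ImproveValues returns. -/
  | sweepEnd (t : Tables S A) (g : SolGraph S A) (final : Bool) (B : Set (PMF S))
      (err : ℝ) (h : err ≤ ε) :
      LAOStep sel ε ⟨t, g, .improve final B [] err⟩ (M.afterImprove sel final t g)

/-- The first configuration of Lazy LAO*, with the graph consisting of `b₀` alone. -/
def laoStart (Qinit : PMF S → A → ℝ) (heur : PMF S → ℝ) : LAOConfig S A where
  tab := M.startTables Qinit heur
  graph := { nodes := {M.b₀}, act := fun _ => none }
  phase := .main

/-- `x` is a run of Lazy LAO*, continued by repeating the last configuration if there is one from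
which no step is possible. -/
def IsLAORun (sel : PMF S → (A → ℝ) → A) (ε : ℝ) (Qinit : PMF S → A → ℝ) (heur : PMF S → ℝ)
    (x : ℕ → LAOConfig S A) : Prop :=
  x 0 = M.laoStart Qinit heur ∧
    ∀ n, M.LAOStep sel ε (x n) (x (n + 1)) ∨
      ((∀ y, ¬ M.LAOStep sel ε (x n) y) ∧ x (n + 1) = x n)

/-- The graph contains `b₀`, has an action marked at each of its non-goal beliefs, and is closed
under the belief transitions of the marked actions. -/
def IsComplete (g : SolGraph S A) : Prop :=
  M.b₀ ∈ g.nodes ∧ (∀ b ∈ g.nodes, ¬ M.IsGoal b → ∃ a, g.act b = some a) ∧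
    ∀ b b', M.Edge g b b' → b' ∈ g.nodes

/-- `π` follows the actions marked in the graph. -/
def Follows (g : SolGraph S A) (π : PMF S → A) : Prop :=
  ∀ b ∈ g.nodes, ∀ a, g.act b = some a → π b = a

end

end GoalPOMDP

/-! Both planners are asynchronous value iteration started from below. Every operation on the tables
keeps underestimates (`Admissible.tableOps`): backups are monotone, and the least Q-value at a
belief is at most that of an optimal action. Bellman's equations hold on the infinite belief space
because value iteration from `0` increases and there are finitely many actions
(`exists_le_limitCost`, `optCost_eq_limitCost`).

The opposite bound comes from verification (`policyCost_le_ofReal`). Let `v` be bounded below on a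
set of beliefs closed under a policy `π`, nonnegative at goal beliefs, and at least its own
lookahead under `π` elsewhere. Each action at a reachable non-goal belief costs at least some `κ >
0` (`exists_cost_lower_bound`), so the probability of missing the goal for `n` steps is at most the
expected `n`-step cost divided by `κ * n`. The remainder left after unrolling the inequality `n`
times is therefore negligible, and `v` dominates the cost of `π`. If `v` is also an underestimate,
then `V* ≤ V^π ≤ v ≤ V*`.

For Lazy RTDP-Bel, `v` is the liminf of the values and `π` picks, at each belief visited infinitely
often, the best of the actions taken there infinitely often. The set of these beliefs is closed
under `π` by fairness: a possible observation after an action taken infinitely often is itself made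
infinitely often. Fairness is the conditional Borel–Cantelli lemma (`ae_fair`), applied to the
filtration of tables and beliefs. The simulated state must be left out of it: given the past, that
state has the current belief as its law (`setLIntegral_stateAverage`), and only after averaging over
it is the chance of an observation bounded below. If no goal were met infinitely often, `π` would
stay among non-goal beliefs and have infinite cost, although it is optimal (`frequently_isGoal`).

For Lazy LAO*, a returned graph carries values whose lookahead exceeds them by at most `ε`; as costs
are at least `κ`, this error amounts to rescaling the costs, and verification gives near-optimality
(`LAOInv.policyCost_le_of_returned`). With finitely many reachable beliefs, policy costs take
finitely many values, so near-optimal means optimal (`exists_gap`). In a run that never returns, new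
evaluations stop, then cut-offs stop, and afterwards only backups change the values, which converge
by a maximum principle (`exists_tendsto_of_backups`). The limit satisfies the verification
inequality for the actions marked infinitely often, so the marked actions are eventually optimal. If
optimal actions are unique, two consecutive graphs must agree, and the planner would have returned
(`false_of_unique`). -/

set_option linter.unusedSectionVars false

namespace GoalPOMDP

noncomputable section

open scoped Classical

/-! ### Belief transitions, goal observability and positive costs. -/

section BeliefMDP

variable {S A Z : Type*} [Fintype S] (M : GoalPOMDP S A Z)

theorem sum_pmf {α : Type*} [Fintype α] (p : PMF α) : ∑ x, p x = 1 := by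
  rw [← tsum_fintype (L := .unconditional _)]; exact p.tsum_coe

theorem sum_pred (b : PMF S) (a : A) : ∑ s, M.pred b a s = 1 := by
  unfold pred
  rw [Finset.sum_comm]
  simp_rw [← Finset.sum_mul, sum_pmf, one_mul, sum_pmf]

theorem sum_obsProb [Fintype Z] (b : PMF S) (a : A) : ∑ z, M.obsProb b a z = 1 := by
  unfold obsProb
  rw [Finset.sum_comm]
  simp_rw [← Finset.mul_sum, sum_pmf, mul_one, sum_pred]

theorem sum_obsProb_toReal [Fintype Z] (b : PMF S) (a : A) :
    ∑ z, (M.obsProb b a z).toReal = 1 := by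
  rw [← ENNReal.toReal_sum fun z _ => M.obsProb_ne_top b a z, sum_obsProb, ENNReal.toReal_one]

theorem succ_mul_obsProb (b : PMF S) (a : A) (z : Z) (h : M.obsProb b a z ≠ 0) (s : S) :
    M.obsProb b a z * M.succ b a z s = M.O s a z * M.pred b a s := by
  unfold succ
  rw [dif_pos h, PMF.normalize_apply, M.tsum_pred_mul, mul_comm, mul_assoc,
    ENNReal.inv_mul_cancel h (M.obsProb_ne_top b a z), mul_one]

theorem succ_apply_ne_zero_iff (b : PMF S) (a : A) (z : Z) (h : M.obsProb b a z ≠ 0) (s : S) :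
    M.succ b a z s ≠ 0 ↔ M.O s a z ≠ 0 ∧ M.pred b a s ≠ 0 := by
  have := M.succ_mul_obsProb b a z h s
  constructor
  · intro hs
    have : M.O s a z * M.pred b a s ≠ 0 := by
      rw [← this]; exact mul_ne_zero h hs
    exact ⟨left_ne_zero_of_mul this, right_ne_zero_of_mul this⟩
  · rintro ⟨h1, h2⟩ hs
    rw [hs, mul_zero] at this
    exact mul_ne_zero h1 h2 this.symm

theorem pred_ne_zero_iff (b : PMF S) (a : A) (s : S) :
    M.pred b a s ≠ 0 ↔ ∃ s', M.T s' a s ≠ 0 ∧ b s' ≠ 0 := by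
  unfold pred
  rw [Ne, Finset.sum_eq_zero_iff]
  push Not
  simp

theorem obsProb_ne_zero_iff (b : PMF S) (a : A) (z : Z) :
    M.obsProb b a z ≠ 0 ↔ ∃ s, M.pred b a s ≠ 0 ∧ M.O s a z ≠ 0 := by
  unfold obsProb
  rw [Ne, Finset.sum_eq_zero_iff]
  push Not
  simp

theorem cost_ne_top (b : PMF S) (a : A) : M.cost b a ≠ ∞ :=
  ENNReal.sum_ne_top.2 fun _ _ => ENNReal.mul_ne_top ENNReal.coe_ne_top (PMF.apply_ne_top _ _)

theorem IsGoal.cost_eq_zero {M : GoalPOMDP S A Z} {b : PMF S} (hb : M.IsGoal b) (a : A) :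
    M.cost b a = 0 := by
  refine Finset.sum_eq_zero fun s _ => ?_
  by_cases hs : s ∈ M.G
  · simp [M.goal_cost s hs a]
  · simp [hb s hs]

theorem pmf_eq_zero_of_one {α : Type*} {p : PMF α} {x y : α} (h : p x = 1) (hxy : y ≠ x) :
    p y = 0 := by
  rw [PMF.apply_eq_one_iff] at h
  by_contra hy
  have : y ∈ p.support := hy
  rw [h] at this
  exact hxy this

theorem IsGoal.succ {M : GoalPOMDP S A Z} {b : PMF S} (hb : M.IsGoal b) {a : A} {z : Z} :
    M.IsGoal (M.succ b a z) := by
  by_cases hz : M.obsProb b a z ≠ 0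
  swap
  · unfold GoalPOMDP.succ; rwa [dif_neg hz]
  intro s hs
  by_contra h
  obtain ⟨-, h2⟩ := (M.succ_apply_ne_zero_iff b a z hz s).1 h
  obtain ⟨s', h3, h4⟩ := (M.pred_ne_zero_iff b a s).1 h2
  by_cases hs' : s' ∈ M.G
  · exact h3 (pmf_eq_zero_of_one (M.goal_absorbing s' hs' a) (by rintro rfl; exact hs hs'))
  · exact h4 (hb s' hs')

/-- One observation decides: `zG` is impossible off the goal, and any other observation is
impossible on it. Hence only `M.b₀` can mix goal and non-goal states. -/
theorem isGoal_succ_or (b : PMF S) (a : A) (z : Z) (hz : M.obsProb b a z ≠ 0) :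
    M.IsGoal (M.succ b a z) ∨ ∀ g ∈ M.G, M.succ b a z g = 0 := by
  by_cases h : z = M.zG
  · left
    intro s hs
    by_contra h'
    have := ((M.succ_apply_ne_zero_iff b a z hz s).1 h').1
    rw [h] at this
    exact this (M.goal_observed_only s hs a)
  · right
    intro g hg
    by_contra h'
    exact ((M.succ_apply_ne_zero_iff b a z hz g).1 h').1
      (pmf_eq_zero_of_one (M.goal_observed g hg a) h)

/-- Reachable non-goal beliefs put at least a fixed mass outside the goal, so that every action
taken there costs at least a fixed positive amount. -/
theorem exists_cost_lower_bound [Fintype A] (hpos : ∀ s, s ∉ M.G → ∀ a, 0 < M.c s a) :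
    ∃ κ : ℝ, 0 < κ ∧ ∀ b, M.Reachable b → ¬ M.IsGoal b → ∀ a, κ ≤ (M.cost b a).toReal := by
  obtain ⟨c₀, hc₀, hc⟩ : ∃ c₀ : ℝ≥0, 0 < c₀ ∧ ∀ s, s ∉ M.G → ∀ a, c₀ ≤ M.c s a := by
    by_cases hne : ((Finset.univ : Finset (S × A)).filter fun p => p.1 ∉ M.G).Nonempty
    · obtain ⟨p, hp, hmin⟩ := Finset.exists_min_image _ (fun p : S × A => M.c p.1 p.2) hne
      refine ⟨M.c p.1 p.2, hpos _ (Finset.mem_filter.1 hp).2 _, fun s hs a => ?_⟩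
      exact hmin (s, a) (by simp [hs])
    · refine ⟨1, one_pos, fun s hs a => ?_⟩
      exact absurd ⟨(s, a), by simp [hs]⟩ hne
  have key : ∀ (b : PMF S) (a : A) (s : S), s ∉ M.G → (c₀ : ℝ) * (b s).toReal ≤
      (M.cost b a).toReal := by
    intro b a s hs
    have h1 : (c₀ : ℝ≥0∞) * b s ≤ M.cost b a :=
      le_trans (mul_le_mul_left (ENNReal.coe_le_coe.2 (hc s hs a)) _)
        (Finset.single_le_sum (f := fun s => (M.c s a : ℝ≥0∞) * b s) (fun _ _ => zero_le)
          (Finset.mem_univ s))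
    have := ENNReal.toReal_mono (M.cost_ne_top b a) h1
    simpa using this
  have key2 : ∀ (b : PMF S) (a : A), (∀ g ∈ M.G, b g = 0) → (c₀ : ℝ) ≤ (M.cost b a).toReal := by
    intro b a hb
    have h1 : (c₀ : ℝ≥0∞) ≤ M.cost b a := by
      calc (c₀ : ℝ≥0∞) = ∑ s, (c₀ : ℝ≥0∞) * b s := by rw [← Finset.mul_sum, sum_pmf, mul_one]
        _ ≤ M.cost b a := Finset.sum_le_sum fun s _ => by
            by_cases hs : s ∈ M.G
            · simp [hb s hs]
            · exact mul_le_mul_left (ENNReal.coe_le_coe.2 (hc s hs a)) _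
    have := ENNReal.toReal_mono (M.cost_ne_top b a) h1
    simpa using this
  -- Beliefs reached by at least one step have no mass on the goal unless they are goal beliefs, and
  -- there `c₀` is a bound. The start may mix both kinds of states, so its bound uses one non-goal
  -- state in its support.
  by_cases hb₀ : M.IsGoal M.b₀
  · refine ⟨c₀, by exact_mod_cast hc₀, fun b hb hg a => key2 b a ?_⟩
    cases hb with
    | start => exact absurd hb₀ hg
    | step b a z hb hz => exact (M.isGoal_succ_or b a z hz).resolve_left hg
  · unfold IsGoal at hb₀
    push Not at hb₀
    obtain ⟨s, hs, hbs⟩ := hb₀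
    have hp : 0 < (M.b₀ s).toReal := ENNReal.toReal_pos hbs (PMF.apply_ne_top _ _)
    have hc0 : (0:ℝ) < c₀ := by exact_mod_cast hc₀
    refine ⟨min c₀ (c₀ * (M.b₀ s).toReal), by positivity, fun b hb hg a => ?_⟩
    cases hb with
    | start => exact (min_le_right _ _).trans (key _ a s hs)
    | step b a' z hb hz =>
      exact (min_le_left _ _).trans (key2 _ a ((M.isGoal_succ_or b a' z hz).resolve_left hg))

theorem Reachable.succ {M : GoalPOMDP S A Z} {b : PMF S} (hb : M.Reachable b) {a : A} {z : Z}
    (hz : M.obsProb b a z ≠ 0) : M.Reachable (M.succ b a z) := .step b a z hb hz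

/-- A reachable belief is determined by a finite action–observation history, listed latest pair
first. Countability lets almost sure statements be combined over all reachable beliefs. -/
theorem countable_reachable [Finite A] [Finite Z] : {b | M.Reachable b}.Countable := by
  let f : List (A × Z) → PMF S := fun l => l.foldr (fun p b => M.succ b p.1 p.2) M.b₀
  refine (Set.countable_range f).mono fun b hb => ?_
  induction hb with
  | start => exact ⟨[], rfl⟩
  | step b a z _ _ ih =>
    obtain ⟨l, rfl⟩ := ih
    exact ⟨(a, z) :: l, rfl⟩

/-! ### Bellman's equations -/

variable [Fintype Z]

theorem costUpTo_of_isGoal (π : PMF S → A) (n : ℕ) {b : PMF S} (hb : M.IsGoal b) :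
    M.costUpTo π n b = 0 := by
  cases n <;> simp [costUpTo, hb]

theorem costUpTo_succ (π : PMF S → A) (n : ℕ) {b : PMF S} (hb : ¬ M.IsGoal b) :
    M.costUpTo π (n + 1) b =
      M.cost b (π b) + ∑ z, M.obsProb b (π b) z * M.costUpTo π n (M.succ b (π b) z) := by
  simp [costUpTo, hb]

theorem costUpTo_mono_succ (π : PMF S → A) (n : ℕ) (b : PMF S) :
    M.costUpTo π n b ≤ M.costUpTo π (n + 1) b := by
  induction n generalizing b with
  | zero => simp [costUpTo]
  | succ n ih =>
    by_cases hb : M.IsGoal b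
    · simp [M.costUpTo_of_isGoal π _ hb]
    · rw [M.costUpTo_succ π n hb, M.costUpTo_succ π (n + 1) hb]
      gcongr
      exact ih _

theorem costUpTo_mono (π : PMF S → A) (b : PMF S) : Monotone fun n => M.costUpTo π n b :=
  monotone_nat_of_le_succ fun n => M.costUpTo_mono_succ π n b

theorem costUpTo_ne_top (π : PMF S → A) (n : ℕ) (b : PMF S) : M.costUpTo π n b ≠ ∞ := by
  induction n generalizing b with
  | zero => simp [costUpTo]
  | succ n ih =>
    by_cases hb : M.IsGoal b
    · simp [M.costUpTo_of_isGoal π _ hb]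
    · rw [M.costUpTo_succ π n hb]
      exact ENNReal.add_ne_top.2 ⟨M.cost_ne_top _ _, ENNReal.sum_ne_top.2 fun z _ =>
        ENNReal.mul_ne_top (M.obsProb_ne_top _ _ _) (ih _)⟩

/-- Unrolling the inequality leaves a remainder that may be dropped because `v` is nonnegative. The
real-valued version below has no such luxury. -/
theorem costUpTo_le_of_le {D : Set (PMF S)} {v : PMF S → ℝ≥0∞} {π : PMF S → A}
    (hD : ∀ b ∈ D, ¬ M.IsGoal b → ∀ z, M.obsProb b (π b) z ≠ 0 → M.succ b (π b) z ∈ D)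
    (hv : ∀ b ∈ D, ¬ M.IsGoal b →
      M.cost b (π b) + ∑ z, M.obsProb b (π b) z * v (M.succ b (π b) z) ≤ v b)
    (n : ℕ) {b : PMF S} (hb : b ∈ D) : M.costUpTo π n b ≤ v b := by
  induction n generalizing b with
  | zero => simp [costUpTo]
  | succ n ih =>
    by_cases hg : M.IsGoal b
    · simp [M.costUpTo_of_isGoal π _ hg]
    · rw [M.costUpTo_succ π n hg]
      refine le_trans ?_ (hv b hb hg)
      refine add_le_add le_rfl (Finset.sum_le_sum fun z _ => ?_)
      by_cases hz : M.obsProb b (π b) z = 0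
      · simp [hz]
      · gcongr
        exact ih (hD b hb hg z hz)

theorem policyCost_le_of_le {D : Set (PMF S)} {v : PMF S → ℝ≥0∞} {π : PMF S → A}
    (hD : ∀ b ∈ D, ¬ M.IsGoal b → ∀ z, M.obsProb b (π b) z ≠ 0 → M.succ b (π b) z ∈ D)
    (hv : ∀ b ∈ D, ¬ M.IsGoal b →
      M.cost b (π b) + ∑ z, M.obsProb b (π b) z * v (M.succ b (π b) z) ≤ v b)
    {b : PMF S} (hb : b ∈ D) : M.policyCost π b ≤ v b :=
  iSup_le fun n => M.costUpTo_le_of_le hD hv n hb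

/-- The values of finite-horizon value iteration, started from `0`. -/
def horizonCost [Fintype A] [Nonempty A] : ℕ → PMF S → ℝ≥0∞
  | 0, _ => 0
  | n + 1, b => if M.IsGoal b then 0 else
      Finset.univ.inf' Finset.univ_nonempty fun a =>
        M.cost b a + ∑ z, M.obsProb b a z * horizonCost n (M.succ b a z)

/-- The limit of value iteration. -/
def limitCost [Fintype A] [Nonempty A] (b : PMF S) : ℝ≥0∞ := ⨆ n, M.horizonCost n b

variable [Fintype A] [Nonempty A]

theorem horizonCost_mono (b : PMF S) : Monotone fun n => M.horizonCost n b := by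
  refine monotone_nat_of_le_succ fun n => ?_
  induction n generalizing b with
  | zero => simp [horizonCost]
  | succ n ih =>
    by_cases hb : M.IsGoal b
    · simp [horizonCost, hb]
    · simp only [horizonCost, hb, if_false]
      refine Finset.le_inf' _ _ fun a _ => (Finset.inf'_le _ (Finset.mem_univ a)).trans ?_
      gcongr
      exact ih _

theorem horizonCost_le_costUpTo (π : PMF S → A) (n : ℕ) (b : PMF S) :
    M.horizonCost n b ≤ M.costUpTo π n b := by
  induction n generalizing b with
  | zero => simp [horizonCost]
  | succ n ih =>
    by_cases hb : M.IsGoal b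
    · simp [horizonCost, hb]
    · rw [M.costUpTo_succ π n hb]
      simp only [horizonCost, hb, if_false]
      refine (Finset.inf'_le _ (Finset.mem_univ (π b))).trans ?_
      gcongr
      exact ih _

theorem limitCost_le_policyCost (π : PMF S → A) (b : PMF S) :
    M.limitCost b ≤ M.policyCost π b :=
  iSup_mono fun n => M.horizonCost_le_costUpTo π n b

theorem limitCost_of_isGoal {b : PMF S} (hb : M.IsGoal b) : M.limitCost b = 0 := by
  refine le_antisymm (iSup_le fun n => ?_) zero_le
  cases n <;> simp [horizonCost, hb]

theorem limitCost_le (b : PMF S) (a : A) :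
    M.limitCost b ≤ M.cost b a + ∑ z, M.obsProb b a z * M.limitCost (M.succ b a z) := by
  refine iSup_le fun n => ?_
  cases n with
  | zero => simp [horizonCost]
  | succ n =>
    by_cases hb : M.IsGoal b
    · simp [horizonCost, hb]
    · simp only [horizonCost, hb, if_false]
      refine (Finset.inf'_le _ (Finset.mem_univ a)).trans ?_
      gcongr
      exact le_iSup (fun n => M.horizonCost n _) n

/-- By pigeonhole one action attains the finite-horizon minimum for infinitely many horizons. Along
these horizons monotone convergence passes to the limit, which exchanges the minimum with the
supremum. -/
theorem exists_le_limitCost {b : PMF S} (hb : ¬ M.IsGoal b) :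
    ∃ a, M.cost b a + ∑ z, M.obsProb b a z * M.limitCost (M.succ b a z) ≤ M.limitCost b := by
  have h1 : ∀ n, ∃ a, M.cost b a + ∑ z, M.obsProb b a z * M.horizonCost n (M.succ b a z) ≤
      M.limitCost b := by
    intro n
    obtain ⟨a, -, ha⟩ := Finset.exists_mem_eq_inf' (Finset.univ_nonempty (α := A)) fun a =>
      M.cost b a + ∑ z, M.obsProb b a z * M.horizonCost n (M.succ b a z)
    refine ⟨a, ha ▸ ?_⟩
    refine le_trans (le_of_eq ?_) (le_iSup (fun n => M.horizonCost n b) (n + 1))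
    simp [horizonCost, hb]
  choose f hf using h1
  obtain ⟨a, ha⟩ := Finite.exists_infinite_fiber f
  refine ⟨a, ?_⟩
  have hmono : ∀ z, Monotone fun n => M.obsProb b a z * M.horizonCost n (M.succ b a z) :=
    fun z m n hmn => mul_le_mul_right (M.horizonCost_mono _ hmn) _
  unfold limitCost
  simp_rw [ENNReal.mul_iSup]
  rw [ENNReal.finsetSum_iSup_of_monotone hmono, ENNReal.add_iSup]
  refine iSup_le fun n => ?_
  obtain ⟨m, hm, hnm⟩ := (Set.infinite_coe_iff.1 ha).exists_gt n
  have := hf m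
  rw [show f m = a from hm] at this
  refine le_trans ?_ this
  gcongr
  exact M.horizonCost_mono _ hnm.le

/-- The policy that is greedy for `limitCost` has `limitCost` as a supersolution, hence attains it.
Bellman's equations for `optCost` follow. -/
theorem optCost_eq_limitCost (b : PMF S) : M.optCost b = M.limitCost b := by
  refine le_antisymm ?_ (le_iInf fun π => M.limitCost_le_policyCost π b)
  have h : ∀ b, ∃ a, ¬ M.IsGoal b →
      M.cost b a + ∑ z, M.obsProb b a z * M.limitCost (M.succ b a z) ≤ M.limitCost b := by
    intro b
    by_cases hb : M.IsGoal b
    · exact ⟨Classical.arbitrary A, fun h => absurd hb h⟩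
    · obtain ⟨a, ha⟩ := M.exists_le_limitCost hb
      exact ⟨a, fun _ => ha⟩
  choose π hπ using h
  exact (iInf_le _ π).trans
    (M.policyCost_le_of_le (D := Set.univ) (fun _ _ _ _ _ => trivial) (fun b _ => hπ b) trivial)

theorem optCost_of_isGoal {b : PMF S} (hb : M.IsGoal b) : M.optCost b = 0 := by
  rw [optCost_eq_limitCost, M.limitCost_of_isGoal hb]

theorem optQ_of_isGoal {b : PMF S} (hb : M.IsGoal b) (a : A) : M.optQ b a = 0 := by
  simp [optQ, hb.cost_eq_zero, M.optCost_of_isGoal hb.succ]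

theorem optCost_le_optQ (b : PMF S) (a : A) : M.optCost b ≤ M.optQ b a := by
  simp only [optQ, optCost_eq_limitCost]
  exact M.limitCost_le b a

theorem exists_optQ_eq_optCost (b : PMF S) : ∃ a, M.optQ b a = M.optCost b := by
  by_cases hb : M.IsGoal b
  · exact ⟨Classical.arbitrary A, by rw [M.optQ_of_isGoal hb, M.optCost_of_isGoal hb]⟩
  · obtain ⟨a, ha⟩ := M.exists_le_limitCost hb
    refine ⟨a, le_antisymm ?_ (M.optCost_le_optQ b a)⟩
    simp only [optQ, optCost_eq_limitCost]
    exact ha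

/-- Policies that only take optimal actions are optimal. -/
theorem policyCost_eq_optCost {D : Set (PMF S)} {π : PMF S → A}
    (hD : ∀ b ∈ D, ¬ M.IsGoal b → ∀ z, M.obsProb b (π b) z ≠ 0 → M.succ b (π b) z ∈ D)
    (hπ : ∀ b ∈ D, ¬ M.IsGoal b → M.optQ b (π b) = M.optCost b)
    {b : PMF S} (hb : b ∈ D) : M.policyCost π b = M.optCost b :=
  le_antisymm (M.policyCost_le_of_le hD (fun b hb hg => (hπ b hb hg).le) hb) (iInf_le _ π)

end BeliefMDP

/-! ### Real-valued lookahead, with values that may be negative. -/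

section Real

variable {S A Z : Type*} [Fintype S] (M : GoalPOMDP S A Z)

/-- The optimal cost as a real number. -/
def optVal [Fintype Z] (b : PMF S) : ℝ := (M.optCost b).toReal

variable [Fintype Z]

/-- The one-step lookahead value of the action `a` at `b`, for the value function `V`. -/
def qval (V : PMF S → ℝ) (b : PMF S) (a : A) : ℝ :=
  (M.cost b a).toReal + ∑ z, (M.obsProb b a z).toReal * V (M.succ b a z)

theorem backup_eq_qval (t : Tables S A) (b : PMF S) (a : A) :
    M.backup t b a = M.qval t.V b a := rfl

theorem qval_mono {V V' : PMF S → ℝ} {b : PMF S} {a : A}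
    (h : ∀ z, M.obsProb b a z ≠ 0 → V (M.succ b a z) ≤ V' (M.succ b a z)) :
    M.qval V b a ≤ M.qval V' b a := by
  refine add_le_add le_rfl (Finset.sum_le_sum fun z _ => ?_)
  by_cases hz : M.obsProb b a z = 0
  · simp [hz]
  · exact mul_le_mul_of_nonneg_left (h z hz) ENNReal.toReal_nonneg

theorem qval_congr {V V' : PMF S → ℝ} {b : PMF S} {a : A}
    (h : ∀ z, M.obsProb b a z ≠ 0 → V (M.succ b a z) = V' (M.succ b a z)) :
    M.qval V b a = M.qval V' b a :=
  le_antisymm (M.qval_mono fun z hz => (h z hz).le) (M.qval_mono fun z hz => (h z hz).ge)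

theorem qval_const_add (V : PMF S → ℝ) (b : PMF S) (a : A) (x : ℝ) :
    M.qval (fun b' => V b' + x) b a = M.qval V b a + x := by
  simp only [qval, mul_add, Finset.sum_add_distrib, ← Finset.sum_mul, M.sum_obsProb_toReal]
  ring

theorem le_qval {V : PMF S → ℝ} {b : PMF S} {a : A} {m : ℝ}
    (h : ∀ z, M.obsProb b a z ≠ 0 → m ≤ V (M.succ b a z)) :
    (M.cost b a).toReal + m ≤ M.qval V b a := by
  have h1 : M.qval (fun _ => m) b a ≤ M.qval V b a := M.qval_mono h
  have h2 : M.qval (fun _ => m) b a = (M.cost b a).toReal + m := by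
    simp only [qval, ← Finset.sum_mul, M.sum_obsProb_toReal, one_mul]
  linarith

theorem optQ_ne_top (hfin : ∀ b, M.Reachable b → M.optCost b ≠ ∞) {b : PMF S}
    (hb : M.Reachable b) (a : A) : M.optQ b a ≠ ∞ := by
  refine ENNReal.add_ne_top.2 ⟨M.cost_ne_top _ _, ENNReal.sum_ne_top.2 fun z _ => ?_⟩
  by_cases hz : M.obsProb b a z = 0
  · simp [hz]
  · exact ENNReal.mul_ne_top (M.obsProb_ne_top _ _ _) (hfin _ (hb.succ hz))

theorem toReal_optQ (hfin : ∀ b, M.Reachable b → M.optCost b ≠ ∞) {b : PMF S}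
    (hb : M.Reachable b) (a : A) : (M.optQ b a).toReal = M.qval M.optVal b a := by
  unfold optQ qval optVal
  have h := M.optQ_ne_top hfin hb a
  unfold optQ at h
  rw [ENNReal.add_ne_top] at h
  rw [ENNReal.toReal_add h.1 h.2, ENNReal.toReal_sum (ENNReal.sum_ne_top.1 h.2)]
  simp_rw [ENNReal.toReal_mul]

theorem optVal_nonneg (b : PMF S) : 0 ≤ M.optVal b := ENNReal.toReal_nonneg

theorem optVal_le_qval [Fintype A] [Nonempty A] (hfin : ∀ b, M.Reachable b → M.optCost b ≠ ∞)
    {b : PMF S} (hb : M.Reachable b) (a : A) : M.optVal b ≤ M.qval M.optVal b a := by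
  rw [← M.toReal_optQ hfin hb]
  exact ENNReal.toReal_mono (M.optQ_ne_top hfin hb a) (M.optCost_le_optQ b a)

theorem exists_qval_eq_optVal [Fintype A] [Nonempty A]
    (hfin : ∀ b, M.Reachable b → M.optCost b ≠ ∞)
    {b : PMF S} (hb : M.Reachable b) : ∃ a, M.qval M.optVal b a = M.optVal b := by
  obtain ⟨a, ha⟩ := M.exists_optQ_eq_optCost b
  exact ⟨a, by rw [← M.toReal_optQ hfin hb, ha, optVal]⟩

theorem optQ_eq_optCost_iff (hfin : ∀ b, M.Reachable b → M.optCost b ≠ ∞)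
    {b : PMF S} (hb : M.Reachable b) (a : A) :
    M.optQ b a = M.optCost b ↔ M.qval M.optVal b a = M.optVal b := by
  rw [← M.toReal_optQ hfin hb, optVal, ENNReal.toReal_eq_toReal_iff' (M.optQ_ne_top hfin hb a)
    (hfin b hb)]

/-! ### Verification -/

/-- The probability that no goal belief is met during the first `n` steps. -/
def aliveProb (π : PMF S → A) : ℕ → PMF S → ℝ
  | 0, b => if M.IsGoal b then 0 else 1
  | n + 1, b => if M.IsGoal b then 0 else
      ∑ z, (M.obsProb b (π b) z).toReal * aliveProb π n (M.succ b (π b) z)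

theorem toReal_costUpTo_succ (π : PMF S → A) (n : ℕ) {b : PMF S} (hb : ¬ M.IsGoal b) :
    (M.costUpTo π (n + 1) b).toReal =
      M.qval (fun b' => (M.costUpTo π n b').toReal) b (π b) := by
  have h (z : Z) : M.obsProb b (π b) z * M.costUpTo π n (M.succ b (π b) z) ≠ ∞ :=
    ENNReal.mul_ne_top (M.obsProb_ne_top _ _ _) (M.costUpTo_ne_top _ _ _)
  rw [M.costUpTo_succ π n hb, ENNReal.toReal_add (M.cost_ne_top _ _)
    (ENNReal.sum_ne_top.2 fun z _ => h z), ENNReal.toReal_sum fun z _ => h z]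
  simp only [qval, ENNReal.toReal_mul]

theorem aliveProb_nonneg_le_one (π : PMF S → A) (n : ℕ) (b : PMF S) :
    0 ≤ M.aliveProb π n b ∧ M.aliveProb π n b ≤ 1 := by
  induction n generalizing b with
  | zero => unfold aliveProb; split_ifs <;> norm_num
  | succ n ih =>
    unfold aliveProb
    split_ifs
    · norm_num
    · refine ⟨Finset.sum_nonneg fun z _ => mul_nonneg ENNReal.toReal_nonneg (ih _).1, ?_⟩
      rw [← M.sum_obsProb_toReal b (π b)]
      refine Finset.sum_le_sum fun z _ => ?_
      exact mul_le_of_le_one_right ENNReal.toReal_nonneg (ih _).2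

/-- A run that misses the goal for `n` steps has paid at least `κ` in each of them. So survival has
probability of order `1 / n` relative to the expected cost. -/
theorem aliveProb_le_costUpTo {D : Set (PMF S)} {π : PMF S → A} {κ : ℝ} (hκ : 0 ≤ κ)
    (hD : ∀ b ∈ D, ¬ M.IsGoal b → ∀ z, M.obsProb b (π b) z ≠ 0 → M.succ b (π b) z ∈ D)
    (hc : ∀ b ∈ D, ¬ M.IsGoal b → κ ≤ (M.cost b (π b)).toReal)
    (n : ℕ) {b : PMF S} (hb : b ∈ D) :
    κ * n * M.aliveProb π n b ≤ (M.costUpTo π n b).toReal := by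
  induction n generalizing b with
  | zero => simp
  | succ n ih =>
    by_cases hg : M.IsGoal b
    · simp [aliveProb, hg]
    · have h1 := (M.aliveProb_nonneg_le_one π (n + 1) b).2
      have h2 : (M.cost b (π b)).toReal + κ * n * M.aliveProb π (n + 1) b ≤
          (M.costUpTo π (n + 1) b).toReal := by
        have h3 : M.qval (fun b' => κ * n * M.aliveProb π n b') b (π b) ≤
            (M.costUpTo π (n + 1) b).toReal := by
          rw [M.toReal_costUpTo_succ π n hg]
          exact M.qval_mono fun z hz => ih (hD b hb hg z hz)
        refine le_trans (le_of_eq ?_) h3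
        simp only [qval, aliveProb, hg, if_false, Finset.mul_sum]
        congr 1
        exact Finset.sum_congr rfl fun z _ => by ring
      have h4 := hc b hb hg
      push_cast
      nlinarith

/-- The inequality for `v` is unrolled `n` times. What remains is the mean of `v` over the surviving
runs, bounded below by `m` times their probability. -/
theorem scaled_costUpTo_add_le {D : Set (PMF S)} {v : PMF S → ℝ} {π : PMF S → A} {m r : ℝ}
    (hD : ∀ b ∈ D, ¬ M.IsGoal b → ∀ z, M.obsProb b (π b) z ≠ 0 → M.succ b (π b) z ∈ D)
    (hgoal : ∀ b ∈ D, M.IsGoal b → 0 ≤ v b) (hm : ∀ b ∈ D, m ≤ v b)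
    (hv : ∀ b ∈ D, ¬ M.IsGoal b →
      M.qval v b (π b) - (1 - r) * (M.cost b (π b)).toReal ≤ v b)
    (n : ℕ) {b : PMF S} (hb : b ∈ D) :
    r * (M.costUpTo π n b).toReal + m * M.aliveProb π n b ≤ v b := by
  by_cases hg : M.IsGoal b
  · have : M.aliveProb π n b = 0 := by cases n <;> simp [aliveProb, hg]
    simp [M.costUpTo_of_isGoal π n hg, this, hgoal b hb hg]
  induction n generalizing b with
  | zero => simp [costUpTo, aliveProb, hg, hm b hb]
  | succ n ih =>
    have h1 : M.qval (fun b' => r * (M.costUpTo π n b').toReal + m * M.aliveProb π n b') b (π b) ≤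
        M.qval v b (π b) := by
      refine M.qval_mono fun z hz => ?_
      have hz' := hD b hb hg z hz
      by_cases hg' : M.IsGoal (M.succ b (π b) z)
      · have : M.aliveProb π n (M.succ b (π b) z) = 0 := by cases n <;> simp [aliveProb, hg']
        simp [M.costUpTo_of_isGoal π n hg', this, hgoal _ hz' hg']
      · exact ih hz' hg'
    refine le_trans (le_of_eq ?_) ((sub_le_sub_right h1 _).trans (hv b hb hg))
    rw [M.toReal_costUpTo_succ π n hg]
    simp only [qval, aliveProb, hg, if_false, mul_add, Finset.mul_sum, Finset.sum_add_distrib]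
    have e1 : ∑ z, r * ((M.obsProb b (π b) z).toReal * (M.costUpTo π n (M.succ b (π b) z)).toReal) =
      ∑ z, (M.obsProb b (π b) z).toReal * (r * (M.costUpTo π n (M.succ b (π b) z)).toReal) :=
      Finset.sum_congr rfl fun z _ => by ring
    have e2 : ∑ z, m * ((M.obsProb b (π b) z).toReal * M.aliveProb π n (M.succ b (π b) z)) =
      ∑ z, (M.obsProb b (π b) z).toReal * (m * M.aliveProb π n (M.succ b (π b) z)) :=
      Finset.sum_congr rfl fun z _ => by ring
    rw [e1, e2]
    ring

/-- A function that is bounded below and dominates its own lookahead value under `π`, with the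
immediate costs scaled by `r`, dominates the scaled expected cost of `π`. -/
theorem policyCost_le_ofReal {D : Set (PMF S)} {v : PMF S → ℝ} {π : PMF S → A} {m r κ : ℝ}
    (hr : 0 < r) (hκ : 0 < κ)
    (hD : ∀ b ∈ D, ¬ M.IsGoal b → ∀ z, M.obsProb b (π b) z ≠ 0 → M.succ b (π b) z ∈ D)
    (hgoal : ∀ b ∈ D, M.IsGoal b → 0 ≤ v b) (hm : ∀ b ∈ D, m ≤ v b)
    (hc : ∀ b ∈ D, ¬ M.IsGoal b → κ ≤ (M.cost b (π b)).toReal)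
    (hv : ∀ b ∈ D, ¬ M.IsGoal b →
      M.qval v b (π b) - (1 - r) * (M.cost b (π b)).toReal ≤ v b)
    {b : PMF S} (hb : b ∈ D) :
    0 ≤ v b ∧ M.policyCost π b ≤ ENNReal.ofReal (v b / r) := by
  have key : ∀ k, r * (M.costUpTo π k b).toReal ≤ v b := by
    intro k
    -- By `aliveProb_le_costUpTo` the remainder is at least `min m 0 / (κ * n)` times the `n`-step
    -- cost, so it only perturbs the coefficient `r`. The minimum with `0` fixes the sign needed for
    -- this estimate. The horizon `k` is kept fixed while `n` grows, so the cost need not be known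
    -- to be finite.
    have hlim : Tendsto (fun n : ℕ => (M.costUpTo π k b).toReal * (r + min m 0 / κ * (n : ℝ)⁻¹))
        atTop (𝓝 ((M.costUpTo π k b).toReal * (r + min m 0 / κ * 0))) :=
      ((tendsto_inv_atTop_nhds_zero_nat.const_mul _).const_add _).const_mul _
    have hlim' : Tendsto (fun n : ℕ => r + min m 0 / κ * (n : ℝ)⁻¹)
        atTop (𝓝 (r + min m 0 / κ * 0)) :=
      (tendsto_inv_atTop_nhds_zero_nat.const_mul _).const_add _
    have hpos : ∀ᶠ n : ℕ in atTop, 0 < r + min m 0 / κ * (n : ℝ)⁻¹ :=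
      hlim'.eventually_const_lt (by simpa using hr)
    rw [mul_zero, add_zero, mul_comm] at hlim
    refine le_of_tendsto hlim ?_
    filter_upwards [hpos, eventually_ge_atTop k, eventually_gt_atTop 0] with n hn hkn hn0
    have h1 := M.scaled_costUpTo_add_le hD hgoal (fun b hb => (min_le_left m 0).trans (hm b hb))
      hv n hb
    have h2 := M.aliveProb_le_costUpTo hκ.le hD hc n hb
    have h3 : (M.costUpTo π k b).toReal ≤ (M.costUpTo π n b).toReal :=
      ENNReal.toReal_mono (M.costUpTo_ne_top _ _ _) (M.costUpTo_mono π b hkn)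
    have hn' : (0 : ℝ) < n := by exact_mod_cast hn0
    have h4 : M.aliveProb π n b ≤ (M.costUpTo π n b).toReal / κ * (n : ℝ)⁻¹ := by
      rw [div_mul_eq_mul_div, le_div_iff₀ hκ, ← div_eq_mul_inv, le_div_iff₀ hn']
      linarith
    have h5 : min m 0 * ((M.costUpTo π n b).toReal / κ * (n : ℝ)⁻¹) ≤
        min m 0 * M.aliveProb π n b := mul_le_mul_of_nonpos_left h4 (min_le_right _ _)
    calc (M.costUpTo π k b).toReal * (r + min m 0 / κ * (n : ℝ)⁻¹)
        ≤ (M.costUpTo π n b).toReal * (r + min m 0 / κ * (n : ℝ)⁻¹) :=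
          mul_le_mul_of_nonneg_right h3 hn.le
      _ = r * (M.costUpTo π n b).toReal +
          min m 0 * ((M.costUpTo π n b).toReal / κ * (n : ℝ)⁻¹) := by ring
      _ ≤ v b := by linarith
  have hv0 : 0 ≤ v b := by simpa [costUpTo] using key 0
  refine ⟨hv0, iSup_le fun k => ?_⟩
  rw [ENNReal.le_ofReal_iff_toReal_le (M.costUpTo_ne_top _ _ _) (div_nonneg hv0 hr.le),
    le_div_iff₀ hr, mul_comm]
  exact key k

/-- A bounded function that dominates its own lookahead value under `π` dominates the
expected cost of `π`. -/
theorem policyCost_le_ofReal_of_qval_le {D : Set (PMF S)} {v : PMF S → ℝ} {π : PMF S → A} {m κ : ℝ}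
    (hκ : 0 < κ)
    (hD : ∀ b ∈ D, ¬ M.IsGoal b → ∀ z, M.obsProb b (π b) z ≠ 0 → M.succ b (π b) z ∈ D)
    (hgoal : ∀ b ∈ D, M.IsGoal b → 0 ≤ v b) (hm : ∀ b ∈ D, m ≤ v b)
    (hc : ∀ b ∈ D, ¬ M.IsGoal b → κ ≤ (M.cost b (π b)).toReal)
    (hv : ∀ b ∈ D, ¬ M.IsGoal b → M.qval v b (π b) ≤ v b)
    {b : PMF S} (hb : b ∈ D) : 0 ≤ v b ∧ M.policyCost π b ≤ ENNReal.ofReal (v b) := by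
  have := M.policyCost_le_ofReal one_pos hκ hD hgoal hm hc (by simpa using hv) hb
  simpa using this

/-! ### Asynchronous value iteration -/

/-- A maximum principle for lookahead values. -/
theorem le_of_forall_qval {J : Set (PMF S)} (hJ : J.Finite) {u v : PMF S → ℝ} {κ : ℝ}
    (hκ : 0 < κ) (hc : ∀ b ∈ J, ∀ a : A, κ ≤ (M.cost b a).toReal)
    (hout : ∀ b, b ∉ J → u b ≤ v b)
    (h : ∀ b ∈ J, u b ≤ v b ∨ ∃ a, M.qval v b a ≤ v b ∧ u b ≤ M.qval u b a) (b : PMF S) :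
    u b ≤ v b := by
  by_contra hlt
  push Not at hlt
  have hbJ : b ∈ J := by
    by_contra hb
    exact absurd (hout b hb) (not_le.2 hlt)
  obtain ⟨b₁, hb₁, hmax⟩ := Set.exists_max_image J (fun b => u b - v b) hJ ⟨b, hbJ⟩
  have hpos : 0 < u b₁ - v b₁ := lt_of_lt_of_le (sub_pos.2 hlt) (hmax b hbJ)
  have hmax' : ∀ b', u b' - v b' ≤ u b₁ - v b₁ := by
    intro b'
    by_cases hb' : b' ∈ J
    · exact hmax b' hb'
    · linarith [hout b' hb']
  -- Among the maximisers of `u - v`, one with least `v` is taken. Averaging forces its possible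
  -- successors to be maximisers too, so `v` is no smaller there, and the positive cost contradicts
  -- `M.qval v b₂ a ≤ v b₂`.
  obtain ⟨b₂, hb₂, hmin⟩ := Set.exists_min_image {b' ∈ J | u b' - v b' = u b₁ - v b₁} v
    (hJ.subset fun _ h => h.1) ⟨b₁, hb₁, rfl⟩
  rcases h b₂ hb₂.1 with h1 | ⟨a, h1, h2⟩
  · linarith [hb₂.2]
  · have hsum : ∑ z, (M.obsProb b₂ a z).toReal *
        ((u b₁ - v b₁) - (u (M.succ b₂ a z) - v (M.succ b₂ a z))) ≤ 0 := by
      simp only [mul_sub, Finset.sum_sub_distrib, ← Finset.sum_mul, M.sum_obsProb_toReal]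
      simp only [qval] at h1 h2
      linarith [hb₂.2]
    have hnn : ∀ z ∈ Finset.univ, 0 ≤ (M.obsProb b₂ a z).toReal *
        ((u b₁ - v b₁) - (u (M.succ b₂ a z) - v (M.succ b₂ a z))) := fun z _ =>
      mul_nonneg ENNReal.toReal_nonneg (sub_nonneg.2 (hmax' _))
    have hzero := (Finset.sum_eq_zero_iff_of_nonneg hnn).1
      (le_antisymm hsum (Finset.sum_nonneg hnn))
    have hle : ∀ z, M.obsProb b₂ a z ≠ 0 → v b₂ ≤ v (M.succ b₂ a z) := by
      intro z hz
      have hz' := (mul_eq_zero.1 (hzero z (Finset.mem_univ z))).resolve_left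
        (ENNReal.toReal_ne_zero.2 ⟨hz, M.obsProb_ne_top _ _ _⟩)
      refine hmin _ ⟨?_, by linarith⟩
      by_contra hzJ
      linarith [hout _ hzJ]
    linarith [M.le_qval hle, hc b₂ hb₂.1 a]

end Real

/-- A property that is acquired at the changes of a sequence eventually holds for good. -/
theorem _root_.eventually_of_forall_change {α : Type*} {X : ℕ → α} {P : α → Prop} {C : ℕ → Prop}
    (hstep : ∀ᶠ n in atTop, X (n + 1) = X n ∨ C n) (hC : ∃ᶠ n in atTop, C n)
    (hP : ∀ᶠ n in atTop, C n → P (X (n + 1))) : ∀ᶠ n in atTop, P (X n) := by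
  obtain ⟨N, hN⟩ := eventually_atTop.1 (hstep.and hP)
  obtain ⟨k, hk, hCk⟩ := (frequently_atTop.1 hC) N
  refine eventually_atTop.2 ⟨k + 1, fun n hn => ?_⟩
  induction n, hn using Nat.le_induction with
  | base => exact (hN k hk).2 hCk
  | succ n hn ih =>
    rcases (hN n (by omega)).1 with h | h
    · rwa [h]
    · exact (hN n (by omega)).2 h

section Async

variable {S A Z : Type*} [Fintype S] (M : GoalPOMDP S A Z) [Fintype Z]

theorem eventually_qval_le {V : ℕ → PMF S → ℝ} {u : PMF S → ℝ} {b : PMF S} {a : A} {η : ℝ}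
    (h : ∀ z, M.obsProb b a z ≠ 0 → ∀ᶠ n in atTop, V n (M.succ b a z) ≤ u (M.succ b a z) + η) :
    ∀ᶠ n in atTop, M.qval (V n) b a ≤ M.qval u b a + η := by
  have : ∀ᶠ n in atTop, ∀ z, M.obsProb b a z ≠ 0 → V n (M.succ b a z) ≤ u (M.succ b a z) + η :=
    eventually_all.2 fun z => by
      by_cases hz : M.obsProb b a z = 0
      · simp [hz]
      · simpa [hz] using h z hz
  filter_upwards [this] with n hn
  rw [← M.qval_const_add]
  exact M.qval_mono hn

theorem eventually_le_qval {V : ℕ → PMF S → ℝ} {u : PMF S → ℝ} {b : PMF S} {a : A} {η : ℝ}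
    (h : ∀ z, M.obsProb b a z ≠ 0 → ∀ᶠ n in atTop, u (M.succ b a z) - η ≤ V n (M.succ b a z)) :
    ∀ᶠ n in atTop, M.qval u b a - η ≤ M.qval (V n) b a := by
  have : ∀ᶠ n in atTop, ∀ z, M.obsProb b a z ≠ 0 → u (M.succ b a z) + -η ≤ V n (M.succ b a z) :=
    eventually_all.2 fun z => by
      by_cases hz : M.obsProb b a z = 0
      · simp [hz]
      · simpa [hz, sub_eq_add_neg] using h z hz
  filter_upwards [this] with n hn
  rw [sub_eq_add_neg, ← M.qval_const_add]
  exact M.qval_mono hn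

theorem tendsto_qval {V : ℕ → PMF S → ℝ} {u : PMF S → ℝ} {b : PMF S} {a : A}
    (h : ∀ z, M.obsProb b a z ≠ 0 →
      Tendsto (fun n => V n (M.succ b a z)) atTop (𝓝 (u (M.succ b a z)))) :
    Tendsto (fun n => M.qval (V n) b a) atTop (𝓝 (M.qval u b a)) := by
  refine tendsto_const_nhds.add (tendsto_finsetSum _ fun z _ => ?_)
  by_cases hz : M.obsProb b a z = 0
  · simp [hz]
  · exact (h z hz).const_mul _

theorem _root_.eventually_le_limsup_add {X : ℕ → ℝ} {hi η : ℝ} (hX : ∀ᶠ n in atTop, X n ≤ hi)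
    (hη : 0 < η) : ∀ᶠ n in atTop, X n ≤ limsup X atTop + η :=
  (eventually_lt_of_limsup_lt (lt_add_of_pos_right _ hη)
    ⟨hi, eventually_map.2 hX⟩).mono fun _ h => h.le

theorem _root_.eventually_liminf_sub_le {X : ℕ → ℝ} {lo η : ℝ} (hX : ∀ᶠ n in atTop, lo ≤ X n)
    (hη : 0 < η) : ∀ᶠ n in atTop, liminf X atTop - η ≤ X n :=
  (eventually_lt_of_lt_liminf (sub_lt_self _ hη)
    ⟨lo, eventually_map.2 hX⟩).mono fun _ h => h.le

/-- The Q-values computed from the values `V`, when only the actions in `E` have been evaluated. -/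
def partialQ (E : Set (PMF S × A)) (q : PMF S → A → ℝ) (V : PMF S → ℝ) (b : PMF S) (a : A) : ℝ :=
  if (b, a) ∈ E then M.qval V b a else q b a

/-- Asynchronous value iteration converges, if it is bounded and every belief of a finite set is
backed up infinitely often. -/
theorem exists_tendsto_of_backups [Finite A] [Nonempty A] {J : Set (PMF S)} (hJ : J.Finite) {κ : ℝ}
    (hκ : 0 < κ) (hc : ∀ b ∈ J, ∀ a : A, κ ≤ (M.cost b a).toReal)
    (E : Set (PMF S × A)) (q : PMF S → A → ℝ) (V : ℕ → PMF S → ℝ) (C : PMF S → ℕ → Prop)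
    (hout : ∀ b, b ∉ J → ∀ᶠ n in atTop, V (n + 1) b = V n b)
    (hstep : ∀ b ∈ J, ∀ᶠ n in atTop, V (n + 1) b = V n b ∨ C b n)
    (hC : ∀ b ∈ J, ∃ᶠ n in atTop, C b n)
    (hle : ∀ b ∈ J, ∀ᶠ n in atTop, C b n → ∀ a, V (n + 1) b ≤ M.partialQ E q (V n) b a)
    (hge : ∀ b ∈ J, ∀ᶠ n in atTop, C b n → ∃ a, M.partialQ E q (V n) b a ≤ V (n + 1) b)
    (hlo : ∀ b ∈ J, ∃ lo, ∀ᶠ n in atTop, lo ≤ V n b)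
    (hhi : ∀ b ∈ J, ∃ hi, ∀ᶠ n in atTop, V n b ≤ hi) :
    ∃ L : PMF S → ℝ, ∀ b, Tendsto (fun n => V n b) atTop (𝓝 (L b)) := by
  have hconst : ∀ b, b ∉ J → ∃ x, ∀ᶠ n in atTop, V n b = x := by
    intro b hb
    obtain ⟨N, hN⟩ := eventually_atTop.1 (hout b hb)
    refine ⟨V N b, eventually_atTop.2 ⟨N, fun n hn => ?_⟩⟩
    induction n, hn using Nat.le_induction with
    | base => rfl
    | succ n hn ih => rw [hN n hn, ih]
  have hlo' : ∀ b, ∃ lo, ∀ᶠ n in atTop, lo ≤ V n b := fun b => by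
    by_cases hb : b ∈ J
    · exact hlo b hb
    · obtain ⟨x, hx⟩ := hconst b hb
      exact ⟨x, hx.mono fun n hn => hn.ge⟩
  have hhi' : ∀ b, ∃ hi, ∀ᶠ n in atTop, V n b ≤ hi := fun b => by
    by_cases hb : b ∈ J
    · exact hhi b hb
    · obtain ⟨x, hx⟩ := hconst b hb
      exact ⟨x, hx.mono fun n hn => hn.le⟩
  have hbd : ∀ b, IsBoundedUnder (· ≤ ·) atTop fun n => V n b := fun b => by
    obtain ⟨x, hx⟩ := hhi' b
    exact ⟨x, eventually_map.2 hx⟩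
  have hbd' : ∀ b, IsBoundedUnder (· ≥ ·) atTop fun n => V n b := fun b => by
    obtain ⟨x, hx⟩ := hlo' b
    exact ⟨x, eventually_map.2 hx⟩
  -- The limsup is a subsolution for every action and the liminf a supersolution for some action.
  -- The maximum principle then gives `u ≤ v`, which is convergence.
  set u : PMF S → ℝ := fun b => limsup (fun n => V n b) atTop with hu
  set v : PMF S → ℝ := fun b => liminf (fun n => V n b) atTop with hv
  have hu1 : ∀ b, ∀ η > 0, ∀ᶠ n in atTop, V n b ≤ u b + η := fun b η hη => by
    obtain ⟨x, hx⟩ := hhi' b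
    exact eventually_le_limsup_add hx hη
  have hv1 : ∀ b, ∀ η > 0, ∀ᶠ n in atTop, v b - η ≤ V n b := fun b η hη => by
    obtain ⟨x, hx⟩ := hlo' b
    exact eventually_liminf_sub_le hx hη
  have hu2 : ∀ b ∈ J, ∀ a, u b ≤ M.partialQ E q u b a := by
    intro b hb a
    refine le_of_forall_pos_le_add fun η hη => ?_
    refine limsup_le_of_le (hbd' b).isCoboundedUnder_le ?_
    refine eventually_of_forall_change (X := fun n => V n b) (P := fun x => x ≤ _)
      (hstep b hb) (hC b hb) ?_
    have h1 : ∀ᶠ n in atTop, M.partialQ E q (V n) b a ≤ M.partialQ E q u b a + η := by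
      unfold partialQ
      split_ifs
      · exact M.eventually_qval_le fun z _ => hu1 _ η hη
      · exact Eventually.of_forall fun n => by linarith
    filter_upwards [hle b hb, h1] with n hn h1 hCn
    exact (hn hCn a).trans h1
  have hv2 : ∀ b ∈ J, ∃ a, M.partialQ E q v b a ≤ v b := by
    intro b hb
    obtain ⟨a, ha⟩ := Finite.exists_min (fun a => M.partialQ E q v b a)
    refine ⟨a, le_of_forall_sub_le fun η hη => ?_⟩
    refine le_liminf_of_le (hbd b).isCoboundedUnder_ge ?_
    refine eventually_of_forall_change (X := fun n => V n b) (P := fun x => _ ≤ x)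
      (hstep b hb) (hC b hb) ?_
    have h1 : ∀ᶠ n in atTop, ∀ a, M.partialQ E q v b a - η ≤ M.partialQ E q (V n) b a := by
      refine eventually_all.2 fun a => ?_
      unfold partialQ
      split_ifs
      · exact M.eventually_le_qval fun z _ => hv1 _ η hη
      · exact Eventually.of_forall fun n => by linarith
    filter_upwards [hge b hb, h1] with n hn h1 hCn
    obtain ⟨a', ha'⟩ := hn hCn
    linarith [ha a', h1 a']
  have huv : ∀ b, u b ≤ v b := by
    refine M.le_of_forall_qval hJ hκ hc (fun b hb => ?_) (fun b hb => ?_)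
    · obtain ⟨x, hx⟩ := hconst b hb
      have : Tendsto (fun n => V n b) atTop (𝓝 x) :=
        tendsto_const_nhds.congr' (hx.mono fun n hn => hn.symm)
      simp only [hu, hv, this.limsup_eq, this.liminf_eq, le_refl]
    · obtain ⟨a, ha⟩ := hv2 b hb
      have ha' := hu2 b hb a
      -- The Q-value of an unevaluated action is a constant, here squeezed between `u b` and `v b`,
      -- so no lookahead is needed in that case.
      by_cases hE : (b, a) ∈ E
      · simp only [partialQ, hE, if_true] at ha ha'
        exact Or.inr ⟨a, ha, ha'⟩
      · simp only [partialQ, hE, if_false] at ha ha'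
        exact Or.inl (ha'.trans ha)
  exact ⟨u, fun b => tendsto_of_le_liminf_of_limsup_le (huv b) le_rfl (hbd b) (hbd' b)⟩

end Async

/-! ### Elementary table operations and their invariants. -/

section TableOps

variable {S A Z : Type*} [Fintype S] (M : GoalPOMDP S A Z) [Fintype Z]
  {sel : PMF S → (A → ℝ) → A}

theorem updateQ_Q_self (t : Tables S A) (b : PMF S) (a : A) :
    (M.updateQ t b).Q b a = M.partialQ t.ev t.Q t.V b a := by
  simp [updateQ, partialQ, backup_eq_qval]

theorem updateQ_Q_of_ne (t : Tables S A) {b b' : PMF S} (h : b' ≠ b) :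
    (M.updateQ t b).Q b' = t.Q b' := by
  simp [updateQ, h]

theorem updateQ_V (t : Tables S A) (b : PMF S) : (M.updateQ t b).V = t.V := rfl

theorem updateQ_ev (t : Tables S A) (b : PMF S) : (M.updateQ t b).ev = t.ev := rfl

theorem setV_V_self (t : Tables S A) (b : PMF S) (a : A) : (setV t b a).V b = t.Q b a := by
  simp [setV]

theorem setV_V_of_ne (t : Tables S A) {b b' : PMF S} (a : A) (h : b' ≠ b) :
    (setV t b a).V b' = t.V b' := by
  simp [setV, h]

theorem best_congr {t t' : Tables S A} {b : PMF S} (h : t.Q b = t'.Q b) :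
    best sel t b = best sel t' b := by
  unfold best; rw [h]

theorem best_setV (t : Tables S A) (b b' : PMF S) (a : A) :
    best sel (setV t b a) b' = best sel t b' := rfl

theorem lazyBody_Q_of_ne (t : Tables S A) {b b' : PMF S} (h : b' ≠ b) :
    (M.lazyBody sel t b).Q b' = t.Q b' :=
  M.updateQ_Q_of_ne _ h

theorem lazyBody_Q_self (t : Tables S A) (b : PMF S) (a : A) :
    (M.lazyBody sel t b).Q b a = M.partialQ (insert (b, best sel t b) t.ev) t.Q t.V b a :=
  M.updateQ_Q_self _ b a

theorem lazyBody_Q_best (t : Tables S A) (b : PMF S) :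
    (M.lazyBody sel t b).Q b (best sel t b) = M.qval t.V b (best sel t b) := by
  rw [lazyBody_Q_self, partialQ, if_pos (Set.mem_insert _ _)]

theorem updateQ_updateQ (t : Tables S A) (b : PMF S) :
    M.updateQ (M.updateQ t b) b = M.updateQ t b := by
  have : (M.updateQ (M.updateQ t b) b).Q = (M.updateQ t b).Q := by
    funext b' a
    by_cases h : b' = b
    · subst h
      rw [updateQ_Q_self, updateQ_ev, updateQ_V]
      simp only [partialQ, updateQ_Q_self]
      split_ifs <;> rfl
    · rw [M.updateQ_Q_of_ne _ h]
  show Tables.mk _ (M.updateQ (M.updateQ t b) b).Q _ = _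
  rw [this]

/-- The body of the do-while loop changes nothing the second time, unless it evaluates a new
action. -/
theorem lazyBody_lazyBody {t : Tables S A} {b : PMF S}
    (h : (b, best sel (M.lazyBody sel t b) b) ∈ (M.lazyBody sel t b).ev) :
    M.lazyBody sel (M.lazyBody sel t b) b = M.lazyBody sel t b := by
  have h1 : evaluate (M.lazyBody sel t b) b (best sel (M.lazyBody sel t b) b) =
      M.lazyBody sel t b := by
    unfold evaluate
    rw [Set.insert_eq_of_mem h]
  conv_lhs => rw [lazyBody, h1]
  exact M.updateQ_updateQ _ b

/-- The elementary operations on the tables. -/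
inductive TableOp (sel : PMF S → (A → ℝ) → A) : Tables S A → Tables S A → Prop
  | evaluate (t : Tables S A) (b : PMF S) (a : A) : TableOp sel t (evaluate t b a)
  | updateQ (t : Tables S A) (b : PMF S) : TableOp sel t (M.updateQ t b)
  | setV (t : Tables S A) (b : PMF S) (hb : ¬ M.IsGoal b) :
      TableOp sel t (setV t b (best sel t b))

/-- The second table arises from the first by elementary operations. -/
def TableOps (sel : PMF S → (A → ℝ) → A) : Tables S A → Tables S A → Prop :=
  Relation.ReflTransGen (M.TableOp sel)

theorem tableOps_lazyBody (t : Tables S A) (b : PMF S) :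
    M.TableOps sel t (M.lazyBody sel t b) :=
  (Relation.ReflTransGen.single (.evaluate t b _)).tail (.updateQ _ b)

theorem tableOps_setV_lazyBody {t : Tables S A} {b : PMF S} (hb : ¬ M.IsGoal b)
    (h : best sel (M.lazyBody sel t b) b = best sel t b) :
    M.TableOps sel t (setV (M.lazyBody sel t b) b (best sel t b)) := by
  rw [← h]
  exact (M.tableOps_lazyBody t b).tail (.setV _ b hb)

theorem tableOps_setV_updateQ {t : Tables S A} {b : PMF S} (hb : ¬ M.IsGoal b) :
    M.TableOps sel t (setV (M.updateQ t b) b (best sel (M.updateQ t b) b)) :=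
  (Relation.ReflTransGen.single (.updateQ t b)).tail (.setV _ b hb)

theorem TableOps.ev_subset {M : GoalPOMDP S A Z} {t t' : Tables S A} (h : M.TableOps sel t t') :
    t.ev ⊆ t'.ev := by
  induction h with
  | refl => exact subset_rfl
  | tail _ h ih =>
    refine ih.trans ?_
    cases h with
    | evaluate => exact Set.subset_insert _ _
    | updateQ => exact subset_rfl
    | setV => exact subset_rfl

/-- The tables hold underestimates, the value of goal beliefs is `0`, and the Q-values of the
actions that have not been evaluated are the initial ones. -/
structure Admissible (Qinit : PMF S → A → ℝ) (t : Tables S A) : Prop where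
  V_le : ∀ b, M.Reachable b → t.V b ≤ M.optVal b
  Q_le : ∀ b, M.Reachable b → ∀ a, t.Q b a ≤ M.qval M.optVal b a
  V_goal : ∀ b, M.IsGoal b → t.V b = 0
  Q_unevaluated : ∀ b a, (b, a) ∉ t.ev → t.Q b a = Qinit b a

theorem _root_.le_toReal_of_coe_le {x : ℝ} {y : ℝ≥0∞} (h : (x : EReal) ≤ (y : EReal))
    (hy : y ≠ ∞) : x ≤ y.toReal := by
  lift y to ℝ≥0 using hy
  rw [EReal.coe_nnreal_eq_coe_real] at h
  exact EReal.coe_le_coe_iff.1 h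

theorem admissible_startTables [Fintype A] [Nonempty A]
    (hfin : ∀ b, M.Reachable b → M.optCost b ≠ ∞) {Qinit : PMF S → A → ℝ} {heur : PMF S → ℝ}
    (hQ : ∀ b a, ((Qinit b a : ℝ) : EReal) ≤ ((M.optQ b a : ℝ≥0∞) : EReal))
    (hheur : ∀ b, ((heur b : ℝ) : EReal) ≤ ((M.optCost b : ℝ≥0∞) : EReal)) :
    M.Admissible Qinit (M.startTables Qinit heur) where
  V_le b hb := by
    unfold startTables
    dsimp only
    split_ifs with hg
    · exact M.optVal_nonneg b
    · exact le_toReal_of_coe_le (hheur b) (hfin b hb)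
  Q_le b hb a := by
    rw [← M.toReal_optQ hfin hb]
    exact le_toReal_of_coe_le (hQ b a) (M.optQ_ne_top hfin hb a)
  V_goal b hb := if_pos hb
  Q_unevaluated b a _ := rfl

theorem partialQ_le_of_admissible {Qinit : PMF S → A → ℝ} {t : Tables S A}
    (ht : M.Admissible Qinit t) {b : PMF S} (hb : M.Reachable b) (a : A) :
    M.partialQ t.ev t.Q t.V b a ≤ M.qval M.optVal b a := by
  unfold partialQ
  split_ifs
  · exact M.qval_mono fun z hz => ht.V_le _ (hb.succ hz)
  · exact ht.Q_le b hb a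

theorem Admissible.partialQ_eq {M : GoalPOMDP S A Z} {Qinit : PMF S → A → ℝ} {t : Tables S A}
    (ht : M.Admissible Qinit t) :
    M.partialQ t.ev t.Q t.V = M.partialQ t.ev Qinit t.V := by
  funext b a
  unfold partialQ
  split_ifs with h
  · rfl
  · exact ht.Q_unevaluated b a h

/-- The minimiser is compared with an optimal action. Lazy evaluation does no harm here, since
unevaluated actions carry underestimates as well. -/
theorem Admissible.best_le [Fintype A] [Nonempty A] {M : GoalPOMDP S A Z}
    (hfin : ∀ b, M.Reachable b → M.optCost b ≠ ∞) (hsel : ∀ b (q : A → ℝ) a, q (sel b q) ≤ q a)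
    {Qinit : PMF S → A → ℝ} {t : Tables S A} (ht : M.Admissible Qinit t) {b : PMF S}
    (hb : M.Reachable b) : t.Q b (best sel t b) ≤ M.optVal b := by
  obtain ⟨a, ha⟩ := M.exists_qval_eq_optVal hfin hb
  rw [← ha]
  exact (hsel b _ a).trans (ht.Q_le b hb a)

theorem Admissible.tableOps [Fintype A] [Nonempty A] {M : GoalPOMDP S A Z}
    (hfin : ∀ b, M.Reachable b → M.optCost b ≠ ∞) (hsel : ∀ b (q : A → ℝ) a, q (sel b q) ≤ q a)
    {Qinit : PMF S → A → ℝ} {t t' : Tables S A} (ht : M.Admissible Qinit t)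
    (h : M.TableOps sel t t') : M.Admissible Qinit t' := by
  induction h with
  | refl => exact ht
  | @tail t t' _ h ht =>
    cases h with
    | evaluate b a =>
      exact ⟨ht.V_le, ht.Q_le, ht.V_goal, fun b' a' h =>
        ht.Q_unevaluated b' a' fun h' => h (Set.mem_insert_of_mem _ h')⟩
    | updateQ b =>
      refine ⟨ht.V_le, fun b' hb' a => ?_, ht.V_goal, fun b' a h => ?_⟩
      · by_cases hbb : b' = b
        · subst hbb
          rw [updateQ_Q_self]
          exact M.partialQ_le_of_admissible ht hb' a
        · rw [M.updateQ_Q_of_ne _ hbb]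
          exact ht.Q_le b' hb' a
      · by_cases hbb : b' = b
        · subst hbb
          rw [updateQ_Q_self, partialQ, if_neg (show (b', a) ∉ t.ev from h)]
          exact ht.Q_unevaluated b' a h
        · rw [M.updateQ_Q_of_ne _ hbb]
          exact ht.Q_unevaluated b' a h
    | setV b hb =>
      refine ⟨fun b' hb' => ?_, ht.Q_le, fun b' hb' => ?_, ht.Q_unevaluated⟩
      · by_cases hbb : b' = b
        · subst hbb
          rw [setV_V_self]
          exact ht.best_le hfin hsel hb'
        · rw [setV_V_of_ne _ _ hbb]
          exact ht.V_le b' hb'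
      · rw [setV_V_of_ne _ _ fun h : b' = b => hb (h ▸ hb')]
        exact ht.V_goal b' hb'

/-- All values and Q-values of reachable beliefs are at least `m`. -/
def BoundedBelow (m : ℝ) (t : Tables S A) : Prop :=
  ∀ b, M.Reachable b → m ≤ t.V b ∧ ∀ a, m ≤ t.Q b a

/-- A backup averages values and adds a nonnegative cost, so it cannot break a common lower bound.
This supplies the lower bound required by verification in the limit. -/
theorem BoundedBelow.tableOps {M : GoalPOMDP S A Z} {m : ℝ} {t t' : Tables S A}
    (ht : M.BoundedBelow m t) (h : M.TableOps sel t t') : M.BoundedBelow m t' := by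
  induction h with
  | refl => exact ht
  | @tail t t' _ h ht =>
    cases h with
    | evaluate b a => exact ht
    | updateQ b =>
      refine fun b' hb' => ⟨(ht b' hb').1, fun a => ?_⟩
      by_cases hbb : b' = b
      · subst hbb
        rw [updateQ_Q_self, partialQ]
        split_ifs
        · have h0 : 0 ≤ (M.cost b' a).toReal := ENNReal.toReal_nonneg
          linarith [M.le_qval (a := a) fun z hz => (ht _ (hb'.succ hz)).1]
        · exact (ht b' hb').2 a
      · rw [M.updateQ_Q_of_ne _ hbb]
        exact (ht b' hb').2 a
    | setV b hb =>
      refine fun b' hb' => ⟨?_, (ht b' hb').2⟩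
      by_cases hbb : b' = b
      · subst hbb
        rw [setV_V_self]
        exact (ht b' hb').2 _
      · rw [setV_V_of_ne _ _ hbb]
        exact (ht b' hb').1

/-- The `0` in the minimum accounts for goal beliefs, whose initial value ignores `heur`. -/
theorem boundedBelow_startTables {Qinit : PMF S → A → ℝ} {heur : PMF S → ℝ} {m : ℝ}
    (h : ∀ b, M.Reachable b → m ≤ heur b ∧ ∀ a, m ≤ Qinit b a) :
    M.BoundedBelow (min m 0) (M.startTables Qinit heur) := by
  refine fun b hb => ⟨?_, fun a => (min_le_left _ _).trans ((h b hb).2 a)⟩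
  unfold startTables
  dsimp only
  split_ifs
  · exact min_le_right _ _
  · exact (min_le_left _ _).trans (h b hb).1

theorem exists_lower_bound_of_finite [Finite A] (hR : {b | M.Reachable b}.Finite)
    (Qinit : PMF S → A → ℝ) (heur : PMF S → ℝ) :
    ∃ m : ℝ, ∀ b, M.Reachable b → m ≤ heur b ∧ ∀ a, m ≤ Qinit b a := by
  obtain ⟨m₁, h₁⟩ := (hR.image heur).bddBelow
  obtain ⟨m₂, h₂⟩ := ((hR.prod Set.finite_univ).image
    fun p : PMF S × A => Qinit p.1 p.2).bddBelow
  refine ⟨min m₁ m₂, fun b hb => ⟨(min_le_left _ _).trans (h₁ ⟨b, hb, rfl⟩), fun a =>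
    (min_le_right _ _).trans (h₂ ⟨(b, a), ⟨hb, trivial⟩, rfl⟩)⟩⟩

end TableOps

/-- A sequence of sets that increases is eventually constant on each finite family of points. -/
theorem _root_.eventually_mem_of_mem_succ {α β : Type*} [Finite β] {E : ℕ → Set α}
    (hE : Monotone E) (f : β → α) : ∀ᶠ n in atTop, ∀ k, ∀ i, f i ∈ E k → f i ∈ E n := by
  have : ∀ᶠ n in atTop, ∀ i, ∀ k, f i ∈ E k → f i ∈ E n := by
    refine eventually_all.2 fun i => ?_
    by_cases h : ∃ k, f i ∈ E k
    · obtain ⟨k, hk⟩ := h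
      filter_upwards [eventually_ge_atTop k] with n hn _ _
      exact hE hn hk
    · push Not at h
      exact Eventually.of_forall fun n k hk => absurd hk (h k)
  exact this.mono fun n hn k i => hn i k

/-! ### Lazy RTDP-Bel: a fixed sequence of visited beliefs -/

section RTDPPath

variable {S A Z : Type*} [Fintype S] (M : GoalPOMDP S A Z) [Fintype Z]
  (sel : PMF S → (A → ℝ) → A)

/-- The do-while loop at `b` ends with the action `a`. -/
def Acts (t : Tables S A) (b : PMF S) (a : A) : Prop :=
  ¬ M.IsGoal b ∧ best sel t b = a ∧ best sel (M.lazyBody sel t b) b = a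

/-- A step of Lazy RTDP-Bel, with the simulated state left out. -/
inductive VisibleStep : Tables S A → PMF S → Tables S A → PMF S → Prop
  | restart (t : Tables S A) (b : PMF S) (hb : M.IsGoal b) : VisibleStep t b t M.b₀
  | again (t : Tables S A) (b : PMF S) (hb : ¬ M.IsGoal b)
      (h : best sel (M.lazyBody sel t b) b ≠ best sel t b) :
      VisibleStep t b (M.lazyBody sel t b) b
  | act (t : Tables S A) (b : PMF S) (hb : ¬ M.IsGoal b)
      (h : best sel (M.lazyBody sel t b) b = best sel t b) (z : Z)
      (hz : M.obsProb b (best sel t b) z ≠ 0) :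
      VisibleStep t b (setV (M.lazyBody sel t b) b (best sel t b)) (M.succ b (best sel t b) z)

/-- A fair sequence of tables and beliefs produced by Lazy RTDP-Bel: if the planner acts
infinitely often from a belief by some action, all possible successors occur infinitely often. -/
structure IsFairPath (t : ℕ → Tables S A) (b : ℕ → PMF S) : Prop where
  start : b 0 = M.b₀
  step : ∀ n, M.VisibleStep sel (t n) (b n) (t (n + 1)) (b (n + 1))
  fair : ∀ b' a z, M.Reachable b' → M.obsProb b' a z ≠ 0 →
    (∃ᶠ n in atTop, b n = b' ∧ M.Acts sel (t n) b' a) → ∃ᶠ n in atTop, b n = M.succ b' a z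

variable {M sel}

theorem VisibleStep.tableOps {t t' : Tables S A} {b b' : PMF S}
    (h : M.VisibleStep sel t b t' b') : M.TableOps sel t t' := by
  cases h with
  | restart => exact .refl
  | again => exact M.tableOps_lazyBody _ _
  | act hb h => exact M.tableOps_setV_lazyBody hb h

theorem VisibleStep.reachable {t t' : Tables S A} {b b' : PMF S}
    (h : M.VisibleStep sel t b t' b') (hb : M.Reachable b) : M.Reachable b' := by
  cases h with
  | restart => exact .start
  | again => exact hb
  | act _ _ z hz => exact hb.succ hz

theorem VisibleStep.eq_start {t t' : Tables S A} {b b' : PMF S}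
    (h : M.VisibleStep sel t b t' b') (hb : M.IsGoal b) : b' = M.b₀ := by
  cases h with
  | restart => rfl
  | again hb' => exact absurd hb hb'
  | act hb' => exact absurd hb hb'

theorem VisibleStep.V_eq_or {t t' : Tables S A} {b b' : PMF S}
    (h : M.VisibleStep sel t b t' b') (d : PMF S) :
    t'.V d = t.V d ∨ b = d ∧ ∃ a, M.Acts sel t d a := by
  cases h with
  | restart => exact Or.inl rfl
  | again => exact Or.inl rfl
  | act hb h =>
    by_cases hd : d = b
    · subst hd
      exact Or.inr ⟨rfl, _, hb, rfl, h⟩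
    · exact Or.inl (setV_V_of_ne _ _ hd)

theorem VisibleStep.V_of_acts {t t' : Tables S A} {b b' : PMF S}
    (h : M.VisibleStep sel t b t' b') {a : A} (ha : M.Acts sel t b a) :
    t'.V b = M.qval t.V b a ∧ t' = setV (M.lazyBody sel t b) b a := by
  obtain ⟨hb, rfl, h2⟩ := ha
  cases h with
  | restart hb' => exact absurd hb' hb
  | again _ h => exact absurd h2 h
  | act _ _ => exact ⟨by rw [setV_V_self, lazyBody_Q_best], rfl⟩

theorem VisibleStep.Q_of_ne {t t' : Tables S A} {b b' : PMF S}
    (h : M.VisibleStep sel t b t' b') {d : PMF S} (hd : d ≠ b) : t'.Q d = t.Q d := by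
  cases h with
  | restart => rfl
  | again => exact M.lazyBody_Q_of_ne t hd
  | act => exact M.lazyBody_Q_of_ne t hd

theorem VisibleStep.acts_or {t t' : Tables S A} {b b' : PMF S}
    (h : M.VisibleStep sel t b t' b') (hb : ¬ M.IsGoal b) :
    (∃ a, M.Acts sel t b a) ∨ t' = M.lazyBody sel t b ∧ b' = b := by
  cases h with
  | restart hb' => exact absurd hb' hb
  | again _ h => exact Or.inr ⟨rfl, rfl⟩
  | act _ h => exact Or.inl ⟨_, hb, rfl, h⟩

namespace IsFairPath

variable {t : ℕ → Tables S A} {b : ℕ → PMF S} (hp : M.IsFairPath sel t b)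
include hp

theorem reachable (n : ℕ) : M.Reachable (b n) := by
  induction n with
  | zero => rw [hp.start]; exact .start
  | succ n ih => exact (hp.step n).reachable ih

theorem tableOps (n : ℕ) : M.TableOps sel (t 0) (t n) := by
  induction n with
  | zero => exact .refl
  | succ n ih => exact ih.trans (hp.step n).tableOps

theorem monotone_ev : Monotone fun n => (t n).ev :=
  monotone_nat_of_le_succ fun n => (hp.step n).tableOps.ev_subset

theorem reachable_of_frequently {d : PMF S} (hd : ∃ᶠ n in atTop, b n = d) : M.Reachable d := by
  obtain ⟨n, rfl⟩ := hd.exists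
  exact hp.reachable n

/-- Once no new action is evaluated at `d`, a run of the do-while loop ends after at most two
rounds. -/
theorem eventually_acts [Finite A] (d : PMF S) (hd : ¬ M.IsGoal d) :
    ∀ᶠ n in atTop, b n = d → (∃ a, M.Acts sel (t n) d a) ∨
      (b (n + 1) = d ∧ t (n + 1) = M.lazyBody sel (t n) d ∧
        M.Acts sel (t (n + 1)) d (best sel (t (n + 1)) d)) := by
  filter_upwards [eventually_mem_of_mem_succ hp.monotone_ev fun a : A => (d, a)] with n hn hbn
  have hs := hp.step n
  rw [hbn] at hs
  refine (hs.acts_or hd).imp id ?_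
  rintro ⟨h1, h2⟩
  refine ⟨h2, h1, hd, rfl, ?_⟩
  have hs' := hp.step (n + 1)
  rw [h2] at hs'
  rcases hs'.acts_or hd with ⟨a, -, h3, h4⟩ | ⟨h3, -⟩
  · rw [h3, h4]
  -- The action evaluated in the second round is no longer new at this late time. Hence the body is
  -- idempotent and the best action could not have changed.
  · have hmem : (d, best sel (t (n + 1)) d) ∈ (t (n + 1)).ev := by
      have : (d, best sel (t (n + 1)) d) ∈ (t (n + 2)).ev := by
        rw [h3]; exact Set.mem_insert _ _
      exact hp.monotone_ev n.le_succ (hn (n + 2) _ this)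
    rw [h1] at hmem ⊢
    rw [M.lazyBody_lazyBody hmem]

theorem frequently_acts [Finite A] {d : PMF S} (hd : ¬ M.IsGoal d)
    (hfr : ∃ᶠ n in atTop, b n = d) :
    ∃ᶠ n in atTop, b n = d ∧ ∃ a, M.Acts sel (t n) d a := by
  rw [frequently_atTop] at hfr ⊢
  intro N
  obtain ⟨N', hN'⟩ := eventually_atTop.1 (hp.eventually_acts d hd)
  obtain ⟨n, hn, hbn⟩ := hfr (max N N')
  rcases hN' n (le_trans (le_max_right _ _) hn) hbn with h | ⟨h1, -, h2⟩
  · exact ⟨n, le_trans (le_max_left _ _) hn, hbn, h⟩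
  · exact ⟨n + 1, (le_trans (le_max_left _ _) hn).trans n.le_succ, h1, _, h2⟩

/-- The planner acts infinitely often from `d` by the action `a`. -/
theorem eventually_frequently [Finite A] (d : PMF S) :
    ∀ᶠ n in atTop, ∀ a, b n = d → M.Acts sel (t n) d a →
      ∃ᶠ n in atTop, b n = d ∧ M.Acts sel (t n) d a := by
  refine eventually_all.2 fun a => ?_
  by_cases h : ∃ᶠ n in atTop, b n = d ∧ M.Acts sel (t n) d a
  · exact Eventually.of_forall fun _ _ _ => h
  · rw [not_frequently] at h
    filter_upwards [h] with n hn h1 h2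
    exact absurd ⟨h1, h2⟩ hn

/-- From some time on, the best action at a belief that is visited infinitely often is one that is
taken infinitely often. -/
theorem eventually_best_frequently [Finite A] {d : PMF S} (hd : ¬ M.IsGoal d)
    (hfr : ∃ᶠ n in atTop, b n = d) :
    ∀ᶠ n in atTop, ∃ᶠ k in atTop, b k = d ∧ M.Acts sel (t k) d (best sel (t n) d) := by
  obtain ⟨N, hN⟩ := eventually_atTop.1 ((hp.eventually_acts d hd).and (hp.eventually_frequently d))
  obtain ⟨k, hk, hbk⟩ := (frequently_atTop.1 hfr) N
  refine eventually_atTop.2 ⟨k + 1, fun n hn => ?_⟩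
  -- After a late visit to `d`, the best action there is the one just taken or the one taken at the
  -- next step. Between visits the Q-values at `d` are frozen, so this persists.
  have key : ∀ n ≥ k, b n = d →
      ∃ᶠ k in atTop, b k = d ∧ M.Acts sel (t k) d (best sel (t (n + 1)) d) := by
    intro n hn hbn
    rcases (hN n (by omega)).1 hbn with ⟨a, ha⟩ | ⟨h1, h2, h3⟩
    · have hs := hp.step n
      rw [hbn] at hs
      rw [(hs.V_of_acts ha).2, best_setV, ha.2.2]
      exact (hN n (by omega)).2 a hbn ha
    · exact (hN (n + 1) (by omega)).2 _ h1 h3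
  induction n, hn using Nat.le_induction with
  | base => exact key k le_rfl hbk
  | succ n hn ih =>
    by_cases hbn : b n = d
    · exact key n (by omega) hbn
    · rwa [best_congr ((hp.step n).Q_of_ne (Ne.symm hbn))]

variable [Fintype A] [Nonempty A]

theorem admissible (hfin : ∀ b, M.Reachable b → M.optCost b ≠ ∞)
    (hsel : ∀ b (q : A → ℝ) a, q (sel b q) ≤ q a)
    {Qinit : PMF S → A → ℝ} (h0 : M.Admissible Qinit (t 0)) (n : ℕ) :
    M.Admissible Qinit (t n) :=
  h0.tableOps hfin hsel (hp.tableOps n)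

/-- The values of the beliefs that are visited infinitely often converge to the optimal ones, and
the actions taken infinitely often there are optimal. -/
theorem tendsto_V (hpos : ∀ s, s ∉ M.G → ∀ a, 0 < M.c s a)
    (hfin : ∀ b, M.Reachable b → M.optCost b ≠ ∞)
    (hsel : ∀ b (q : A → ℝ) a, q (sel b q) ≤ q a)
    {Qinit : PMF S → A → ℝ} (h0 : M.Admissible Qinit (t 0)) {m : ℝ}
    (hm : M.BoundedBelow m (t 0)) {d : PMF S} (hd : ∃ᶠ n in atTop, b n = d) :
    Tendsto (fun n => (t n).V d) atTop (𝓝 (M.optVal d)) := by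
  obtain ⟨κ, hκ, hc⟩ := M.exists_cost_lower_bound hpos
  have hlo : ∀ d, M.Reachable d → ∀ᶠ n in atTop, m ≤ (t n).V d := fun d hd =>
    Eventually.of_forall fun n => (hm.tableOps (hp.tableOps n) d hd).1
  have hhi : ∀ d, M.Reachable d → ∀ᶠ n in atTop, (t n).V d ≤ M.optVal d := fun d hd =>
    Eventually.of_forall fun n => (hp.admissible hfin hsel h0 n).V_le d hd
  have hbd : ∀ d, M.Reachable d → IsBoundedUnder (· ≤ ·) atTop fun n => (t n).V d :=
    fun d hd => ⟨_, eventually_map.2 (hhi d hd)⟩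
  have hbd' : ∀ d, M.Reachable d → IsBoundedUnder (· ≥ ·) atTop fun n => (t n).V d :=
    fun d hd => ⟨_, eventually_map.2 (hlo d hd)⟩
  set v : PMF S → ℝ := fun d => liminf (fun n => (t n).V d) atTop with hv
  have hact : ∀ d, ∃ a, (∃ᶠ n in atTop, b n = d) → ¬ M.IsGoal d →
      (∃ᶠ n in atTop, b n = d ∧ M.Acts sel (t n) d a) ∧ M.qval v d a ≤ v d := by
    intro d
    by_cases hg : M.IsGoal d
    · exact ⟨Classical.arbitrary A, fun _ h => absurd hg h⟩
    by_cases hd : ∃ᶠ n in atTop, b n = d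
    swap
    · exact ⟨Classical.arbitrary A, fun h => absurd h hd⟩
    have hdr := hp.reachable_of_frequently hd
    -- The minimum is over the recurring actions only: every late backup at `d` uses one of them,
    -- and fairness applies to the minimiser because it recurs.
    set R : Set A := {a | ∃ᶠ n in atTop, b n = d ∧ M.Acts sel (t n) d a} with hR
    have hRne : R.Nonempty := by
      obtain ⟨n, hn, h1, a, ha⟩ := ((hp.eventually_frequently d).and_frequently
        (hp.frequently_acts hg hd)).exists
      exact ⟨a, hn a h1 ha⟩
    obtain ⟨a, haR, ha⟩ := Set.exists_min_image R (M.qval v d) R.toFinite hRne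
    refine ⟨a, fun _ _ => ⟨haR, le_of_forall_sub_le fun η hη => ?_⟩⟩
    refine le_liminf_of_le (hbd d hdr).isCoboundedUnder_ge ?_
    refine eventually_of_forall_change (X := fun n => (t n).V d) (P := fun x => _ ≤ x)
      (Eventually.of_forall fun n => (hp.step n).V_eq_or d) (hp.frequently_acts hg hd) ?_
    have h1 : ∀ᶠ n in atTop, ∀ a, M.qval v d a - η ≤ M.qval (t n).V d a := by
      refine eventually_all.2 fun a => ?_
      exact M.eventually_le_qval fun z hz => eventually_liminf_sub_le (hlo _ (hdr.succ hz)) hη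
    filter_upwards [h1, hp.eventually_frequently d] with n h1 h2
    rintro ⟨h3, a', ha'⟩
    have hs := hp.step n
    rw [h3] at hs
    rw [(hs.V_of_acts ha').1]
    linarith [ha a' (h2 a' h3 ha'), h1 a']
  choose π hπ using hact
  -- Fairness closes the set of beliefs visited infinitely often under `π`. This set may be
  -- infinite, which is why verification is used here and not the maximum principle.
  have hver := M.policyCost_le_ofReal_of_qval_le (D := {d | ∃ᶠ n in atTop, b n = d}) (v := v)
    (π := π) (m := m) hκ
    (fun d hd hg z hz => hp.fair d _ z (hp.reachable_of_frequently hd) hz (hπ d hd hg).1)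
    (fun d _ hg => by
      have : (fun n => (t n).V d) = fun _ => (0 : ℝ) :=
        funext fun n => (hp.admissible hfin hsel h0 n).V_goal d hg
      simp only [hv, this, liminf_const, le_refl])
    (fun d hd => le_liminf_of_le (hbd d (hp.reachable_of_frequently hd)).isCoboundedUnder_ge
      (hlo d (hp.reachable_of_frequently hd)))
    (fun d hd hg => hc d (hp.reachable_of_frequently hd) hg _)
    (fun d hd hg => (hπ d hd hg).2) hd
  have hdr := hp.reachable_of_frequently hd
  have hle : M.optVal d ≤ v d := by
    have h1 : M.optCost d ≤ ENNReal.ofReal (v d) := (iInf_le _ π).trans hver.2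
    exact ENNReal.toReal_le_of_le_ofReal hver.1 h1
  refine tendsto_of_le_liminf_of_limsup_le hle ?_ (hbd d hdr) (hbd' d hdr)
  exact limsup_le_of_le (hbd' d hdr).isCoboundedUnder_le (hhi d hdr)

/-- At each time the action is taken, the new value at `d` is its lookahead value. All successors
are visited infinitely often by fairness, so both sides converge along these times to optimal
quantities. -/
theorem qval_eq_of_frequently_acts (hpos : ∀ s, s ∉ M.G → ∀ a, 0 < M.c s a)
    (hfin : ∀ b, M.Reachable b → M.optCost b ≠ ∞)
    (hsel : ∀ b (q : A → ℝ) a, q (sel b q) ≤ q a)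
    {Qinit : PMF S → A → ℝ} (h0 : M.Admissible Qinit (t 0)) {m : ℝ}
    (hm : M.BoundedBelow m (t 0)) {d : PMF S} {a : A}
    (ha : ∃ᶠ n in atTop, b n = d ∧ M.Acts sel (t n) d a) :
    M.optQ d a = M.optCost d := by
  have hd : ∃ᶠ n in atTop, b n = d := ha.mono fun n h => h.1
  have hdr := hp.reachable_of_frequently hd
  rw [M.optQ_eq_optCost_iff hfin hdr]
  have h1 : Tendsto (fun n => M.qval (t n).V d a) atTop (𝓝 (M.qval M.optVal d a)) :=
    M.tendsto_qval fun z hz => hp.tendsto_V hpos hfin hsel h0 hm (hp.fair d a z hdr hz ha)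
  have h2 : Tendsto (fun n => (t (n + 1)).V d) atTop (𝓝 (M.optVal d)) :=
    (hp.tendsto_V hpos hfin hsel h0 hm hd).comp (tendsto_add_atTop_nat 1)
  refine tendsto_nhds_unique_of_frequently_eq h1 h2 (ha.mono fun n hn => ?_)
  have hs := hp.step n
  rw [hn.1] at hs
  exact (hs.V_of_acts hn.2).1.symm

theorem eventually_best_optimal (hpos : ∀ s, s ∉ M.G → ∀ a, 0 < M.c s a)
    (hfin : ∀ b, M.Reachable b → M.optCost b ≠ ∞)
    (hsel : ∀ b (q : A → ℝ) a, q (sel b q) ≤ q a)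
    {Qinit : PMF S → A → ℝ} (h0 : M.Admissible Qinit (t 0)) {m : ℝ}
    (hm : M.BoundedBelow m (t 0)) {d : PMF S} (hd : ∃ᶠ n in atTop, b n = d) :
    ∀ᶠ n in atTop, M.optQ d (best sel (t n) d) = M.optCost d := by
  by_cases hg : M.IsGoal d
  · exact Eventually.of_forall fun n => by rw [M.optQ_of_isGoal hg, M.optCost_of_isGoal hg]
  · exact (hp.eventually_best_frequently hg hd).mono fun n hn =>
      hp.qval_eq_of_frequently_acts hpos hfin hsel h0 hm hn

theorem exists_frequently_of_finite (hR : {b | M.Reachable b}.Finite) {P : PMF S → Prop}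
    (h : ∃ᶠ n in atTop, P (b n)) : ∃ d, P d ∧ ∃ᶠ n in atTop, b n = d := by
  by_contra hcon
  push Not at hcon
  have h1 : ∀ᶠ n in atTop, ∀ d ∈ {b | M.Reachable b}, P d → b n ≠ d :=
    (eventually_all_finite hR).2 fun d _ => by
      by_cases hd : P d
      · filter_upwards [hcon d hd] with n hn _ using hn
      · exact Eventually.of_forall fun _ h => absurd h hd
  obtain ⟨n, h2, h3⟩ := (h1.and_frequently h).exists
  exact h2 (b n) (hp.reachable n) h3 rfl

/-- With finitely many reachable beliefs, goal beliefs are met infinitely often. -/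
theorem frequently_isGoal (hR : {b | M.Reachable b}.Finite)
    (hpos : ∀ s, s ∉ M.G → ∀ a, 0 < M.c s a)
    (hfin : ∀ b, M.Reachable b → M.optCost b ≠ ∞)
    (hsel : ∀ b (q : A → ℝ) a, q (sel b q) ≤ q a)
    {Qinit : PMF S → A → ℝ} (h0 : M.Admissible Qinit (t 0)) {m : ℝ}
    (hm : M.BoundedBelow m (t 0)) : ∃ᶠ n in atTop, M.IsGoal (b n) := by
  by_contra hcon
  rw [not_frequently] at hcon
  obtain ⟨κ, hκ, hc⟩ := M.exists_cost_lower_bound hpos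
  obtain ⟨d, -, hd⟩ := hp.exists_frequently_of_finite hR (P := fun _ => True)
    (Eventually.of_forall fun _ => trivial).frequently
  have hng : ∀ d, (∃ᶠ n in atTop, b n = d) → ¬ M.IsGoal d := by
    intro d hd
    obtain ⟨n, h1, h2⟩ := (hcon.and_frequently hd).exists
    rwa [h2] at h1
  have hact : ∀ d, ∃ a, (∃ᶠ n in atTop, b n = d) →
      ∃ᶠ n in atTop, b n = d ∧ M.Acts sel (t n) d a := by
    intro d
    by_cases hd : ∃ᶠ n in atTop, b n = d
    · obtain ⟨n, hn⟩ := (hp.eventually_best_frequently (hng d hd) hd).exists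
      exact ⟨_, fun _ => hn⟩
    · exact ⟨Classical.arbitrary A, fun h => absurd h hd⟩
  choose π hπ using hact
  have hD : ∀ d ∈ {d | ∃ᶠ n in atTop, b n = d}, ¬ M.IsGoal d → ∀ z,
      M.obsProb d (π d) z ≠ 0 → M.succ d (π d) z ∈ {d | ∃ᶠ n in atTop, b n = d} :=
    fun d hd hg z hz => hp.fair d _ z (hp.reachable_of_frequently hd) hz (hπ d hd)
  have hopt : M.policyCost π d = M.optCost d := M.policyCost_eq_optCost hD
    (fun d hd _ => hp.qval_eq_of_frequently_acts hpos hfin hsel h0 hm (hπ d hd)) hd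
  -- The policy of recurring actions is optimal but never leaves the recurring beliefs, none of
  -- which is a goal. It pays at least `κ * n` in `n` steps for every `n`, against finiteness of the
  -- optimal cost.
  have halive : ∀ n : ℕ, ∀ d, (∃ᶠ n in atTop, b n = d) → M.aliveProb π n d = 1 := by
    intro n
    induction n with
    | zero => intro d hd; simp [aliveProb, hng d hd]
    | succ n ih =>
      intro d hd
      rw [aliveProb, if_neg (hng d hd), ← M.sum_obsProb_toReal d (π d)]
      refine Finset.sum_congr rfl fun z _ => ?_
      by_cases hz : M.obsProb d (π d) z = 0
      · simp [hz]
      · rw [ih _ (hD d hd (hng d hd) z hz), mul_one]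
  have hbound : ∀ n : ℕ, κ * n ≤ M.optVal d := by
    intro n
    have h1 := M.aliveProb_le_costUpTo hκ.le hD
      (fun d hd hg => hc d (hp.reachable_of_frequently hd) hg _) n hd
    rw [halive n d hd, mul_one] at h1
    refine h1.trans (ENNReal.toReal_mono (hfin d (hp.reachable_of_frequently hd)) ?_)
    rw [← hopt]
    exact le_iSup (fun n => M.costUpTo π n d) n
  obtain ⟨n, hn⟩ := exists_nat_gt (M.optVal d / κ)
  rw [div_lt_iff₀ hκ] at hn
  linarith [hbound n]

theorem frequently_start (hgoal : ∃ᶠ n in atTop, M.IsGoal (b n)) :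
    ∃ᶠ n in atTop, b n = M.b₀ := by
  rw [frequently_atTop] at hgoal ⊢
  intro N
  obtain ⟨n, hn, hg⟩ := hgoal N
  exact ⟨n + 1, by omega, (hp.step n).eq_start hg⟩

/-- From some time on, the beliefs visited infinitely often are closed under the current best
actions, which are optimal there. They include `M.b₀`, as goals are met infinitely often. Finiteness
makes that time uniform over beliefs. -/
theorem eventually_policyCost_eq (hR : {b | M.Reachable b}.Finite)
    (hpos : ∀ s, s ∉ M.G → ∀ a, 0 < M.c s a)
    (hfin : ∀ b, M.Reachable b → M.optCost b ≠ ∞)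
    (hsel : ∀ b (q : A → ℝ) a, q (sel b q) ≤ q a)
    {Qinit : PMF S → A → ℝ} (h0 : M.Admissible Qinit (t 0)) {m : ℝ}
    (hm : M.BoundedBelow m (t 0)) :
    ∀ᶠ n in atTop, M.policyCost (best sel (t n)) M.b₀ = M.optCost M.b₀ := by
  have hstart := hp.frequently_start (hp.frequently_isGoal hR hpos hfin hsel h0 hm)
  have h1 : ∀ᶠ n in atTop, ∀ d ∈ {b | M.Reachable b}, (∃ᶠ n in atTop, b n = d) →
      ¬ M.IsGoal d → ∃ᶠ k in atTop, b k = d ∧ M.Acts sel (t k) d (best sel (t n) d) :=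
    (eventually_all_finite hR).2 fun d _ => by
      by_cases hd : (∃ᶠ n in atTop, b n = d) ∧ ¬ M.IsGoal d
      · exact (hp.eventually_best_frequently hd.2 hd.1).mono fun n hn _ _ => hn
      · exact Eventually.of_forall fun n h1 h2 => absurd ⟨h1, h2⟩ hd
  filter_upwards [h1] with n hn
  refine M.policyCost_eq_optCost (D := {d | ∃ᶠ n in atTop, b n = d}) (fun d hd hg z hz => ?_)
    (fun d hd hg => ?_) hstart
  · exact hp.fair d _ z (hp.reachable_of_frequently hd) hz
      (hn d (hp.reachable_of_frequently hd) hd hg)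
  · exact hp.qval_eq_of_frequently_acts hpos hfin hsel h0 hm
      (hn d (hp.reachable_of_frequently hd) hd hg)

end IsFairPath

end RTDPPath

end

end GoalPOMDP

/-! ### Discrete expectations -/

namespace PMF

/-- The expectation of an extended nonnegative function. -/
noncomputable def expect {α : Type*} (p : PMF α) (f : α → ℝ≥0∞) : ℝ≥0∞ := ∑' x, p x * f x

/-- The measure is a weighted sum of Dirac masses at measurable points, so `f` need not be
measurable. -/
theorem lintegral_toMeasure_eq_expect {α : Type*} [MeasurableSpace α] [MeasurableSingletonClass α]
    (p : PMF α) {f : α → ℝ≥0∞} : ∫⁻ x, f x ∂p.toMeasure = p.expect f := by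
  have h : p.toMeasure = Measure.sum fun x => p x • Measure.dirac x := by
    ext s hs
    rw [PMF.toMeasure_apply _ hs, Measure.sum_apply _ hs]
    refine tsum_congr fun x => ?_
    by_cases hx : x ∈ s <;> simp [hx]
  rw [h, lintegral_sum_measure]
  simp [expect, lintegral_smul_measure]

theorem expect_pure {α : Type*} (x : α) (f : α → ℝ≥0∞) : (PMF.pure x).expect f = f x := by
  unfold expect
  rw [tsum_eq_single x]
  · simp
  · intro y hy
    simp [PMF.pure_apply, hy]

theorem expect_bind {α β : Type*} (p : PMF α) (q : α → PMF β) (f : β → ℝ≥0∞) :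
    (p.bind q).expect f = p.expect fun x => (q x).expect f := by
  unfold expect
  simp_rw [PMF.bind_apply, ← ENNReal.tsum_mul_right, ← ENNReal.tsum_mul_left]
  rw [ENNReal.tsum_comm]
  simp_rw [mul_assoc]

theorem expect_map {α β : Type*} (p : PMF α) (g : α → β) (f : β → ℝ≥0∞) :
    (p.map g).expect f = p.expect fun x => f (g x) := by
  rw [← PMF.bind_pure_comp, expect_bind]
  simp [expect_pure]

theorem expect_const {α : Type*} (p : PMF α) (x : ℝ≥0∞) : p.expect (fun _ => x) = x := by
  simp [expect, ENNReal.tsum_mul_right, p.tsum_coe]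

theorem expect_mono {α : Type*} (p : PMF α) {f g : α → ℝ≥0∞} (h : ∀ x, f x ≤ g x) :
    p.expect f ≤ p.expect g :=
  ENNReal.tsum_le_tsum fun x => mul_le_mul_right (h x) _

theorem expect_le_one {α : Type*} (p : PMF α) {f : α → ℝ≥0∞} (h : ∀ x, f x ≤ 1) :
    p.expect f ≤ 1 :=
  (p.expect_mono h).trans (p.expect_const 1).le

theorem expect_fintype {α : Type*} [Fintype α] (p : PMF α) (f : α → ℝ≥0∞) :
    p.expect f = ∑ x, p x * f x := tsum_fintype _

end PMF

namespace GoalPOMDP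

noncomputable section

open scoped Classical

/-! ### The Markov property of Lazy RTDP-Bel, with the hidden state averaged out. -/

section RTDPLaw

variable {S A Z : Type*} [Fintype S] (M : GoalPOMDP S A Z)

/-- Averaging over the simulated state, which is distributed according to the current belief. -/
def stateAverage (f : RTDPConfig S A → ℝ≥0∞) (x : RTDPConfig S A) : ℝ≥0∞ :=
  x.b.expect fun s => f { tab := x.tab, b := x.b, s := s }

theorem stateAverage_mk (f : RTDPConfig S A → ℝ≥0∞) (t : Tables S A) (b : PMF S) (s : S) :
    stateAverage f ⟨t, b, s⟩ = b.expect fun s => f ⟨t, b, s⟩ := rfl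

theorem stateAverage_le_one {f : RTDPConfig S A → ℝ≥0∞} (hf : ∀ x, f x ≤ 1)
    (x : RTDPConfig S A) : stateAverage f x ≤ 1 :=
  PMF.expect_le_one _ fun _ => hf _

variable [Fintype Z] (sel : PMF S → (A → ℝ) → A)

/-- The joint law of the next state and the observation. -/
theorem expect_bind_map (b : PMF S) (a : A) (g : S → Z → ℝ≥0∞) :
    (b.expect fun s => (M.T s a).expect fun s' => (M.O s' a).expect fun z => g s' z) =
      ∑ z, M.obsProb b a z * (M.succ b a z).expect fun s' => g s' z := by
  have h1 : ∀ z, M.obsProb b a z * (M.succ b a z).expect (fun s' => g s' z) =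
      ∑ s', M.pred b a s' * (M.O s' a z * g s' z) := by
    intro z
    rw [PMF.expect_fintype, Finset.mul_sum]
    refine Finset.sum_congr rfl fun s' _ => ?_
    by_cases hz : M.obsProb b a z = 0
    · have h0 : M.pred b a s' * M.O s' a z = 0 :=
        Finset.sum_eq_zero_iff.1 hz s' (Finset.mem_univ s')
      rw [hz, zero_mul, ← mul_assoc, h0, zero_mul]
    · rw [← mul_assoc, M.succ_mul_obsProb b a z hz]
      ring
  rw [Finset.sum_congr rfl fun z _ => h1 z, Finset.sum_comm]
  simp only [PMF.expect_fintype, Finset.mul_sum, pred, Finset.sum_mul]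
  rw [Finset.sum_comm]
  refine Finset.sum_congr rfl fun s' _ => ?_
  rw [Finset.sum_comm]
  refine Finset.sum_congr rfl fun z _ => Finset.sum_congr rfl fun s _ => ?_
  ring

/-- The expectation of a function of the next configuration. -/
def expectNext (f : RTDPConfig S A → ℝ≥0∞) (x : RTDPConfig S A) : ℝ≥0∞ :=
  (M.rtdpStep sel x).expect f

theorem stateAverage_expectNext_of_acts (f : RTDPConfig S A → ℝ≥0∞) {t : Tables S A} {b : PMF S}
    {a : A} (ha : M.Acts sel t b a) (s : S) :
    stateAverage (M.expectNext sel f) ⟨t, b, s⟩ =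
      ∑ z, M.obsProb b a z * (M.succ b a z).expect fun s' =>
        f ⟨setV (M.lazyBody sel t b) b a, M.succ b a z, s'⟩ := by
  obtain ⟨hb, rfl, h⟩ := ha
  rw [← M.expect_bind_map b (best sel t b) fun s' z =>
    f ⟨setV (M.lazyBody sel t b) b (best sel t b), M.succ b (best sel t b) z, s'⟩]
  simp only [stateAverage, expectNext, rtdpStep, hb, h, if_false, ne_eq, not_true_eq_false,
    PMF.expect_bind, PMF.expect_map]

/-- The belief is a sufficient statistic: if the state follows the current belief, then after one
step and one observation it follows the new belief, by Bayes' rule. Averaging once more at the next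
time changes nothing. -/
theorem stateAverage_expectNext (f : RTDPConfig S A → ℝ≥0∞) (x : RTDPConfig S A) :
    stateAverage (M.expectNext sel f) x = stateAverage (M.expectNext sel (stateAverage f)) x := by
  obtain ⟨t, b, s⟩ := x
  by_cases hb : M.IsGoal b
  · simp [stateAverage, expectNext, rtdpStep, hb, PMF.expect_map, PMF.expect_const]
  by_cases h : best sel (M.lazyBody sel t b) b = best sel t b
  · rw [M.stateAverage_expectNext_of_acts sel _ ⟨hb, rfl, h⟩,
      M.stateAverage_expectNext_of_acts sel _ ⟨hb, rfl, h⟩]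
    simp_rw [stateAverage_mk, PMF.expect_const]
  · simp [stateAverage, expectNext, rtdpStep, hb, h, PMF.expect_pure, PMF.expect_const]

variable (Qinit : PMF S → A → ℝ) (heur : PMF S → ℝ)

instance rtdpLaw_isProbabilityMeasure : IsProbabilityMeasure (M.rtdpLaw sel Qinit heur) := by
  unfold rtdpLaw; infer_instance

/-- The Markov property, integrated over an arbitrary event of the history up to time `n`. -/
theorem lintegral_rtdpLaw_succ (n : ℕ)
    {U : Set ((i : Finset.Iic n) → (fun _ : ℕ => RTDPConfig S A) i)} (hU : MeasurableSet U)
    (f : RTDPConfig S A → ℝ≥0∞) :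
    ∫⁻ x in Preorder.frestrictLe n ⁻¹' U, f (x (n + 1)) ∂(M.rtdpLaw sel Qinit heur) =
      ∫⁻ x in Preorder.frestrictLe n ⁻¹' U, M.expectNext sel f (x n)
        ∂(M.rtdpLaw sel Qinit heur) := by
  have hf : Measurable fun p : ((i : Finset.Iic n) → (fun _ : ℕ => RTDPConfig S A) i) ×
      RTDPConfig S A => f p.2 := (measurable_from_top (f := f)).comp measurable_snd
  have h := Kernel.map_frestrictLe_trajMeasure_compProd_eq_map_trajMeasure
    (X := fun _ => RTDPConfig S A) (μ₀ := (M.rtdpStart Qinit heur).toMeasure)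
    (κ := M.rtdpKernel sel) (a := n)
  have h1 : ∫⁻ p in U ×ˢ Set.univ, f p.2 ∂((M.rtdpLaw sel Qinit heur).map
      (fun x => (Preorder.frestrictLe n x, x (n + 1)))) =
      ∫⁻ x in Preorder.frestrictLe n ⁻¹' U, f (x (n + 1)) ∂(M.rtdpLaw sel Qinit heur) := by
    rw [setLIntegral_map (hU.prod MeasurableSet.univ) hf (by fun_prop)]
    congr 2
    ext x
    simp
  rw [← h1]
  unfold rtdpLaw
  rw [← h, Measure.setLIntegral_compProd hf hU MeasurableSet.univ]
  simp only [Measure.restrict_univ]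
  rw [setLIntegral_map hU hf.lintegral_kernel_prod_right (by fun_prop)]
  refine lintegral_congr fun x => ?_
  have : MeasurableSingletonClass (RTDPConfig S A) := ⟨fun _ => trivial⟩
  exact PMF.lintegral_toMeasure_eq_expect _

theorem map_rtdpLaw_zero :
    (M.rtdpLaw sel Qinit heur).map (fun x => x 0) = (M.rtdpStart Qinit heur).toMeasure := by
  have h1 : (fun x : ℕ → RTDPConfig S A => x 0) =
      (fun y : (i : Finset.Iic 0) → (fun _ : ℕ => RTDPConfig S A) i =>
        y ⟨0, Finset.mem_Iic.2 le_rfl⟩) ∘ Preorder.frestrictLe 0 := rfl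
  rw [h1, ← Measure.map_map (by fun_prop) (by fun_prop), rtdpLaw, Kernel.trajMeasure,
    Measure.map_comp _ _ (by fun_prop), Kernel.traj_map_frestrictLe, Kernel.partialTraj_self,
    Measure.id_comp, Measure.map_map (by fun_prop) (by fun_prop)]
  exact Measure.map_id

end RTDPLaw

/-! ### The filtration generated by the tables and the beliefs. -/

section Visible

variable {S A : Type*}

theorem measurableSet_at (k : ℕ) (U : Set (RTDPConfig S A)) :
    MeasurableSet {x : ℕ → RTDPConfig S A | x k ∈ U} := by
  have h : Measurable fun x : ℕ → RTDPConfig S A => x k := measurable_pi_apply k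
  exact h (show MeasurableSet U from trivial)

theorem measurableSet_restrict_at {n : ℕ} (k : Finset.Iic n) (U : Set (RTDPConfig S A)) :
    MeasurableSet {h : (i : Finset.Iic n) → (fun _ : ℕ => RTDPConfig S A) i | h k ∈ U} := by
  have h : Measurable fun h : (i : Finset.Iic n) → (fun _ : ℕ => RTDPConfig S A) i => h k :=
    measurable_pi_apply k
  exact h (show MeasurableSet U from trivial)

/-- The events that depend only on the tables and the belief at time `n`. -/
@[reducible] def visibleAt (S A : Type*) (n : ℕ) : MeasurableSpace (ℕ → RTDPConfig S A) :=
  MeasurableSpace.comap (fun x => ((x n).tab, (x n).b)) ⊤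

/-- The events that depend only on the tables and the beliefs up to time `n`. -/
def visibleFiltration (S A : Type*) :
    Filtration ℕ (inferInstance : MeasurableSpace (ℕ → RTDPConfig S A)) where
  seq n := ⨆ k ≤ n, visibleAt S A k
  mono' _ _ h := biSup_mono fun _ hk => hk.trans h
  le' n := iSup₂_le fun k _ => by
    rintro _ ⟨U, -, rfl⟩
    exact measurableSet_at k ((fun y : RTDPConfig S A => (y.tab, y.b)) ⁻¹' U)

theorem visibleFiltration_zero : visibleFiltration S A 0 = visibleAt S A 0 := by
  show (⨆ k ≤ 0, visibleAt S A k) = _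
  simp

theorem visibleFiltration_succ (n : ℕ) :
    visibleFiltration S A (n + 1) = visibleFiltration S A n ⊔ visibleAt S A (n + 1) := by
  show (⨆ k ≤ n + 1, visibleAt S A k) = (⨆ k ≤ n, visibleAt S A k) ⊔ _
  refine le_antisymm (iSup₂_le fun k hk => ?_) (sup_le (biSup_mono fun k hk => ?_) ?_)
  · rcases Nat.le_add_one_iff.1 hk with hk | rfl
    · exact le_sup_of_le_left (le_iSup₂_of_le k hk le_rfl)
    · exact le_sup_right
  · exact hk.trans n.le_succ
  · exact le_iSup₂_of_le (n + 1) le_rfl le_rfl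

theorem measurableSet_visible (n : ℕ) (P : Tables S A → PMF S → Prop) :
    MeasurableSet[visibleFiltration S A n] {x | P (x n).tab (x n).b} := by
  have h : visibleAt S A n ≤ visibleFiltration S A n := le_iSup₂_of_le (f := fun k (_ : k ≤ n) =>
    visibleAt S A k) n le_rfl le_rfl
  exact h _ ⟨{p | P p.1 p.2}, trivial, rfl⟩

theorem exists_of_measurableSet_visibleAt {n : ℕ} {E : Set (ℕ → RTDPConfig S A)}
    (hE : MeasurableSet[visibleAt S A n] E) :
    ∃ P : Tables S A → PMF S → Prop, E = {x | P (x n).tab (x n).b} := by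
  obtain ⟨U, -, rfl⟩ := hE
  exact ⟨fun t b => (t, b) ∈ U, rfl⟩

theorem exists_of_measurableSet_visibleFiltration {n : ℕ} {E : Set (ℕ → RTDPConfig S A)}
    (hE : MeasurableSet[visibleFiltration S A n] E) :
    ∃ U : Set ((i : Finset.Iic n) → (fun _ : ℕ => RTDPConfig S A) i), MeasurableSet U ∧
      E = Preorder.frestrictLe n ⁻¹' U := by
  have h : visibleFiltration S A n ≤ MeasurableSpace.comap
      (Preorder.frestrictLe (π := fun _ : ℕ => RTDPConfig S A) n) inferInstance := by
    refine iSup₂_le fun k hk => ?_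
    rintro _ ⟨U, -, rfl⟩
    refine ⟨(fun y => ((y ⟨k, Finset.mem_Iic.2 hk⟩).tab, (y ⟨k, Finset.mem_Iic.2 hk⟩).b)) ⁻¹' U,
      ?_, rfl⟩
    exact measurableSet_restrict_at ⟨k, Finset.mem_Iic.2 hk⟩
      ((fun y : RTDPConfig S A => (y.tab, y.b)) ⁻¹' U)
  obtain ⟨U, hU, rfl⟩ := h E hE
  exact ⟨U, hU, rfl⟩

end Visible

/-! ### Fairness of Lazy RTDP-Bel by conditional Borel–Cantelli. -/

section RTDPFair

variable {S A Z : Type*} [Fintype S] (M : GoalPOMDP S A Z) [Fintype Z]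
  (sel : PMF S → (A → ℝ) → A) (Qinit : PMF S → A → ℝ) (heur : PMF S → ℝ)

theorem expectNext_le_one {f : RTDPConfig S A → ℝ≥0∞} (hf : ∀ x, f x ≤ 1)
    (x : RTDPConfig S A) : M.expectNext sel f x ≤ 1 :=
  PMF.expect_le_one _ hf

theorem stateAverage_indicator (P : Tables S A → PMF S → Prop) (f : RTDPConfig S A → ℝ≥0∞)
    (x : RTDPConfig S A) :
    stateAverage ({y | P y.tab y.b}.indicator f) x =
      {y : RTDPConfig S A | P y.tab y.b}.indicator (stateAverage f) x := by
  by_cases h : P x.tab x.b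
  · simp [stateAverage, Set.indicator, h]
  · simp [stateAverage, Set.indicator, h, PMF.expect]

theorem setLIntegral_inter_visible (n : ℕ) (μ : Measure (ℕ → RTDPConfig S A))
    (P : Tables S A → PMF S → Prop) (E : Set (ℕ → RTDPConfig S A))
    (f : RTDPConfig S A → ℝ≥0∞) :
    ∫⁻ x in E ∩ {x | P (x n).tab (x n).b}, f (x n) ∂μ =
      ∫⁻ x in E, {y : RTDPConfig S A | P y.tab y.b}.indicator f (x n) ∂μ := by
  have hP : MeasurableSet {x : ℕ → RTDPConfig S A | P (x n).tab (x n).b} :=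
    (visibleFiltration S A).le n _ (measurableSet_visible n P)
  rw [Set.inter_comm, ← Measure.restrict_restrict hP, ← lintegral_indicator hP]
  rfl

theorem measurable_at (n : ℕ) (f : RTDPConfig S A → ℝ≥0∞) :
    Measurable fun x : ℕ → RTDPConfig S A => f (x n) :=
  (measurable_from_top (f := f)).comp (measurable_pi_apply n)

theorem lintegral_rtdpLaw_zero (f : RTDPConfig S A → ℝ≥0∞) :
    ∫⁻ x, f (x 0) ∂(M.rtdpLaw sel Qinit heur) = (M.rtdpStart Qinit heur).expect f := by
  have : MeasurableSingletonClass (RTDPConfig S A) := ⟨fun _ => trivial⟩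
  rw [← PMF.lintegral_toMeasure_eq_expect, ← M.map_rtdpLaw_zero sel Qinit heur,
    lintegral_map measurable_from_top (measurable_pi_apply 0)]

/-- The generating intersections form a π-system, so finite measures on the join need only be
compared on them. -/
theorem _root_.MeasurableSpace.generateFrom_inter_eq_sup {α : Type*} (m₁ m₂ : MeasurableSpace α) :
    m₁ ⊔ m₂ = MeasurableSpace.generateFrom
      {s | ∃ s₁ s₂, MeasurableSet[m₁] s₁ ∧ MeasurableSet[m₂] s₂ ∧ s = s₁ ∩ s₂} := by
  refine le_antisymm (sup_le (fun s hs => ?_) fun s hs => ?_)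
    (MeasurableSpace.generateFrom_le ?_)
  · exact MeasurableSpace.measurableSet_generateFrom
      ⟨s, Set.univ, hs, MeasurableSet.univ, (Set.inter_univ s).symm⟩
  · exact MeasurableSpace.measurableSet_generateFrom
      ⟨Set.univ, s, MeasurableSet.univ, hs, (Set.univ_inter s).symm⟩
  · rintro _ ⟨s₁, s₂, h₁, h₂, rfl⟩
    exact MeasurableSet.inter (le_sup_left (a := m₁) (b := m₂) _ h₁)
      (le_sup_right (a := m₁) (b := m₂) _ h₂)

/-- Given the tables and beliefs so far, the simulated state is distributed according to the
current belief. -/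
theorem setLIntegral_stateAverage (n : ℕ) {E : Set (ℕ → RTDPConfig S A)}
    (hE : MeasurableSet[visibleFiltration S A n] E) {f : RTDPConfig S A → ℝ≥0∞}
    (hf : ∀ x, f x ≤ 1) :
    ∫⁻ x in E, f (x n) ∂(M.rtdpLaw sel Qinit heur) =
      ∫⁻ x in E, stateAverage f (x n) ∂(M.rtdpLaw sel Qinit heur) := by
  set μ := M.rtdpLaw sel Qinit heur with hμ
  induction n generalizing E f with
  | zero =>
    rw [visibleFiltration_zero] at hE
    obtain ⟨P, rfl⟩ := exists_of_measurableSet_visibleAt hE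
    have h1 := setLIntegral_inter_visible 0 μ P Set.univ
    simp only [Set.univ_inter, Measure.restrict_univ] at h1
    rw [h1, h1, hμ, lintegral_rtdpLaw_zero, lintegral_rtdpLaw_zero]
    have h2 : {y : RTDPConfig S A | P y.tab y.b}.indicator (stateAverage f) =
        stateAverage ({y | P y.tab y.b}.indicator f) :=
      funext fun x => (stateAverage_indicator P f x).symm
    rw [h2]
    simp only [rtdpStart, PMF.expect_map, stateAverage_mk, PMF.expect_const]
  | succ n ih =>
    have hfin : ∀ g : RTDPConfig S A → ℝ≥0∞, (∀ x, g x ≤ 1) →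
        IsFiniteMeasure (μ.withDensity fun x => g (x (n + 1))) := by
      intro g hg
      refine isFiniteMeasure_withDensity (ne_top_of_le_ne_top ENNReal.one_ne_top ?_)
      calc ∫⁻ x, g (x (n + 1)) ∂μ ≤ ∫⁻ _, 1 ∂μ := lintegral_mono fun x => hg _
        _ = 1 := by simp
    have hle := (visibleFiltration S A).le (n + 1)
    have := hfin f hf
    have := hfin (stateAverage f) (stateAverage_le_one hf)
    have key : ∀ {E₁ : Set (ℕ → RTDPConfig S A)}, MeasurableSet[visibleFiltration S A n] E₁ →
        ∀ P : Tables S A → PMF S → Prop,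
        ∫⁻ x in E₁ ∩ {x | P (x (n + 1)).tab (x (n + 1)).b}, f (x (n + 1)) ∂μ =
        ∫⁻ x in E₁ ∩ {x | P (x (n + 1)).tab (x (n + 1)).b}, stateAverage f (x (n + 1)) ∂μ := by
      intro E₁ hE₁ P
      rw [setLIntegral_inter_visible (n + 1) μ P, setLIntegral_inter_visible (n + 1) μ P]
      obtain ⟨U, hU, hEU⟩ := exists_of_measurableSet_visibleFiltration hE₁
      have hg : ∀ x, {y : RTDPConfig S A | P y.tab y.b}.indicator f x ≤ 1 := fun x =>
        (Set.indicator_le_self _ f x).trans (hf x)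
      have hg' : ∀ x, {y : RTDPConfig S A | P y.tab y.b}.indicator (stateAverage f) x ≤ 1 :=
        fun x => (Set.indicator_le_self _ _ x).trans (stateAverage_le_one hf x)
      -- The Markov property moves the integrand back to time `n`, where the induction hypothesis
      -- averages it. Applied to `f` and to `stateAverage f`, both cut down by the event at time `n
      -- + 1`, it yields equal results by `stateAverage_expectNext`.
      have hstep : ∀ g : RTDPConfig S A → ℝ≥0∞, (∀ x, g x ≤ 1) →
          ∫⁻ x in E₁, g (x (n + 1)) ∂μ =
            ∫⁻ x in E₁, stateAverage (M.expectNext sel g) (x n) ∂μ := by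
        intro g hg
        rw [← ih hE₁ (f := M.expectNext sel g) (M.expectNext_le_one sel hg), hEU]
        exact M.lintegral_rtdpLaw_succ sel Qinit heur n hU g
      rw [hstep _ hg, hstep _ hg']
      refine lintegral_congr fun x => ?_
      rw [stateAverage_expectNext]
      congr 2
      funext y
      exact stateAverage_indicator P f y
    -- The bound `f ≤ 1` makes both density measures finite, so agreement on the π-system spreads to
    -- the whole σ-algebra.
    have hext : (μ.withDensity fun x => f (x (n + 1))).trim hle =
        (μ.withDensity fun x => stateAverage f (x (n + 1))).trim hle := by
      have := isFiniteMeasure_trim (μ := μ.withDensity fun x => f (x (n + 1))) hle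
      refine ext_of_generate_finite _ ((visibleFiltration_succ n).trans
        (MeasurableSpace.generateFrom_inter_eq_sup _ _)) ?_ ?_ ?_
      · rintro _ ⟨s₁, s₂, h₁, h₂, rfl⟩ _ ⟨t₁, t₂, k₁, k₂, rfl⟩ -
        exact ⟨s₁ ∩ t₁, s₂ ∩ t₂, h₁.inter k₁, h₂.inter k₂, Set.inter_inter_inter_comm _ _ _ _⟩
      · rintro _ ⟨s₁, s₂, h₁, h₂, rfl⟩
        obtain ⟨P, rfl⟩ := exists_of_measurableSet_visibleAt h₂
        have hm : MeasurableSet[visibleFiltration S A (n + 1)]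
            (s₁ ∩ {x | P (x (n + 1)).tab (x (n + 1)).b}) :=
          ((visibleFiltration S A).mono n.le_succ _ h₁).inter (measurableSet_visible (n + 1) P)
        rw [trim_measurableSet_eq hle hm, trim_measurableSet_eq hle hm,
          withDensity_apply _ (hle _ hm), withDensity_apply _ (hle _ hm)]
        exact key h₁ P
      · rw [trim_measurableSet_eq hle MeasurableSet.univ, trim_measurableSet_eq hle MeasurableSet.univ,
          withDensity_apply _ MeasurableSet.univ, withDensity_apply _ MeasurableSet.univ]
        have := key (E₁ := Set.univ) MeasurableSet.univ (fun _ _ => True)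
        simpa using this
    have h2 := congrArg (fun ν => ν E) hext
    simp only [trim_measurableSet_eq hle hE] at h2
    rwa [withDensity_apply _ (hle _ hE), withDensity_apply _ (hle _ hE)] at h2

/-- The indicator of the configurations with belief `c`. -/
def beliefIndicator (c : PMF S) : RTDPConfig S A → ℝ≥0∞ := {y | y.b = c}.indicator 1

theorem beliefIndicator_le_one (c : PMF S) (x : RTDPConfig S A) : beliefIndicator c x ≤ 1 :=
  Set.indicator_le_self _ _ _

/-- The probability that `c` is the next belief, for an observer who does not see the simulated
state. -/
def nextProb (c : PMF S) (x : RTDPConfig S A) : ℝ≥0∞ :=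
  stateAverage (M.expectNext sel (beliefIndicator c)) x

theorem nextProb_le_one (c : PMF S) (x : RTDPConfig S A) : M.nextProb sel c x ≤ 1 :=
  stateAverage_le_one (M.expectNext_le_one sel (beliefIndicator_le_one c)) x

/-- The conditional probability that `c` is the next belief, given the tables and beliefs so
far. -/
theorem condExp_next (n : ℕ) (c : PMF S) :
    (fun x : ℕ → RTDPConfig S A => (M.nextProb sel c (x n)).toReal)
      =ᵐ[M.rtdpLaw sel Qinit heur]
      condExp (visibleFiltration S A n) (M.rtdpLaw sel Qinit heur)
        ({x | (x (n + 1)).b = c}.indicator (1 : (ℕ → RTDPConfig S A) → ℝ)) := by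
  set μ := M.rtdpLaw sel Qinit heur with hμ
  have hle := (visibleFiltration S A).le n
  have hm : MeasurableSet {x : ℕ → RTDPConfig S A | (x (n + 1)).b = c} :=
    (visibleFiltration S A).le (n + 1) _ (measurableSet_visible (n + 1) fun _ b => b = c)
  have hmeas : Measurable[visibleFiltration S A n]
      fun x : ℕ → RTDPConfig S A => (M.nextProb sel c (x n)).toReal := by
    intro U hU
    exact measurableSet_visible n fun t b =>
      ((b.expect fun s => M.expectNext sel (beliefIndicator c) ⟨t, b, s⟩).toReal ∈ U)
  refine ae_eq_condExp_of_forall_setIntegral_eq hle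
    ((integrable_const (1 : ℝ)).indicator hm) (fun E hE _ => ?_) (fun E hE _ => ?_)
    hmeas.aestronglyMeasurable
  · refine Integrable.integrableOn ?_
    refine Integrable.of_bound (hmeas.mono hle le_rfl).aestronglyMeasurable 1
      (Eventually.of_forall fun x => ?_)
    rw [Real.norm_of_nonneg ENNReal.toReal_nonneg]
    exact ENNReal.toReal_le_of_le_ofReal zero_le_one
      (by simpa using M.nextProb_le_one sel c (x n))
  · have h4 : ∫⁻ x in E, M.nextProb sel c (x n) ∂μ =
        ∫⁻ x in E, M.expectNext sel (beliefIndicator c) (x n) ∂μ :=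
      (M.setLIntegral_stateAverage sel Qinit heur n hE
        (M.expectNext_le_one sel (beliefIndicator_le_one c))).symm
    rw [integral_toReal (measurable_at n _).aemeasurable
      (Eventually.of_forall fun x => (M.nextProb_le_one sel c (x n)).trans_lt ENNReal.one_lt_top),
      h4]
    obtain ⟨U, hU, rfl⟩ := exists_of_measurableSet_visibleFiltration hE
    rw [← M.lintegral_rtdpLaw_succ sel Qinit heur n hU, setIntegral_indicator hm]
    have h3 : ∀ x : ℕ → RTDPConfig S A, beliefIndicator c (x (n + 1)) =
        {x : ℕ → RTDPConfig S A | (x (n + 1)).b = c}.indicator 1 x := fun x => rfl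
    simp_rw [h3]
    rw [lintegral_indicator_one hm, Measure.restrict_apply hm, Set.inter_comm]
    simp [Measure.real, hμ]

/-- Only an inequality, because several observations may lead to the same belief. The bound depends
on neither the tables nor the state, which makes the sum in `ae_fair` diverge. -/
theorem obsProb_le_nextProb {t : Tables S A} {b : PMF S} {a : A} (ha : M.Acts sel t b a)
    (s : S) (z : Z) :
    M.obsProb b a z ≤ M.nextProb sel (M.succ b a z) ⟨t, b, s⟩ := by
  rw [nextProb, M.stateAverage_expectNext_of_acts sel _ ha]
  refine le_trans (le_of_eq ?_) (Finset.single_le_sum (fun _ _ => zero_le) (Finset.mem_univ z))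
  simp [PMF.expect_const, beliefIndicator]

/-- Almost surely, every observation that has positive probability after an action taken
infinitely often from a belief is made infinitely often. -/
theorem ae_fair (b' : PMF S) (a : A) (z : Z) (hz : M.obsProb b' a z ≠ 0) :
    ∀ᵐ x ∂(M.rtdpLaw sel Qinit heur),
      (∃ᶠ n in atTop, (x n).b = b' ∧ M.Acts sel (x n).tab b' a) →
        ∃ᶠ n in atTop, (x n).b = M.succ b' a z := by
  set c := M.succ b' a z with hc
  -- Lévy's conditional Borel–Cantelli lemma: the belief `c` recurs exactly when its conditional
  -- probabilities have a divergent sum. Infinitely many of these terms are at least the fixed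
  -- positive probability of `z`.
  have hL := ae_mem_limsup_atTop_iff (ℱ := visibleFiltration S A) (M.rtdpLaw sel Qinit heur)
    (s := fun n => {x | (x n).b = c}) fun n => measurableSet_visible n fun _ b => b = c
  have hce : ∀ᵐ x ∂(M.rtdpLaw sel Qinit heur), ∀ n, (M.nextProb sel c (x n)).toReal = _ :=
    ae_all_iff.2 fun n => M.condExp_next sel Qinit heur n c
  filter_upwards [hL, hce] with x hx hce hfr
  have hlim : x ∈ limsup (fun n => {x : ℕ → RTDPConfig S A | (x n).b = c}) atTop := by
    rw [hx]
    simp_rw [← hce]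
    rw [← not_summable_iff_tendsto_nat_atTop_of_nonneg fun n => ENNReal.toReal_nonneg]
    intro hsum
    have hzero := hsum.tendsto_atTop_zero
    have hp : 0 < (M.obsProb b' a z).toReal := ENNReal.toReal_pos hz (M.obsProb_ne_top _ _ _)
    obtain ⟨n, ⟨h1, h2⟩, h3⟩ := (hfr.and_eventually (hzero.eventually_lt_const hp)).exists
    refine absurd h3 (not_lt.2 (ENNReal.toReal_mono ?_ ?_))
    · exact ne_top_of_le_ne_top ENNReal.one_ne_top (M.nextProb_le_one sel c _)
    · have := M.obsProb_le_nextProb sel h2 (x n).s z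
      rw [← h1] at this hc
      rw [← h1, hc]
      exact this
  rwa [Filter.mem_limsup_iff_frequently_mem] at hlim

/-! ### Almost every path takes only steps of positive probability. -/

/-- The configurations that can occur at time `n`. -/
def possibleConfigs : ℕ → Set (RTDPConfig S A)
  | 0 => (M.rtdpStart Qinit heur).support
  | n + 1 => ⋃ y ∈ possibleConfigs n, (M.rtdpStep sel y).support

/-- Configurations form an uncountable type; null sets indexed by the current configuration can be
united only over the countably many possible ones. -/
theorem countable_possibleConfigs (n : ℕ) :
    (M.possibleConfigs sel Qinit heur n).Countable := by
  induction n with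
  | zero => exact PMF.support_countable _
  | succ n ih => exact ih.biUnion fun y _ => PMF.support_countable _

theorem _root_.PMF.expect_indicator_compl_support {α : Type*} (p : PMF α) :
    p.expect (p.supportᶜ.indicator 1) = 0 := by
  refine ENNReal.tsum_eq_zero.2 fun x => ?_
  by_cases hx : x ∈ p.support
  · simp [hx]
  · rw [PMF.mem_support_iff, not_not] at hx
    rw [hx, zero_mul]

theorem ae_start : ∀ᵐ x ∂(M.rtdpLaw sel Qinit heur),
    x 0 ∈ (M.rtdpStart Qinit heur).support := by
  have h := M.lintegral_rtdpLaw_zero sel Qinit heur ((M.rtdpStart Qinit heur).supportᶜ.indicator 1)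
  rw [PMF.expect_indicator_compl_support, lintegral_eq_zero_iff (measurable_at 0 _)] at h
  filter_upwards [h] with x hx
  by_contra hcon
  rw [Set.indicator_of_mem (show x 0 ∈ (M.rtdpStart Qinit heur).supportᶜ from hcon)] at hx
  simp at hx

theorem ae_step_of_eq (n : ℕ) (y : RTDPConfig S A) : ∀ᵐ x ∂(M.rtdpLaw sel Qinit heur),
    x n = y → x (n + 1) ∈ (M.rtdpStep sel y).support := by
  have hU : MeasurableSet {h : (i : Finset.Iic n) → (fun _ : ℕ => RTDPConfig S A) i |
      h ⟨n, Finset.mem_Iic.2 le_rfl⟩ = y} := measurableSet_restrict_at _ {y}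
  have h := M.lintegral_rtdpLaw_succ sel Qinit heur n hU ((M.rtdpStep sel y).supportᶜ.indicator 1)
  have hm : MeasurableSet {x : ℕ → RTDPConfig S A | x n = y} := measurableSet_at n {y}
  have hpre : Preorder.frestrictLe (π := fun _ : ℕ => RTDPConfig S A) n ⁻¹'
      {h | h ⟨n, Finset.mem_Iic.2 le_rfl⟩ = y} = {x | x n = y} := rfl
  rw [hpre] at h
  have h0 : ∫⁻ x in {x : ℕ → RTDPConfig S A | x n = y},
      M.expectNext sel ((M.rtdpStep sel y).supportᶜ.indicator 1) (x n)
        ∂(M.rtdpLaw sel Qinit heur) = 0 := by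
    rw [setLIntegral_congr_fun (g := fun _ => 0) hm]
    · simp
    · intro x hx
      have : x n = y := hx
      simp only [this, expectNext, PMF.expect_indicator_compl_support]
  rw [h0, lintegral_eq_zero_iff (measurable_at (n + 1) _)] at h
  rw [Filter.EventuallyEq, ae_restrict_iff' hm] at h
  filter_upwards [h] with x hx hxy
  by_contra hcon
  have := hx hxy
  rw [Set.indicator_of_mem (show x (n + 1) ∈ (M.rtdpStep sel y).supportᶜ from hcon)] at this
  simp at this

theorem ae_step : ∀ᵐ x ∂(M.rtdpLaw sel Qinit heur),
    ∀ n, x (n + 1) ∈ (M.rtdpStep sel (x n)).support := by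
  have h1 : ∀ᵐ x ∂(M.rtdpLaw sel Qinit heur), ∀ n, ∀ y ∈ M.possibleConfigs sel Qinit heur n,
      x n = y → x (n + 1) ∈ (M.rtdpStep sel y).support :=
    ae_all_iff.2 fun n => (ae_ball_iff (M.countable_possibleConfigs sel Qinit heur n)).2
      fun y _ => M.ae_step_of_eq sel Qinit heur n y
  filter_upwards [M.ae_start sel Qinit heur, h1] with x h0 h1
  have h2 : ∀ n, x n ∈ M.possibleConfigs sel Qinit heur n := by
    intro n
    induction n with
    | zero => exact h0
    | succ n ih => exact Set.mem_biUnion ih (h1 n _ ih rfl)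
  exact fun n => h1 n _ (h2 n) rfl

variable {M sel}

/-- A step of positive probability, from a state that the current belief thinks possible. -/
theorem visibleStep_of_mem_support {x y : RTDPConfig S A} (hx : x.b x.s ≠ 0)
    (hy : y ∈ (M.rtdpStep sel x).support) :
    M.VisibleStep sel x.tab x.b y.tab y.b ∧ y.b y.s ≠ 0 := by
  unfold rtdpStep at hy
  split_ifs at hy with hb h
  · obtain ⟨s, hs, rfl⟩ := (PMF.mem_support_map_iff _ _ _).1 hy
    exact ⟨.restart _ _ hb, hs⟩
  · rw [PMF.support_pure, Set.mem_singleton_iff] at hy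
    subst hy
    exact ⟨.again _ _ hb h, hx⟩
  · obtain ⟨s', hs', hy⟩ := (PMF.mem_support_bind_iff _ _ _).1 hy
    obtain ⟨z, hz, rfl⟩ := (PMF.mem_support_map_iff _ _ _).1 hy
    rw [not_not] at h
    have hp : M.pred x.b (best sel x.tab x.b) s' ≠ 0 :=
      (M.pred_ne_zero_iff _ _ _).2 ⟨x.s, hs', hx⟩
    have ho : M.obsProb x.b (best sel x.tab x.b) z ≠ 0 :=
      (M.obsProb_ne_zero_iff _ _ _).2 ⟨s', hp, hz⟩
    exact ⟨.act _ _ hb h z ho, (M.succ_apply_ne_zero_iff _ _ _ ho _).2 ⟨hz, hp⟩⟩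

variable (M sel)

theorem ae_isFairPath [Finite A] : ∀ᵐ x ∂(M.rtdpLaw sel Qinit heur),
    (x 0).tab = M.startTables Qinit heur ∧
      M.IsFairPath sel (fun n => (x n).tab) (fun n => (x n).b) := by
  have hfair : ∀ᵐ x ∂(M.rtdpLaw sel Qinit heur), ∀ b' ∈ {b | M.Reachable b}, ∀ a z,
      M.obsProb b' a z ≠ 0 → (∃ᶠ n in atTop, (x n).b = b' ∧ M.Acts sel (x n).tab b' a) →
        ∃ᶠ n in atTop, (x n).b = M.succ b' a z := by
    refine (ae_ball_iff M.countable_reachable).2 fun b' _ => ae_all_iff.2 fun a =>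
      ae_all_iff.2 fun z => ?_
    by_cases hz : M.obsProb b' a z = 0
    · exact Eventually.of_forall fun _ h => absurd hz h
    · filter_upwards [M.ae_fair sel Qinit heur b' a z hz] with x hx _ using hx
  filter_upwards [M.ae_start sel Qinit heur, M.ae_step sel Qinit heur, hfair] with x h0 h1 h2
  obtain ⟨s, hs, hs0⟩ := (PMF.mem_support_map_iff _ _ _).1 h0
  -- The simulated state always lies in the support of the belief. Hence every observation sampled
  -- has positive probability under the belief, as a visible step requires.
  have hst : ∀ n, (x n).b (x n).s ≠ 0 := by
    intro n
    induction n with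
    | zero => rw [← hs0]; exact hs
    | succ n ih => exact (visibleStep_of_mem_support ih (h1 n)).2
  exact ⟨by rw [← hs0], by rw [← hs0], fun n => (visibleStep_of_mem_support (hst n) (h1 n)).1,
    fun b' a z hb' => h2 b' hb' a z⟩

end RTDPFair

/-! ### Lazy LAO*: single steps -/

section LAO

variable {S A Z : Type*} [Fintype S] {M : GoalPOMDP S A Z} [Fintype Z]
  {sel : PMF S → (A → ℝ) → A} {ε : ℝ}

theorem LAOStep.of_main {x y : LAOConfig S A} (h : M.LAOStep sel ε x y) (hx : x.phase = .main) :
    (∃ b, M.IsTip sel x.tab x.graph b ∧ y = ⟨x.tab, x.graph, .expand b⟩) ∨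
    ((∀ b, ¬ M.IsTip sel x.tab x.graph b) ∧ ∃ l, M.IsSweep x.graph.nodes l ∧
      y = ⟨x.tab, x.graph, .improve true x.graph.nodes l 0⟩) := by
  cases h with
  | pick t g b hb => exact Or.inl ⟨b, hb, rfl⟩
  | noTip t g l h hl => exact Or.inr ⟨h, l, hl, rfl⟩
  | _ => cases hx

theorem LAOStep.of_expand {x y : LAOConfig S A} (h : M.LAOStep sel ε x y) {b : PMF S}
    (hx : x.phase = .expand b) :
    (best sel (M.lazyBody sel x.tab b) b ≠ best sel x.tab b ∧
      y = ⟨M.lazyBody sel x.tab b, x.graph, .expand b⟩) ∨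
    (best sel (M.lazyBody sel x.tab b) b = best sel x.tab b ∧
      ∃ l, M.IsSweep (M.withAncestors x.graph b) l ∧
      y = ⟨setV (M.lazyBody sel x.tab b) b (best sel x.tab b), x.graph,
        .improve false (M.withAncestors x.graph b) l 0⟩) := by
  cases h with
  | again t g b h => cases hx; exact Or.inl ⟨h, rfl⟩
  | expanded t g b l h hl => cases hx; exact Or.inr ⟨h, l, hl, rfl⟩
  | _ => cases hx

theorem LAOStep.of_cons {x y : LAOConfig S A} (h : M.LAOStep sel ε x y) {final : Bool}
    {B : Set (PMF S)} {b : PMF S} {l : List (PMF S)} {err : ℝ}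
    (hx : x.phase = .improve final B (b :: l) err) :
    ((b, best sel (M.updateQ x.tab b) b) ∈ x.tab.ev ∧
      y = ⟨setV (M.updateQ x.tab b) b (best sel (M.updateQ x.tab b) b), x.graph,
        .improve final B l (max err
          |(M.updateQ x.tab b).Q b (best sel (M.updateQ x.tab b) b) - x.tab.V b|)⟩) ∨
    ((b, best sel (M.updateQ x.tab b) b) ∉ x.tab.ev ∧
      y = M.afterImprove sel final (M.updateQ x.tab b) x.graph) := by
  cases h with
  | backup t g final B b l err h => cases hx; exact Or.inl ⟨h, rfl⟩
  | cutOff t g final B b l err h => cases hx; exact Or.inr ⟨h, rfl⟩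
  | _ => cases hx

theorem LAOStep.of_nil {x y : LAOConfig S A} (h : M.LAOStep sel ε x y) {final : Bool}
    {B : Set (PMF S)} {err : ℝ} (hx : x.phase = .improve final B [] err) :
    (ε < err ∧ ∃ l, M.IsSweep B l ∧ y = ⟨x.tab, x.graph, .improve final B l 0⟩) ∨
    (err ≤ ε ∧ y = M.afterImprove sel final x.tab x.graph) := by
  cases h with
  | sweepAgain t g final B l err h hl => cases hx; exact Or.inl ⟨h, l, hl, rfl⟩
  | sweepEnd t g final B err h => cases hx; exact Or.inr ⟨h, rfl⟩
  | _ => cases hx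

theorem not_laoStep_of_returned {x y : LAOConfig S A} (hx : x.phase = .returned) :
    ¬ M.LAOStep sel ε x y := by
  intro h
  cases h <;> cases hx

theorem afterImprove_eq_or (final : Bool) (t : Tables S A) (g : SolGraph S A) :
    (final = true ∧ g = M.bestGraph sel t ∧
      M.afterImprove sel final t g = ⟨t, g, .returned⟩) ∨
    (¬ (final = true ∧ g = M.bestGraph sel t) ∧
      M.afterImprove sel final t g = ⟨t, M.bestGraph sel t, .main⟩) := by
  unfold afterImprove
  split_ifs with h
  · exact Or.inl ⟨h.1, h.2, rfl⟩
  · exact Or.inr ⟨h, rfl⟩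

theorem afterImprove_tab (final : Bool) (t : Tables S A) (g : SolGraph S A) :
    (M.afterImprove sel final t g).tab = t := by
  unfold afterImprove
  split_ifs <;> rfl

theorem afterImprove_graph (final : Bool) (t : Tables S A) (g : SolGraph S A) :
    (M.afterImprove sel final t g).graph = M.bestGraph sel t := by
  unfold afterImprove
  split_ifs with h
  · exact h.2
  · rfl

theorem BestReach.reachable {t : Tables S A} {b : PMF S} (h : M.BestReach sel t b) :
    M.Reachable b := by
  induction h with
  | start => exact .start
  | step b z _ _ _ hz ih => exact ih.succ hz

theorem bestGraph_act_eq_some {t : Tables S A} {b : PMF S} {a : A} :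
    (M.bestGraph sel t).act b = some a ↔ M.BestReach sel t b ∧ ¬ M.IsGoal b ∧
      (b, best sel t b) ∈ t.ev ∧ best sel t b = a := by
  unfold bestGraph
  dsimp only
  split_ifs with h
  · simp [h]
  · simp only [false_iff]
    exact fun h' => h ⟨h'.1, h'.2.1, h'.2.2.1⟩

theorem isComplete_bestGraph {t : Tables S A}
    (h : ∀ b, M.BestReach sel t b → ¬ M.IsGoal b → (b, best sel t b) ∈ t.ev) :
    M.IsComplete (M.bestGraph sel t) := by
  refine ⟨.start, fun b hb hg => ⟨_, bestGraph_act_eq_some.2 ⟨hb, hg, h b hb hg, rfl⟩⟩, ?_⟩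
  rintro b _ ⟨hb, a, z, ha, hz, rfl⟩
  obtain ⟨-, hg, he, rfl⟩ := bestGraph_act_eq_some.1 ha
  exact BestReach.step b z hb hg he hz

theorem isComplete_bestGraph_of_noTip {t : Tables S A}
    (h : ∀ b, ¬ M.IsTip sel t (M.bestGraph sel t) b) : M.IsComplete (M.bestGraph sel t) := by
  refine isComplete_bestGraph fun b hb hg => ?_
  by_contra he
  exact h b ⟨hb, hg, Or.inr he⟩

theorem withAncestors_subset {g : SolGraph S A} {b : PMF S} (hb : b ∈ g.nodes) :
    M.withAncestors g b ⊆ g.nodes := by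
  intro b' hb'
  rcases Relation.ReflTransGen.cases_head hb' with rfl | ⟨c, hc, -⟩
  · exact hb
  · exact hc.1

theorem LAOStep.tableOps {x y : LAOConfig S A} (h : M.LAOStep sel ε x y)
    (hexp : ∀ b, x.phase = .expand b → ¬ M.IsGoal b)
    (himp : ∀ f B l err, x.phase = .improve f B l err → ∀ b ∈ l, ¬ M.IsGoal b) :
    M.TableOps sel x.tab y.tab := by
  cases h with
  | pick => exact .refl
  | noTip => exact .refl
  | again t g b h => exact M.tableOps_lazyBody t b
  | expanded t g b l h hl => exact M.tableOps_setV_lazyBody (hexp b rfl) h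
  | backup t g final B b l err h =>
    exact M.tableOps_setV_updateQ (himp _ _ _ _ rfl b List.mem_cons_self)
  | cutOff t g final B b l err h =>
    rw [afterImprove_tab]
    exact .single (.updateQ t b)
  | sweepAgain => exact .refl
  | sweepEnd =>
    rw [afterImprove_tab]
    exact .refl

/-- What is known about a sweep of ImproveValues: the beliefs that have been processed carry the
lookahead values of their best actions, up to the changes made later in the sweep. -/
def SweepInv (M : GoalPOMDP S A Z) (sel : PMF S → (A → ℝ) → A) (t : Tables S A)
    (B : Set (PMF S)) (l : List (PMF S)) (err : ℝ) : Prop :=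
  ∀ b ∈ B, ¬ M.IsGoal b → b ∉ l → ∃ U : PMF S → ℝ,
    (∀ b', |U b' - t.V b'| ≤ err) ∧ (∀ b' ∈ l, U b' = t.V b') ∧
    t.V b = M.qval U b (best sel t b)

/-- What is known about the control state of Lazy LAO*. -/
def PhaseInv (M : GoalPOMDP S A Z) (sel : PMF S → (A → ℝ) → A) (ε : ℝ) (t : Tables S A)
    (g : SolGraph S A) : LAOPhase S → Prop
  | .main => g = M.bestGraph sel t
  | .expand b => b ∈ g.nodes ∧ ¬ M.IsGoal b
  | .improve final B l err => B ⊆ g.nodes ∧ {b ∈ B | ¬ M.IsGoal b}.Finite ∧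
      (∀ b ∈ l, b ∈ B ∧ ¬ M.IsGoal b) ∧ l.Nodup ∧ 0 ≤ err ∧
      (final = true → B = g.nodes ∧ M.IsComplete g) ∧ M.SweepInv sel t B l err
  | .returned => g = M.bestGraph sel t ∧ M.IsComplete g ∧ {b ∈ g.nodes | ¬ M.IsGoal b}.Finite ∧
      ∀ b ∈ g.nodes, ¬ M.IsGoal b → M.qval t.V b (best sel t b) - ε ≤ t.V b

/-- What is known about a configuration of Lazy LAO*. -/
structure LAOInv (M : GoalPOMDP S A Z) (sel : PMF S → (A → ℝ) → A) (ε : ℝ)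
    (Qinit : PMF S → A → ℝ) (x : LAOConfig S A) : Prop where
  admissible : M.Admissible Qinit x.tab
  reachable : ∀ b ∈ x.graph.nodes, M.Reachable b
  phase : M.PhaseInv sel ε x.tab x.graph x.phase

theorem IsSweep.finite {B : Set (PMF S)} {l : List (PMF S)} (h : M.IsSweep B l) :
    {b ∈ B | ¬ M.IsGoal b}.Finite :=
  (List.finite_toSet l).subset fun b hb => (h.2 b).2 hb

theorem phaseInv_start_sweep {t : Tables S A} {g : SolGraph S A} {final : Bool}
    {B : Set (PMF S)} {l : List (PMF S)} (hl : M.IsSweep B l) (hB : B ⊆ g.nodes)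
    (hfinal : final = true → B = g.nodes ∧ M.IsComplete g) :
    M.PhaseInv sel ε t g (.improve final B l 0) :=
  ⟨hB, hl.finite, fun b hb => (hl.2 b).1 hb, hl.1, le_rfl, hfinal,
    fun b hb hg hbl => absurd ((hl.2 b).2 ⟨hb, hg⟩) hbl⟩

/-- A belief occurs at most once in a sweep, so its value changes at most once and `err` bounds the
drift since any earlier backup. That is why `U` must agree with the current values on the beliefs
still to be processed. -/
theorem sweepInv_backup {t : Tables S A} {B : Set (PMF S)} {b : PMF S} {l : List (PMF S)}
    {err : ℝ} (h : M.SweepInv sel t B (b :: l) err) (herr : 0 ≤ err) (hnd : (b :: l).Nodup)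
    (hev : (b, best sel (M.updateQ t b) b) ∈ t.ev) :
    M.SweepInv sel (setV (M.updateQ t b) b (best sel (M.updateQ t b) b)) B l
      (max err |(M.updateQ t b).Q b (best sel (M.updateQ t b) b) - t.V b|) := by
  intro d hd hg hdl
  rw [best_setV]
  have hbl : b ∉ l := (List.nodup_cons.1 hnd).1
  by_cases hdb : d = b
  · subst hdb
    refine ⟨t.V, fun b' => ?_, fun b' hb' => ?_, ?_⟩
    · by_cases hb' : b' = d
      · subst hb'
        rw [setV_V_self, abs_sub_comm]
        exact le_max_right _ _
      · rw [setV_V_of_ne _ _ hb', updateQ_V, sub_self, abs_zero]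
        exact le_max_of_le_left herr
    · rw [setV_V_of_ne _ _ fun hb : b' = d => hbl (hb ▸ hb'), updateQ_V]
    · rw [setV_V_self, updateQ_Q_self, partialQ, if_pos hev]
  · obtain ⟨U, h1, h2, h3⟩ := h d hd hg (by simp [hdb, hdl])
    refine ⟨U, fun b' => ?_, fun b' hb' => ?_, ?_⟩
    · by_cases hb' : b' = b
      · subst hb'
        rw [setV_V_self, h2 b' List.mem_cons_self, abs_sub_comm]
        exact le_max_right _ _
      · rw [setV_V_of_ne _ _ hb', updateQ_V]
        exact le_max_of_le_left (h1 b')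
    · rw [setV_V_of_ne _ _ fun hb : b' = b => hbl (hb ▸ hb'), updateQ_V]
      exact h2 b' (List.mem_cons_of_mem _ hb')
    · rw [setV_V_of_ne _ _ hdb, updateQ_V, h3, best_congr (M.updateQ_Q_of_ne t hdb)]

theorem laoInv_afterImprove {Qinit : PMF S → A → ℝ} {t : Tables S A} {g : SolGraph S A}
    {final : Bool} (ht : M.Admissible Qinit t)
    (hret : final = true → g = M.bestGraph sel t → M.PhaseInv sel ε t g .returned) :
    M.LAOInv sel ε Qinit (M.afterImprove sel final t g) := by
  refine ⟨by rwa [afterImprove_tab], ?_, ?_⟩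
  · rw [afterImprove_graph]
    exact fun b hb => BestReach.reachable hb
  · rcases afterImprove_eq_or (M := M) (sel := sel) final t g with ⟨h1, h2, h3⟩ | ⟨-, h3⟩
    · rw [h3]; exact hret h1 h2
    · rw [h3]; exact rfl

theorem LAOInv.tableOps {Qinit : PMF S → A → ℝ} {x y : LAOConfig S A}
    (hx : M.LAOInv sel ε Qinit x) (h : M.LAOStep sel ε x y) : M.TableOps sel x.tab y.tab := by
  refine h.tableOps (fun b hb => ?_) (fun f B l err hp b hb => ?_)
  · have := hx.phase
    rw [hb] at this
    exact this.2
  · have := hx.phase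
    rw [hp] at this
    exact (this.2.2.1 b hb).2

variable [Fintype A] [Nonempty A]

theorem LAOInv.step {Qinit : PMF S → A → ℝ} (hfin : ∀ b, M.Reachable b → M.optCost b ≠ ∞)
    (hsel : ∀ b (q : A → ℝ) a, q (sel b q) ≤ q a) {x y : LAOConfig S A}
    (hx : M.LAOInv sel ε Qinit x) (h : M.LAOStep sel ε x y) : M.LAOInv sel ε Qinit y := by
  have hops := hx.tableOps h
  have hadm := hx.admissible.tableOps hfin hsel hops
  have hph := hx.phase
  cases h with
  | pick t g b hb => exact ⟨hadm, hx.reachable, hb.1, hb.2.1⟩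
  | again t g b h => exact ⟨hadm, hx.reachable, hph⟩
  | expanded t g b l h hl =>
    exact ⟨hadm, hx.reachable, phaseInv_start_sweep hl (withAncestors_subset hph.1) (by simp)⟩
  | noTip t g l h hl =>
    refine ⟨hadm, hx.reachable, phaseInv_start_sweep hl subset_rfl fun _ => ⟨rfl, ?_⟩⟩
    have hg : g = M.bestGraph sel t := hph
    rw [hg] at h ⊢
    exact isComplete_bestGraph_of_noTip h
  | backup t g final B b l err h =>
    obtain ⟨h1, h2, h3, h4, h5, h6, h7⟩ := hph
    exact ⟨hadm, hx.reachable, h1, h2, fun b' hb' => h3 b' (List.mem_cons_of_mem _ hb'),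
      (List.nodup_cons.1 h4).2, le_max_of_le_left h5, h6, sweepInv_backup h7 h5 h4 h⟩
  | cutOff t g final B b l err h =>
    rw [afterImprove_tab] at hadm
    refine laoInv_afterImprove hadm fun hf hg => ?_
    -- A cut-off cannot lead to a return: the graph is complete, so if it were the current best
    -- graph, the best action at `b` would have been evaluated.
    obtain ⟨-, -, h3, -, -, h6, -⟩ := hph
    obtain ⟨h7, h8⟩ := h6 hf
    obtain ⟨h9, h10⟩ := h3 b List.mem_cons_self
    obtain ⟨a, ha⟩ := h8.2.1 b (h7 ▸ h9) h10
    rw [hg] at ha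
    exact absurd (bestGraph_act_eq_some.1 ha).2.2.1 h
  | sweepAgain t g final B l err h hl =>
    exact ⟨hadm, hx.reachable, phaseInv_start_sweep hl hph.1 hph.2.2.2.2.2.1⟩
  | sweepEnd t g final B err h =>
    rw [afterImprove_tab] at hadm
    refine laoInv_afterImprove hadm fun hf hg => ?_
    obtain ⟨-, h2, -, -, -, h6, h7⟩ := hph
    obtain ⟨hB, h8⟩ := h6 hf
    dsimp only at hB
    subst hB
    refine ⟨hg, h8, h2, fun b hb hbg => ?_⟩
    -- After a full sweep nothing is left to process, so `U` is within `ε` of the final values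
    -- everywhere, and averaging keeps this bound.
    obtain ⟨U, hU, -, hV⟩ := h7 b hb hbg List.not_mem_nil
    dsimp only at hU hV ⊢
    rw [hV, sub_eq_add_neg, ← M.qval_const_add]
    refine M.qval_mono fun z _ => ?_
    linarith [neg_abs_le (U (M.succ b (best sel t b) z) - t.V (M.succ b (best sel t b) z)),
      hU (M.succ b (best sel t b) z)]

theorem bestGraph_startTables (Qinit : PMF S → A → ℝ) (heur : PMF S → ℝ) :
    M.bestGraph sel (M.startTables Qinit heur) = ⟨{M.b₀}, fun _ => none⟩ := by
  ext b
  · constructor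
    · intro hb
      cases (show M.BestReach sel (M.startTables Qinit heur) b from hb) with
      | start => rfl
      | step b z _ _ he _ => exact absurd he (Set.notMem_empty _)
    · rintro rfl
      exact .start
  · rw [bestGraph_act_eq_some]
    simp [startTables]

theorem laoInv_laoStart (hfin : ∀ b, M.Reachable b → M.optCost b ≠ ∞)
    {Qinit : PMF S → A → ℝ} {heur : PMF S → ℝ}
    (hQ : ∀ b a, ((Qinit b a : ℝ) : EReal) ≤ ((M.optQ b a : ℝ≥0∞) : EReal))
    (hheur : ∀ b, ((heur b : ℝ) : EReal) ≤ ((M.optCost b : ℝ≥0∞) : EReal)) :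
    M.LAOInv sel ε Qinit (M.laoStart Qinit heur) where
  admissible := M.admissible_startTables hfin hQ hheur
  reachable b hb := by
    rw [show b = M.b₀ from hb]
    exact .start
  phase := (bestGraph_startTables Qinit heur).symm

theorem laoInv_of_isLAORun (hfin : ∀ b, M.Reachable b → M.optCost b ≠ ∞)
    (hsel : ∀ b (q : A → ℝ) a, q (sel b q) ≤ q a)
    {Qinit : PMF S → A → ℝ} {heur : PMF S → ℝ}
    (hQ : ∀ b a, ((Qinit b a : ℝ) : EReal) ≤ ((M.optQ b a : ℝ≥0∞) : EReal))
    (hheur : ∀ b, ((heur b : ℝ) : EReal) ≤ ((M.optCost b : ℝ≥0∞) : EReal))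
    {x : ℕ → LAOConfig S A} (hx : M.IsLAORun sel ε Qinit heur x) (n : ℕ) :
    M.LAOInv sel ε Qinit (x n) := by
  induction n with
  | zero => rw [hx.1]; exact laoInv_laoStart hfin hQ hheur
  | succ n ih =>
    rcases hx.2 n with h | ⟨-, h⟩
    · exact ih.step hfin hsel h
    · rwa [h]

/-- The policies that follow a returned graph are optimal up to a factor close to `1`. -/
theorem LAOInv.policyCost_le_of_returned
    {κ θ : ℝ} (hκ : 0 < κ)
    (hc : ∀ b, M.Reachable b → ¬ M.IsGoal b → ∀ a, κ ≤ (M.cost b a).toReal)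
    (hθ0 : 0 ≤ θ) (hθ : θ < 1) (hε : ε ≤ θ * κ)
    {Qinit : PMF S → A → ℝ} {x : LAOConfig S A} (hx : M.LAOInv sel ε Qinit x)
    (hr : x.phase = .returned) {π : PMF S → A} (hπ : Follows x.graph π) :
    M.policyCost π M.b₀ ≤ ENNReal.ofReal (M.optVal M.b₀ / (1 - θ)) := by
  have hph := hx.phase
  rw [hr] at hph
  obtain ⟨hg, hcomp, hfinite, hV⟩ := hph
  have hπb : ∀ b ∈ x.graph.nodes, ¬ M.IsGoal b → π b = best sel x.tab b ∧
      x.graph.act b = some (π b) := by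
    intro b hb hbg
    obtain ⟨a, ha⟩ := hcomp.2.1 b hb hbg
    have h1 := hπ b hb a ha
    subst h1
    rw [hg] at ha
    exact ⟨(bestGraph_act_eq_some.1 ha).2.2.2.symm, by rw [hg]; exact ha⟩
  -- A returned graph has been swept by a finite list, so its values are bounded below whatever
  -- `heur` is.
  obtain ⟨m, hm⟩ := (hfinite.image x.tab.V).bddBelow
  -- The residual `ε` is at most `θ * κ`, hence at most `θ` times the immediate cost. It is absorbed
  -- by scaling the costs by `r = 1 - θ`.
  have hver := M.policyCost_le_ofReal (D := x.graph.nodes) (v := x.tab.V) (π := π)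
    (m := min m 0) (r := 1 - θ) (sub_pos.2 hθ) hκ
    (fun b hb hbg z hz => hcomp.2.2 b _ ⟨hb, π b, z, (hπb b hb hbg).2, hz, rfl⟩)
    (fun b _ hbg => (hx.admissible.V_goal b hbg).ge)
    (fun b hb => by
      by_cases hbg : M.IsGoal b
      · rw [hx.admissible.V_goal b hbg]; exact min_le_right _ _
      · exact (min_le_left _ _).trans (hm ⟨b, ⟨hb, hbg⟩, rfl⟩))
    (fun b hb hbg => hc b (hx.reachable b hb) hbg _)
    (fun b hb hbg => by
      have h1 := hV b hb hbg
      rw [← (hπb b hb hbg).1] at h1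
      have h2 := mul_le_mul_of_nonneg_left (hc b (hx.reachable b hb) hbg (π b)) hθ0
      linarith) hcomp.1
  refine hver.2.trans (ENNReal.ofReal_le_ofReal ?_)
  exact div_le_div_of_nonneg_right (hx.admissible.V_le _ .start) (sub_pos.2 hθ).le

theorem laoStar_returned (hpos : ∀ s, s ∉ M.G → ∀ a, 0 < M.c s a)
    (hfin : ∀ b, M.Reachable b → M.optCost b ≠ ∞)
    (hsel : ∀ b (q : A → ℝ) a, q (sel b q) ≤ q a)
    {Qinit : PMF S → A → ℝ} {heur : PMF S → ℝ}
    (hQ : ∀ b a, ((Qinit b a : ℝ) : EReal) ≤ ((M.optQ b a : ℝ≥0∞) : EReal))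
    (hheur : ∀ b, ((heur b : ℝ) : EReal) ≤ ((M.optCost b : ℝ≥0∞) : EReal))
    (δ : ℝ≥0) (hδ : 0 < δ) :
    ∃ ε₀ : ℝ, 0 < ε₀ ∧ ∀ ε : ℝ, 0 < ε → ε < ε₀ →
      ∀ x : ℕ → LAOConfig S A, M.IsLAORun sel ε Qinit heur x →
        ∀ n, (x n).phase = .returned →
          M.IsComplete (x n).graph ∧
          ∀ π, Follows (x n).graph π → M.policyCost π M.b₀ ≤ M.optCost M.b₀ + δ := by
  obtain ⟨κ, hκ, hc⟩ := M.exists_cost_lower_bound hpos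
  have hδ' : (0 : ℝ) < δ := by exact_mod_cast hδ
  have hW := M.optVal_nonneg M.b₀
  -- Chosen so that `(1 - θ) * (M.optVal M.b₀ + δ) = M.optVal M.b₀ + δ / 2`, which leaves room for
  -- the factor `1 / (1 - θ)`; also `θ < 1`.
  set θ : ℝ := δ / (2 * (M.optVal M.b₀ + δ)) with hθdef
  have hden : 0 < 2 * (M.optVal M.b₀ + δ) := by positivity
  have hθ0 : 0 < θ := div_pos hδ' hden
  have hθ : θ ≤ 1 / 2 := by
    rw [hθdef, div_le_div_iff₀ hden two_pos]; linarith
  have hθW : 2 * θ * M.optVal M.b₀ ≤ δ := by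
    have h1 : θ * (2 * (M.optVal M.b₀ + δ)) = δ := div_mul_cancel₀ _ hden.ne'
    nlinarith
  refine ⟨θ * κ, by positivity, fun ε _ hε x hx n hr => ?_⟩
  have hinv := laoInv_of_isLAORun hfin hsel hQ hheur hx n
  refine ⟨?_, fun π hπ => ?_⟩
  · have := hinv.phase
    rw [hr] at this
    exact this.2.1
  · refine (hinv.policyCost_le_of_returned hκ hc hθ0.le (by linarith) hε.le hr hπ).trans ?_
    have h1 : M.optVal M.b₀ / (1 - θ) ≤ M.optVal M.b₀ + δ := by
      rw [div_le_iff₀ (by linarith)]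
      nlinarith
    refine (ENNReal.ofReal_le_ofReal h1).trans (le_of_eq ?_)
    rw [ENNReal.ofReal_add hW hδ'.le, optVal, ENNReal.ofReal_toReal (hfin _ .start),
      ENNReal.ofReal_coe_nnreal]

end LAO

/-! ### Lazy LAO*: runs that never return -/

section LAORun

variable {S A Z : Type*} [Fintype S] (M : GoalPOMDP S A Z) [Fintype Z]
  (sel : PMF S → (A → ℝ) → A) (ε : ℝ) (Qinit : PMF S → A → ℝ)

/-- A run of Lazy LAO* on finitely many reachable beliefs that never returns. -/
structure IsEndlessRun (x : ℕ → LAOConfig S A) : Prop where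
  step : ∀ n, M.LAOStep sel ε (x n) (x (n + 1))
  inv : ∀ n, M.LAOInv sel ε Qinit (x n)
  finite : {b | M.Reachable b}.Finite
  lower : ∃ m, ∀ n, M.BoundedBelow m (x n).tab

/-- The pairs that are evaluated at some time. -/
def everEvaluated (x : ℕ → LAOConfig S A) : Set (PMF S × A) := ⋃ n, (x n).tab.ev

/-- All actions that are ever evaluated from a reachable belief have been evaluated by time `n`. -/
def Stable (x : ℕ → LAOConfig S A) (n : ℕ) : Prop :=
  ∀ b, M.Reachable b → ∀ a, (b, a) ∈ everEvaluated x → (b, a) ∈ (x n).tab.ev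

/-- At time `n`, ImproveValues is not cut off. -/
def NotCut (x : ℕ → LAOConfig S A) (n : ℕ) : Prop :=
  ∀ f B b l err, (x n).phase = .improve f B (b :: l) err →
    ∃ err', (x (n + 1)).phase = .improve f B l err'

/-- At time `n`, ImproveValues backs up the belief `b`. -/
def BacksUp (x : ℕ → LAOConfig S A) (b : PMF S) (n : ℕ) : Prop :=
  ∃ f B l err err', (x n).phase = .improve f B (b :: l) err ∧
    (x (n + 1)).phase = .improve f B l err'

variable {M sel ε Qinit}

theorem afterImprove_phase_ne (final : Bool) (t : Tables S A) (g : SolGraph S A) {f : Bool}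
    {B : Set (PMF S)} {l : List (PMF S)} {err : ℝ} :
    (M.afterImprove sel final t g).phase ≠ .improve f B l err := by
  rcases afterImprove_eq_or (M := M) (sel := sel) final t g with ⟨-, -, h⟩ | ⟨-, h⟩ <;>
    simp [h]

theorem exists_backsUp_of_mem {x : ℕ → LAOConfig S A} {N : ℕ} (hN : ∀ n ≥ N, NotCut x n)
    {f : Bool} {B : Set (PMF S)} {l : List (PMF S)} {b : PMF S} (hb : b ∈ l) :
    ∀ {n : ℕ} {err : ℝ}, N ≤ n → (x n).phase = .improve f B l err →
      ∃ m ≥ n, BacksUp x b m := by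
  induction l with
  | nil => simp at hb
  | cons d l ih =>
    intro n err hn hx
    obtain ⟨err', h⟩ := hN n hn _ _ _ _ _ hx
    rcases List.mem_cons.1 hb with rfl | hb
    · exact ⟨n, le_rfl, _, _, _, _, _, hx, h⟩
    · obtain ⟨m, hm, h'⟩ := ih hb (hn.trans n.le_succ) h
      exact ⟨m, by omega, h'⟩

theorem exists_sweep_done {x : ℕ → LAOConfig S A} {N : ℕ} (hN : ∀ n ≥ N, NotCut x n)
    {f : Bool} {B : Set (PMF S)} {l : List (PMF S)} :
    ∀ {n : ℕ} {err : ℝ}, N ≤ n → (x n).phase = .improve f B l err →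
      ∃ m ≥ n, ∃ err', (x m).phase = .improve f B [] err' := by
  induction l with
  | nil => intro n err _ hx; exact ⟨n, le_rfl, err, hx⟩
  | cons d l ih =>
    intro n err hn hx
    obtain ⟨err', h⟩ := hN n hn _ _ _ _ _ hx
    obtain ⟨m, hm, h'⟩ := ih (hn.trans n.le_succ) h
    exact ⟨m, by omega, h'⟩

namespace IsEndlessRun

variable {x : ℕ → LAOConfig S A} (hx : M.IsEndlessRun sel ε Qinit x)
include hx

theorem monotone_ev : Monotone fun n => (x n).tab.ev :=
  monotone_nat_of_le_succ fun n => ((hx.inv n).tableOps (hx.step n)).ev_subset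

theorem eventually_stable [Finite A] : ∀ᶠ n in atTop, M.Stable x n := by
  have : Finite {b | M.Reachable b} := hx.finite
  filter_upwards [eventually_mem_of_mem_succ hx.monotone_ev
    fun p : {b | M.Reachable b} × A => (p.1.1, p.2)] with n hn b hb a ha
  obtain ⟨k, hk⟩ := Set.mem_iUnion.1 ha
  exact hn k (⟨b, hb⟩, a) hk

theorem phase_ne_returned (n : ℕ) : (x n).phase ≠ .returned :=
  fun h => not_laoStep_of_returned h (hx.step n)

theorem afterImprove_main {n : ℕ} {f : Bool} {t : Tables S A} {g : SolGraph S A}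
    (h : x n = M.afterImprove sel f t g) :
    ¬ (f = true ∧ g = M.bestGraph sel t) ∧ x n = ⟨t, M.bestGraph sel t, .main⟩ := by
  rcases afterImprove_eq_or (M := M) (sel := sel) f t g with ⟨-, -, h'⟩ | ⟨h1, h'⟩
  · exact absurd (by rw [h, h']) (hx.phase_ne_returned n)
  · exact ⟨h1, by rw [h, h']⟩

theorem partialQ_eq {n : ℕ} (hn : M.Stable x n) {b : PMF S} (hb : M.Reachable b) :
    M.partialQ (x n).tab.ev (x n).tab.Q (x n).tab.V b =
      M.partialQ (everEvaluated x) Qinit (x n).tab.V b := by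
  rw [(hx.inv n).admissible.partialQ_eq]
  funext a
  have : (b, a) ∈ (x n).tab.ev ↔ (b, a) ∈ everEvaluated x :=
    ⟨fun h => Set.mem_iUnion.2 ⟨n, h⟩, hn b hb a⟩
  simp only [partialQ, this]

theorem of_backsUp {b : PMF S} {n : ℕ} (h : BacksUp x b n) :
    M.Reachable b ∧ ¬ M.IsGoal b ∧
      (x (n + 1)).tab = setV (M.updateQ (x n).tab b) b (best sel (M.updateQ (x n).tab b) b) := by
  obtain ⟨f, B, l, err, err', h1, h2⟩ := h
  have hph := (hx.inv n).phase
  rw [h1] at hph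
  obtain ⟨h3, -, h4, -⟩ := hph
  obtain ⟨h5, h6⟩ := h4 b List.mem_cons_self
  refine ⟨(hx.inv n).reachable b (h3 h5), h6, ?_⟩
  rcases (hx.step n).of_cons h1 with ⟨-, h⟩ | ⟨-, h⟩
  · rw [h]
  · rw [h] at h2
    exact absurd h2 (afterImprove_phase_ne _ _ _)

theorem Q_of_backsUp {b : PMF S} {n : ℕ} (hn : M.Stable x n) (h : BacksUp x b n) :
    (x (n + 1)).tab.Q b = M.partialQ (everEvaluated x) Qinit (x n).tab.V b ∧
    (x (n + 1)).tab.V b = (x (n + 1)).tab.Q b (best sel (x (n + 1)).tab b) := by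
  obtain ⟨hb, -, h⟩ := hx.of_backsUp h
  rw [← hx.partialQ_eq hn hb, h, best_setV, setV_V_self]
  exact ⟨funext fun a => M.updateQ_Q_self _ b a, rfl⟩

/-- Outside the do-while loop, the values and Q-values change only by backups. -/
theorem eq_or_backsUp {n : ℕ} (hexp : ∀ b, (x n).phase ≠ .expand b) (hcut : NotCut x n)
    (d : PMF S) : ((x (n + 1)).tab.V d = (x n).tab.V d ∧ (x (n + 1)).tab.Q d = (x n).tab.Q d) ∨
      BacksUp x d n := by
  rcases hph : (x n).phase with _ | b | ⟨f, B, l, err⟩ | _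
  · rcases (hx.step n).of_main hph with ⟨b, -, h⟩ | ⟨-, l, -, h⟩ <;> simp [h]
  · exact absurd hph (hexp b)
  · cases l with
    | nil =>
      rcases (hx.step n).of_nil hph with ⟨-, l, -, h⟩ | ⟨-, h⟩
      · simp [h]
      · simp [h, afterImprove_tab]
    | cons b l =>
      obtain ⟨err', h⟩ := hcut _ _ _ _ _ hph
      have hb : BacksUp x b n := ⟨_, _, _, _, _, hph, h⟩
      by_cases hd : d = b
      · subst hd
        exact Or.inr hb
      · left
        rw [(hx.of_backsUp hb).2.2]
        exact ⟨setV_V_of_ne _ _ hd, M.updateQ_Q_of_ne _ hd⟩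
  · exact absurd hph (hx.phase_ne_returned n)

variable [Fintype A] [Nonempty A]

/-- Once only backups are made, the values converge. -/
theorem exists_tendsto_V (hpos : ∀ s, s ∉ M.G → ∀ a, 0 < M.c s a)
    (hsel : ∀ b (q : A → ℝ) a, q (sel b q) ≤ q a)
    (h : ∀ᶠ n in atTop, (∀ b, (x n).phase ≠ .expand b) ∧ NotCut x n) :
    ∃ L : PMF S → ℝ, ∀ b, Tendsto (fun n => (x n).tab.V b) atTop (𝓝 (L b)) := by
  obtain ⟨κ, hκ, hc⟩ := M.exists_cost_lower_bound hpos
  obtain ⟨m, hm⟩ := hx.lower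
  set J : Set (PMF S) := {b | ∃ᶠ n in atTop, BacksUp x b n} with hJ
  have hJR : ∀ b ∈ J, M.Reachable b ∧ ¬ M.IsGoal b := by
    intro b hb
    obtain ⟨n, hn⟩ := hb.exists
    exact ⟨(hx.of_backsUp hn).1, (hx.of_backsUp hn).2.1⟩
  have hst := hx.eventually_stable
  refine M.exists_tendsto_of_backups (J := J) (hx.finite.subset fun b hb => (hJR b hb).1) hκ
    (fun b hb a => hc b (hJR b hb).1 (hJR b hb).2 a) (everEvaluated x) Qinit
    (fun n => (x n).tab.V) (BacksUp x) (fun b hb => ?_) (fun b hb => ?_) (fun b hb => hb)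
    (fun b hb => ?_) (fun b hb => ?_)
    (fun b hb => ⟨m, Eventually.of_forall fun n => (hm n b (hJR b hb).1).1⟩)
    (fun b hb => ⟨M.optVal b, Eventually.of_forall fun n =>
      (hx.inv n).admissible.V_le b (hJR b hb).1⟩)
  · filter_upwards [h, not_frequently.1 hb] with n hn hb
    exact ((hx.eq_or_backsUp hn.1 hn.2 b).resolve_right hb).1
  · filter_upwards [h] with n hn
    exact (hx.eq_or_backsUp hn.1 hn.2 b).imp And.left id
  · filter_upwards [hst] with n hn hC a
    obtain ⟨h1, h2⟩ := hx.Q_of_backsUp hn hC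
    rw [h2, ← h1]
    exact hsel b _ a
  · filter_upwards [hst] with n hn hC
    obtain ⟨h1, h2⟩ := hx.Q_of_backsUp hn hC
    exact ⟨_, by rw [h2, ← h1]⟩

/-- With no new action to evaluate, the second round of the do-while loop repeats the first and the
best action cannot change again. -/
theorem exists_improve {n : ℕ} (hn : M.Stable x n) (hmain : ∀ k ≥ n, (x k).phase ≠ .main) :
    ∃ k ≥ n, ∃ f B l err, (x k).phase = .improve f B l err := by
  rcases hph : (x n).phase with _ | b | ⟨f, B, l, err⟩ | _
  · exact absurd hph (hmain n le_rfl)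
  · rcases (hx.step n).of_expand hph with ⟨-, h1⟩ | ⟨-, l, -, h1⟩
    swap
    · exact ⟨n + 1, n.le_succ, _, _, _, _, by rw [h1]⟩
    have hph1 : (x (n + 1)).phase = .expand b := by rw [h1]
    rcases (hx.step (n + 1)).of_expand hph1 with ⟨h2, h3⟩ | ⟨-, l, -, h2⟩
    swap
    · exact ⟨n + 2, by omega, _, _, _, _, by rw [h2]⟩
    exfalso
    have hinv := (hx.inv n).phase
    rw [hph] at hinv
    have hmem : (b, best sel (x (n + 1)).tab b) ∈ (x (n + 1)).tab.ev := by
      refine hx.monotone_ev n.le_succ (hn b ((hx.inv n).reachable b hinv.1) _ ?_)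
      refine Set.mem_iUnion.2 ⟨n + 2, ?_⟩
      rw [h3]
      exact Set.mem_insert _ _
    have htab : (x (n + 1)).tab = M.lazyBody sel (x n).tab b := by rw [h1]
    rw [htab] at hmem h2
    rw [M.lazyBody_lazyBody hmem] at h2
    exact h2 rfl
  · exact ⟨n, le_rfl, f, B, l, err, hph⟩
  · exact absurd hph (hx.phase_ne_returned n)

/-- No call of ImproveValues and no do-while loop runs forever. -/
theorem frequently_main (hpos : ∀ s, s ∉ M.G → ∀ a, 0 < M.c s a)
    (hsel : ∀ b (q : A → ℝ) a, q (sel b q) ≤ q a) (hε : 0 < ε) :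
    ∃ᶠ n in atTop, (x n).phase = .main := by
  by_contra hcon
  rw [not_frequently] at hcon
  obtain ⟨N, hN⟩ := eventually_atTop.1 (hcon.and hx.eventually_stable)
  obtain ⟨k, hk, f, B, l, err, hph⟩ := hx.exists_improve (hN N le_rfl).2
    fun k hk => (hN k hk).1
  -- Leaving ImproveValues would lead to the main loop, since the run never returns. So the same
  -- call, on the same set `B`, goes on forever without a cut-off.
  have hnext : ∀ n ≥ k, ∀ l err, (x n).phase = .improve f B l err →
      NotCut x n ∧ ∃ l' err', (x (n + 1)).phase = .improve f B l' err' := by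
    intro n hn l err h
    have hmain : ∀ t : Tables S A, x (n + 1) ≠ M.afterImprove sel f t (x n).graph := by
      intro t h'
      exact (hN (n + 1) (by omega)).1 (by rw [(hx.afterImprove_main h').2])
    cases l with
    | nil =>
      refine ⟨fun f B b l err h' => by simp [h] at h', ?_⟩
      rcases (hx.step n).of_nil h with ⟨-, l, -, h1⟩ | ⟨-, h1⟩
      · exact ⟨l, 0, by rw [h1]⟩
      · exact absurd h1 (hmain _)
    | cons b l =>
      rcases (hx.step n).of_cons h with ⟨-, h1⟩ | ⟨-, h1⟩
      · refine ⟨fun f' B' b' l' err' h' => ?_, l, _, by rw [h1]⟩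
        rw [h] at h'
        cases h'
        exact ⟨_, by rw [h1]⟩
      · exact absurd h1 (hmain _)
  have himp : ∀ n ≥ k, ∃ l err, (x n).phase = .improve f B l err := by
    intro n hn
    induction n, hn using Nat.le_induction with
    | base => exact ⟨l, err, hph⟩
    | succ n hn ih =>
      obtain ⟨l, err, h⟩ := ih
      exact (hnext n hn l err h).2
  have hcut : ∀ n ≥ k, NotCut x n := fun n hn => by
    obtain ⟨l, err, h⟩ := himp n hn
    exact (hnext n hn l err h).1
  have hexp : ∀ n ≥ k, ∀ b, (x n).phase ≠ .expand b := fun n hn b h => by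
    obtain ⟨l, err, h'⟩ := himp n hn
    rw [h] at h'
    cases h'
  obtain ⟨L, hL⟩ := hx.exists_tendsto_V hpos hsel
    (eventually_atTop.2 ⟨k, fun n hn => ⟨hexp n hn, hcut n hn⟩⟩)
  have hsmall : ∀ᶠ n in atTop, ∀ b ∈ {b | M.Reachable b},
      |(x (n + 1)).tab.V b - (x n).tab.V b| ≤ ε :=
    (eventually_all_finite hx.finite).2 fun b _ => by
      have h1 := (((hL b).comp (tendsto_add_atTop_nat 1)).sub (hL b)).abs
      rw [sub_self, abs_zero] at h1
      exact (h1.eventually_lt_const hε).mono fun n hn => hn.le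
  obtain ⟨N', hN'⟩ := eventually_atTop.1 hsmall
  obtain ⟨l₁, err₁, h₁⟩ := himp (max k N') (le_max_left _ _)
  obtain ⟨m, hm, err₂, h₂⟩ := exists_sweep_done hcut (le_max_left _ _) h₁
  have hkm : k ≤ m := (le_max_left _ _).trans hm
  have hNm : N' ≤ m := (le_max_right _ _).trans hm
  have hagain : ∀ n ≥ k, ∀ err, (x n).phase = .improve f B [] err →
      ε < err ∧ ∃ l, (x (n + 1)).phase = .improve f B l 0 := by
    intro n hn err h
    rcases (hx.step n).of_nil h with ⟨h1, l, -, h2⟩ | ⟨-, h1⟩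
    · exact ⟨h1, l, by rw [h2]⟩
    · obtain ⟨l', err', h'⟩ := himp (n + 1) (by omega)
      rw [h1] at h'
      exact absurd h' (afterImprove_phase_ne _ _ _)
  obtain ⟨-, l₃, h₃⟩ := hagain m hkm err₂ h₂
  -- The values converge, so all changes are eventually at most `ε`. A sweep begun after that ends
  -- with `err ≤ ε`, which would have terminated the call.
  have herr : ∀ n ≥ m + 1, ∃ l err, err ≤ ε ∧ (x n).phase = .improve f B l err := by
    intro n hn
    induction n, hn using Nat.le_induction with
    | base => exact ⟨l₃, 0, hε.le, h₃⟩
    | succ n hn ih =>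
      obtain ⟨l, err, he, h⟩ := ih
      cases l with
      | nil => exact absurd he (not_le.2 (hagain n (by omega) err h).1)
      | cons b l =>
        rcases (hx.step n).of_cons h with ⟨-, h1⟩ | ⟨-, h1⟩
        · refine ⟨l, _, max_le he ?_, by rw [h1]⟩
          have hb : BacksUp x b n := ⟨_, _, _, _, _, h, by rw [h1]⟩
          have h2 := hN' n (by omega) b (hx.of_backsUp hb).1
          rwa [h1, setV_V_self] at h2
        · obtain ⟨l', err', h'⟩ := himp (n + 1) (by omega)
          rw [h1] at h'
          exact absurd h' (afterImprove_phase_ne _ _ _)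
  obtain ⟨m', hm', err₄, h₄⟩ := exists_sweep_done hcut (n := m + 1) (by omega) h₃
  obtain ⟨l₅, err₅, he, h₅⟩ := herr m' hm'
  rw [h₄] at h₅
  cases h₅
  exact absurd he (not_le.2 (hagain m' (by omega) _ h₄).1)

omit [Fintype A] [Nonempty A] in
/-- Once no new action is evaluated, there are no tips left at the head of the main loop. -/
theorem of_main {n : ℕ} (hn : M.Stable x n) (hph : (x n).phase = .main) :
    M.IsComplete (x n).graph ∧ ∃ l, M.IsSweep (x n).graph.nodes l ∧
      x (n + 1) = ⟨(x n).tab, (x n).graph, .improve true (x n).graph.nodes l 0⟩ := by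
  have hg : (x n).graph = M.bestGraph sel (x n).tab := by
    have := (hx.inv n).phase
    rwa [hph] at this
  rcases (hx.step n).of_main hph with ⟨b, hb, h⟩ | ⟨htip, hl⟩
  · exfalso
    have hph1 : (x (n + 1)).phase = .expand b := by rw [h]
    have htab : (x (n + 1)).tab = (x n).tab := by rw [h]
    -- The best action of a tip is unevaluated and is evaluated as soon as the tip is expanded,
    -- against stability.
    have hnot : (b, best sel (x n).tab b) ∉ (x n).tab.ev := hb.2.2.elim (fun h => h _) id
    refine hnot (hn b ((hx.inv n).reachable b hb.1) _ (Set.mem_iUnion.2 ⟨n + 2, ?_⟩))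
    rcases (hx.step (n + 1)).of_expand hph1 with ⟨-, h1⟩ | ⟨-, l, -, h1⟩
    · rw [h1, ← htab]
      exact Set.mem_insert _ _
    · rw [h1, ← htab]
      exact Set.mem_insert _ _
  · refine ⟨?_, hl⟩
    rw [hg] at htip ⊢
    exact isComplete_bestGraph_of_noTip htip

end IsEndlessRun

/-! ### Eventually complete graphs and the end of cut-offs. -/

variable (M sel) in
/-- The planner is at the head of the main loop or in a final call of ImproveValues, and the
solution graph is complete. -/
def Settled (x : LAOConfig S A) : Prop :=
  (x.phase = .main ∨ ∃ l err, x.phase = .improve true x.graph.nodes l err) ∧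
    M.IsComplete x.graph ∧ ∃ t, x.graph = M.bestGraph sel t

namespace IsEndlessRun

variable {x : ℕ → LAOConfig S A} (hx : M.IsEndlessRun sel ε Qinit x)
include hx

theorem settled_of_main {n : ℕ} (hn : M.Stable x n) (hph : (x n).phase = .main) :
    M.Settled sel (x n) := by
  refine ⟨Or.inl hph, (hx.of_main hn hph).1, (x n).tab, ?_⟩
  have := (hx.inv n).phase
  rwa [hph] at this

/-- Without tips, only final calls of ImproveValues occur. They touch no belief outside the graph,
and the graph is replaced only on return to the main loop. -/
theorem settled_succ {n : ℕ} (hn : M.Stable x n) (hn1 : M.Stable x (n + 1))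
    (h : M.Settled sel (x n)) : M.Settled sel (x (n + 1)) ∧
      ((x (n + 1)).graph = (x n).graph ∨ (x (n + 1)).phase = .main) ∧
      ∀ d, d ∉ (x n).graph.nodes → (x (n + 1)).tab.Q d = (x n).tab.Q d := by
  obtain ⟨hph | ⟨l, err, hph⟩, hcomp, hg⟩ := h
  · obtain ⟨-, l, -, h⟩ := hx.of_main hn hph
    rw [h]
    exact ⟨⟨Or.inr ⟨_, _, rfl⟩, hcomp, hg⟩, Or.inl rfl, fun _ _ => rfl⟩
  · cases l with
    | nil =>
      rcases (hx.step n).of_nil hph with ⟨-, l, -, h⟩ | ⟨-, h⟩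
      · rw [h]
        exact ⟨⟨Or.inr ⟨_, _, rfl⟩, hcomp, hg⟩, Or.inl rfl, fun _ _ => rfl⟩
      · have hm : (x (n + 1)).phase = .main := by rw [(hx.afterImprove_main h).2]
        refine ⟨hx.settled_of_main hn1 hm, Or.inr hm, fun d _ => ?_⟩
        rw [h, afterImprove_tab]
    | cons b l =>
      have hb : b ∈ (x n).graph.nodes := by
        have := (hx.inv n).phase
        rw [hph] at this
        exact (this.2.2.1 b List.mem_cons_self).1
      have hne : ∀ d, d ∉ (x n).graph.nodes → d ≠ b := fun d hd h => hd (h ▸ hb)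
      rcases (hx.step n).of_cons hph with ⟨-, h⟩ | ⟨-, h⟩
      · rw [h]
        exact ⟨⟨Or.inr ⟨_, _, rfl⟩, hcomp, hg⟩, Or.inl rfl,
          fun d hd => M.updateQ_Q_of_ne _ (hne d hd)⟩
      · have hm : (x (n + 1)).phase = .main := by rw [(hx.afterImprove_main h).2]
        refine ⟨hx.settled_of_main hn1 hm, Or.inr hm, fun d hd => ?_⟩
        rw [h, afterImprove_tab]
        exact M.updateQ_Q_of_ne _ (hne d hd)

/-- A belief at which ImproveValues is cut off does not come back into the solution graph. -/
theorem eventually_notCut [Finite A] {N : ℕ}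
    (hN : ∀ n ≥ N, M.Stable x n ∧ M.Settled sel (x n)) : ∀ᶠ n in atTop, NotCut x n := by
  have h1 : ∀ᶠ n in atTop, ∀ b ∈ {b | M.Reachable b}, ∀ f B l err,
      (x n).phase = .improve f B (b :: l) err →
      ∃ err', (x (n + 1)).phase = .improve f B l err' := by
    refine (eventually_all_finite hx.finite).2 fun b hb => ?_
    by_cases hcut : ∀ n ≥ N, ∀ f B l err, (x n).phase = .improve f B (b :: l) err →
      ∃ err', (x (n + 1)).phase = .improve f B l err'
    · exact eventually_atTop.2 ⟨N, hcut⟩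
    push Not at hcut
    obtain ⟨n, hn, f, B, l, err, hph, hnext⟩ := hcut
    rcases (hx.step n).of_cons hph with ⟨-, h⟩ | ⟨hev, h⟩
    · exact absurd (by rw [h]) (hnext _)
    have hbg : ¬ M.IsGoal b := by
      have := (hx.inv n).phase
      rw [hph] at this
      exact (this.2.2.1 b List.mem_cons_self).2
    have hout : ∀ m ≥ N, (x m).phase = .main → (b, best sel (x m).tab b) ∉ (x m).tab.ev →
        b ∉ (x m).graph.nodes := by
      intro m hm hmain hev hb
      obtain ⟨a, ha⟩ := (hN m hm).2.2.1.2.1 b hb hbg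
      have hg : (x m).graph = M.bestGraph sel (x m).tab := by
        have := (hx.inv m).phase
        rwa [hmain] at this
      rw [hg] at ha
      exact hev (bestGraph_act_eq_some.1 ha).2.2.1
    -- At the cut-off the best action at `b` is unevaluated, so the complete best graph omits `b`.
    -- Outside the graph the Q-values at `b` are frozen and nothing new is evaluated, so `b` stays
    -- out. Hence each belief causes at most one late cut-off.
    have hgone : ∀ m ≥ n + 1, b ∉ (x m).graph.nodes ∧
        (b, best sel (x m).tab b) ∉ (x m).tab.ev := by
      intro m hm
      induction m, hm using Nat.le_induction with
      | base =>
        have h2 := (hx.afterImprove_main h).2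
        have hev' : (b, best sel (x (n + 1)).tab b) ∉ (x (n + 1)).tab.ev := by
          rw [h2]
          exact hev
        exact ⟨hout (n + 1) (by omega) (by rw [h2]) hev', hev'⟩
      | succ m hm ih =>
        obtain ⟨-, h3, h4⟩ := hx.settled_succ (hN m (by omega)).1 (hN (m + 1) (by omega)).1
          (hN m (by omega)).2
        have hev' : (b, best sel (x (m + 1)).tab b) ∉ (x (m + 1)).tab.ev := by
          rw [best_congr (h4 b ih.1)]
          intro hmem
          exact ih.2 ((hN m (by omega)).1 b hb _ (Set.mem_iUnion.2 ⟨m + 1, hmem⟩))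
        refine ⟨?_, hev'⟩
        rcases h3 with h3 | h3
        · rw [h3]; exact ih.1
        · exact hout (m + 1) (by omega) h3 hev'
    refine eventually_atTop.2 ⟨n + 1, fun m hm f B l err hph => ?_⟩
    have := (hx.inv m).phase
    rw [hph] at this
    exact absurd (this.1 (this.2.2.1 b List.mem_cons_self).1) (hgone m hm).1
  filter_upwards [h1] with n hn f B b l err hph
  have := (hx.inv n).phase
  rw [hph] at this
  exact hn b ((hx.inv n).reachable b (this.1 (this.2.2.1 b List.mem_cons_self).1)) f B l err hph

end IsEndlessRun

/-! ### Optimality of the actions marked infinitely often. -/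

variable (sel) in
/-- The action `a` is infinitely often the one marked at `b` at the head of the main loop. -/
def Recurs (x : ℕ → LAOConfig S A) (b : PMF S) (a : A) : Prop :=
  ∃ᶠ n in atTop, (x n).phase = .main ∧ b ∈ (x n).graph.nodes ∧ best sel (x n).tab b = a

namespace IsEndlessRun

variable {x : ℕ → LAOConfig S A} (hx : M.IsEndlessRun sel ε Qinit x)
include hx

variable [Fintype A] [Nonempty A]

theorem eventually_settled (hpos : ∀ s, s ∉ M.G → ∀ a, 0 < M.c s a)
    (hsel : ∀ b (q : A → ℝ) a, q (sel b q) ≤ q a) (hε : 0 < ε) :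
    ∀ᶠ n in atTop, M.Stable x n ∧ M.Settled sel (x n) := by
  obtain ⟨N, hN⟩ := eventually_atTop.1 hx.eventually_stable
  obtain ⟨k, hk, hmain⟩ := (frequently_atTop.1 (hx.frequently_main hpos hsel hε)) N
  refine eventually_atTop.2 ⟨k, fun n hn => ⟨hN n (hk.trans hn), ?_⟩⟩
  induction n, hn using Nat.le_induction with
  | base => exact hx.settled_of_main (hN k hk) hmain
  | succ n hn ih =>
    exact (hx.settled_succ (hN n (by omega)) (hN (n + 1) (by omega)) ih).1

/-- From some time on, all marked actions recur. -/
theorem eventually_recurs (hpos : ∀ s, s ∉ M.G → ∀ a, 0 < M.c s a)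
    (hsel : ∀ b (q : A → ℝ) a, q (sel b q) ≤ q a) (hε : 0 < ε) :
    ∀ᶠ n in atTop, ∀ b a, (x n).graph.act b = some a →
      b ∈ (x n).graph.nodes ∧ ¬ M.IsGoal b ∧ Recurs sel x b a := by
  have h1 : ∀ᶠ n in atTop, ∀ b ∈ {b | M.Reachable b}, ∀ a, (x n).phase = .main →
      b ∈ (x n).graph.nodes → best sel (x n).tab b = a → Recurs sel x b a := by
    refine (eventually_all_finite hx.finite).2 fun b hb => eventually_all.2 fun a => ?_
    by_cases h : Recurs sel x b a
    · exact Eventually.of_forall fun _ _ _ _ => h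
    · filter_upwards [not_frequently.1 h] with n hn h1 h2 h3
      exact absurd ⟨h1, h2, h3⟩ hn
  obtain ⟨N, hN⟩ := eventually_atTop.1 (h1.and (hx.eventually_settled hpos hsel hε))
  obtain ⟨k, hk, hmain⟩ := (frequently_atTop.1 (hx.frequently_main hpos hsel hε)) N
  have hat : ∀ n ≥ N, (x n).phase = .main → ∀ b a, (x n).graph.act b = some a →
      b ∈ (x n).graph.nodes ∧ ¬ M.IsGoal b ∧ Recurs sel x b a := by
    intro n hn hmain b a ha
    have hg : (x n).graph = M.bestGraph sel (x n).tab := by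
      have := (hx.inv n).phase
      rwa [hmain] at this
    rw [hg] at ha
    obtain ⟨h1, h2, -, h3⟩ := bestGraph_act_eq_some.1 ha
    have hb : b ∈ (x n).graph.nodes := by rw [hg]; exact h1
    exact ⟨hb, h2, (hN n hn).1 b h1.reachable a hmain hb h3⟩
  refine eventually_atTop.2 ⟨k, fun n hn => ?_⟩
  induction n, hn using Nat.le_induction with
  | base => exact hat k hk hmain
  | succ n hn ih =>
    obtain ⟨-, h2, -⟩ := hx.settled_succ (hN n (by omega)).2.1 (hN (n + 1) (by omega)).2.1
      (hN n (by omega)).2.2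
    rcases h2 with h2 | h2
    · rw [h2]; exact ih
    · exact hat (n + 1) (by omega) h2

/-- The limit of the values dominates its lookahead value for the recurring actions. -/
theorem qval_le_of_recurs (hpos : ∀ s, s ∉ M.G → ∀ a, 0 < M.c s a)
    (hsel : ∀ b (q : A → ℝ) a, q (sel b q) ≤ q a) (hε : 0 < ε)
    (hcut : ∀ᶠ n in atTop, NotCut x n) {L : PMF S → ℝ}
    (hL : ∀ b, Tendsto (fun n => (x n).tab.V b) atTop (𝓝 (L b))) {b : PMF S} {a : A}
    (hg : ¬ M.IsGoal b) (h : Recurs sel x b a) : M.qval L b a ≤ L b := by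
  have hset := hx.eventually_settled hpos hsel hε
  have hback : ∃ᶠ n in atTop, BacksUp x b n := by
    obtain ⟨N, hN⟩ := eventually_atTop.1 (hset.and hcut)
    rw [frequently_atTop]
    intro K
    obtain ⟨n, hn, hmain, hb, -⟩ := (frequently_atTop.1 h) (max N K)
    have hnN : N ≤ n := (le_max_left _ _).trans hn
    obtain ⟨-, l, hl, hnext⟩ := hx.of_main (hN n hnN).1.1 hmain
    obtain ⟨m, hm, hbm⟩ := exists_backsUp_of_mem (N := N) (n := n + 1) (err := 0)
      (fun n hn => (hN n hn).2) ((hl.2 b).2 ⟨hb, hg⟩) (by omega) (by rw [hnext])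
    exact ⟨m, by have := le_max_right N K; omega, hbm⟩
  refine le_of_forall_sub_le fun η hη => ?_
  -- Value and Q-values at `b` are tracked as a pair because they change only together, at backups,
  -- and the best action is a function of the Q-values. The inequality made true by a backup thus
  -- lasts until the next one.
  have hev : ∀ᶠ n in atTop, (b, sel b ((x n).tab.Q b)) ∈ everEvaluated x →
      M.qval L b (sel b ((x n).tab.Q b)) - η ≤ (x n).tab.V b := by
    refine eventually_of_forall_change (X := fun n => ((x n).tab.V b, (x n).tab.Q b))
      (P := fun p => (b, sel b p.2) ∈ everEvaluated x → M.qval L b (sel b p.2) - η ≤ p.1)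
      (C := BacksUp x b) ?_ hback ?_
    · filter_upwards [hset, hcut] with n hn hcut
      refine (hx.eq_or_backsUp (fun b hb => ?_) hcut b).imp (fun h => Prod.ext h.1 h.2) id
      rcases hn.2.1 with h | ⟨l, err, h⟩ <;> simp [h] at hb
    · have hq : ∀ᶠ n in atTop, ∀ a, M.qval L b a - η ≤ M.qval (x n).tab.V b a := by
        refine eventually_all.2 fun a => M.eventually_le_qval fun z _ => ?_
        exact ((hL _).eventually_const_lt (sub_lt_self _ hη)).mono fun n hn => hn.le
      filter_upwards [hset, hq] with n hn hq hC hmem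
      obtain ⟨h1, h2⟩ := hx.Q_of_backsUp hn.1 hC
      have h3 : (x (n + 1)).tab.V b = M.qval (x n).tab.V b (sel b ((x (n + 1)).tab.Q b)) := by
        rw [h2]
        exact (congrFun h1 _).trans (if_pos hmem)
      rw [h3]
      exact hq _
  refine ge_of_tendsto_of_frequently (hL b) ?_
  refine (h.and_eventually (hev.and hset)).mono ?_
  rintro n ⟨⟨hmain, hb, hbest⟩, hev, hst⟩
  have hcomp := hst.2.2.1
  obtain ⟨a', ha'⟩ := hcomp.2.1 b hb hg
  have hgr : (x n).graph = M.bestGraph sel (x n).tab := by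
    have := (hx.inv n).phase
    rwa [hmain] at this
  rw [hgr] at ha'
  have hmem := (bestGraph_act_eq_some.1 ha').2.2.1
  have h4 := hev (Set.mem_iUnion.2 ⟨n, hmem⟩)
  rw [show sel b ((x n).tab.Q b) = a from hbest] at h4
  exact h4

/-- From some time on, the solution graph is complete, and its marked actions are optimal. -/
theorem eventually_optimal (hpos : ∀ s, s ∉ M.G → ∀ a, 0 < M.c s a)
    (hfin : ∀ b, M.Reachable b → M.optCost b ≠ ∞)
    (hsel : ∀ b (q : A → ℝ) a, q (sel b q) ≤ q a) (hε : 0 < ε) :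
    ∀ᶠ n in atTop, M.IsComplete (x n).graph ∧ ∀ b ∈ (x n).graph.nodes, ¬ M.IsGoal b →
      ∀ a, (x n).graph.act b = some a → M.optQ b a = M.optCost b := by
  have hset := hx.eventually_settled hpos hsel hε
  obtain ⟨N, hN⟩ := eventually_atTop.1 hset
  have hcut := hx.eventually_notCut hN
  obtain ⟨L, hL⟩ := hx.exists_tendsto_V hpos hsel (by
    filter_upwards [hset, hcut] with n hn hcut
    refine ⟨fun b hb => ?_, hcut⟩
    rcases hn.2.1 with h | ⟨l, err, h⟩ <;> simp [h] at hb)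
  obtain ⟨κ, hκ, hc⟩ := M.exists_cost_lower_bound hpos
  obtain ⟨m, hm⟩ := hx.lower
  have hLle : ∀ b, M.Reachable b → L b ≤ M.optVal b := fun b hb =>
    le_of_tendsto' (hL b) fun n => (hx.inv n).admissible.V_le b hb
  filter_upwards [hset, hx.eventually_recurs hpos hsel hε] with n hn hrec
  have hcomp := hn.2.2.1
  refine ⟨hcomp, ?_⟩
  set g := (x n).graph with hgdef
  have hreach : ∀ b ∈ g.nodes, M.Reachable b := (hx.inv n).reachable
  have hq : ∀ b a, g.act b = some a → M.qval L b a ≤ L b := fun b a ha =>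
    hx.qval_le_of_recurs hpos hsel hε hcut hL (hrec b a ha).2.1 (hrec b a ha).2.2
  set π : PMF S → A := fun b => (g.act b).getD (Classical.arbitrary A) with hπ
  have hπb : ∀ b ∈ g.nodes, ¬ M.IsGoal b → g.act b = some (π b) := by
    intro b hb hbg
    obtain ⟨a, ha⟩ := hcomp.2.1 b hb hbg
    simp [hπ, ha]
  -- The limit is an underestimate, and on the graph it dominates its lookahead under the marked
  -- actions, all of which recur. Verification closes the gap exactly; the tolerance `ε` plays no
  -- role in the limit.
  have hWL : ∀ b ∈ g.nodes, L b = M.optVal b := by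
    intro b hb
    refine le_antisymm (hLle b (hreach b hb)) ?_
    have hver := M.policyCost_le_ofReal_of_qval_le (D := g.nodes) (v := L) (π := π) (m := m) hκ
      (fun b hb hbg z hz => hcomp.2.2 b _ ⟨hb, π b, z, hπb b hb hbg, hz, rfl⟩)
      (fun b hb hbg => ge_of_tendsto' (hL b) fun n =>
        ((hx.inv n).admissible.V_goal b hbg).ge)
      (fun b hb => ge_of_tendsto' (hL b) fun n => (hm n b (hreach b hb)).1)
      (fun b hb hbg => hc b (hreach b hb) hbg _)
      (fun b hb hbg => hq b _ (hπb b hb hbg)) hb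
    exact ENNReal.toReal_le_of_le_ofReal hver.1 ((iInf_le _ π).trans hver.2)
  intro b hb hbg a ha
  rw [M.optQ_eq_optCost_iff hfin (hreach b hb)]
  refine le_antisymm ?_ (M.optVal_le_qval hfin (hreach b hb) a)
  rw [← hWL b hb]
  refine le_trans (le_of_eq (M.qval_congr fun z hz => ?_)) (hq b a ha)
  exact (hWL _ (hcomp.2.2 b _ ⟨hb, a, z, ha, hz, rfl⟩)).symm

omit hx in
-- A complete graph marks every non-goal belief it reaches, so by induction from `M.b₀` agreement on
-- common beliefs already forces the same beliefs.
theorem _root_.GoalPOMDP.eq_of_act_eq {t t' : Tables S A}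
    (h : M.IsComplete (M.bestGraph sel t)) (h' : M.IsComplete (M.bestGraph sel t'))
    (hact : ∀ b a a', (M.bestGraph sel t).act b = some a → (M.bestGraph sel t').act b = some a' →
      a = a') : M.bestGraph sel t = M.bestGraph sel t' := by
  have hsub : ∀ {t t' : Tables S A}, M.IsComplete (M.bestGraph sel t') →
      (∀ b a a', (M.bestGraph sel t).act b = some a → (M.bestGraph sel t').act b = some a' →
        a = a') → ∀ b, M.BestReach sel t b → M.BestReach sel t' b := by
    intro t t' h' hact b hb
    induction hb with
    | start => exact .start
    | step b z hb hg he hz ih =>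
      obtain ⟨a', ha'⟩ := h'.2.1 b ih hg
      have h1 := hact b _ a' (bestGraph_act_eq_some.2 ⟨hb, hg, he, rfl⟩) ha'
      subst h1
      exact h'.2.2 b _ ⟨ih, _, z, ha', hz, rfl⟩
  have hiff : ∀ b, M.BestReach sel t b ↔ M.BestReach sel t' b := fun b =>
    ⟨hsub h' hact b, hsub h (fun b a a' h1 h2 => (hact b a' a h2 h1).symm) b⟩
  ext b a
  · exact hiff b
  · have key : ∀ {t t' : Tables S A}, M.IsComplete (M.bestGraph sel t') →
        (∀ b, M.BestReach sel t b → M.BestReach sel t' b) →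
        (∀ b a a', (M.bestGraph sel t).act b = some a → (M.bestGraph sel t').act b = some a' →
          a = a') → (M.bestGraph sel t).act b = some a → (M.bestGraph sel t').act b = some a := by
      intro t t' h' hsub hact ha
      obtain ⟨h1, h2, -, -⟩ := bestGraph_act_eq_some.1 ha
      obtain ⟨a', ha'⟩ := h'.2.1 b (hsub b h1) h2
      rwa [hact b a a' ha ha']
    exact ⟨key h' (fun b => (hiff b).1) hact,
      key h (fun b => (hiff b).2) fun b a a' h1 h2 => (hact b a' a h2 h1).symm⟩

/-- A run never goes on forever if the optimal actions are unique. -/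
theorem false_of_unique (hpos : ∀ s, s ∉ M.G → ∀ a, 0 < M.c s a)
    (hfin : ∀ b, M.Reachable b → M.optCost b ≠ ∞)
    (hsel : ∀ b (q : A → ℝ) a, q (sel b q) ≤ q a) (hε : 0 < ε)
    (huniq : ∀ b, M.Reachable b → ¬ M.IsGoal b → ∀ a a', M.optQ b a = M.optCost b →
      M.optQ b a' = M.optCost b → a = a') : False := by
  have hset := hx.eventually_settled hpos hsel hε
  obtain ⟨N₀, hN₀⟩ := eventually_atTop.1 hset
  obtain ⟨N, hN⟩ := eventually_atTop.1 ((hset.and (hx.eventually_notCut hN₀)).and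
    ((hx.eventually_optimal hpos hfin hsel hε).and (hx.eventually_recurs hpos hsel hε)))
  -- The bound `N + 1` leaves a late predecessor `n`. Without cut-offs, the step into the main loop
  -- ends a full final sweep; unique optimal actions make the graphs at `n` and `n + 1` equal, so
  -- the planner should have returned.
  obtain ⟨k, hk, hmain⟩ := (frequently_atTop.1 (hx.frequently_main hpos hsel hε)) (N + 1)
  obtain ⟨n, rfl⟩ : ∃ n, k = n + 1 := ⟨k - 1, by omega⟩
  have hn : N ≤ n := by omega
  obtain ⟨⟨⟨hst, hph, hcomp, t, hgt⟩, hcut⟩, ⟨-, hopt⟩, hrec⟩ := hN n hn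
  obtain ⟨-, ⟨hcomp', hopt'⟩, hrec'⟩ := hN (n + 1) (by omega)
  have hg' : (x (n + 1)).graph = M.bestGraph sel (x (n + 1)).tab := by
    have := (hx.inv (n + 1)).phase
    rwa [hmain] at this
  have heq : (x n).graph = (x (n + 1)).graph := by
    rw [hgt, hg']
    refine eq_of_act_eq (hgt ▸ hcomp) (hg' ▸ hcomp') fun b a a' ha ha' => ?_
    rw [← hgt] at ha
    rw [← hg'] at ha'
    obtain ⟨h1, h2, -⟩ := hrec b a ha
    exact huniq b ((hx.inv n).reachable b h1) h2 a a' (hopt b h1 h2 a ha)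
      (hopt' b (hrec' b a' ha').1 h2 a' ha')
  rcases hph with hph | ⟨l, err, hph⟩
  · obtain ⟨-, l, -, h⟩ := hx.of_main hst hph
    rw [h] at hmain
    cases hmain
  · cases l with
    | cons b l =>
      obtain ⟨err', h⟩ := hcut _ _ _ _ _ hph
      rw [h] at hmain
      cases hmain
    | nil =>
      rcases (hx.step n).of_nil hph with ⟨-, l, -, h⟩ | ⟨-, h⟩
      · rw [h] at hmain
        cases hmain
      · refine (hx.afterImprove_main h).1 ⟨rfl, ?_⟩
        rw [heq, hg', (hx.afterImprove_main h).2]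

end IsEndlessRun

end LAORun

/-! ### Lazy LAO*: finitely many reachable beliefs -/

section LAOFinite

variable {S A Z : Type*} [Fintype S] {M : GoalPOMDP S A Z} [Fintype Z]
  {sel : PMF S → (A → ℝ) → A} {ε : ℝ} {Qinit : PMF S → A → ℝ} {heur : PMF S → ℝ}

theorem costUpTo_congr {π π' : PMF S → A} (h : ∀ b, M.Reachable b → π b = π' b) (n : ℕ)
    {b : PMF S} (hb : M.Reachable b) : M.costUpTo π n b = M.costUpTo π' n b := by
  induction n generalizing b with
  | zero => rfl
  | succ n ih =>
    by_cases hg : M.IsGoal b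
    · rw [M.costUpTo_of_isGoal _ _ hg, M.costUpTo_of_isGoal _ _ hg]
    · rw [M.costUpTo_succ _ _ hg, M.costUpTo_succ _ _ hg, h b hb]
      congr 1
      refine Finset.sum_congr rfl fun z _ => ?_
      by_cases hz : M.obsProb b (π' b) z = 0
      · rw [hz, zero_mul, zero_mul]
      · rw [ih (hb.succ hz)]

theorem policyCost_congr {π π' : PMF S → A} (h : ∀ b, M.Reachable b → π b = π' b)
    {b : PMF S} (hb : M.Reachable b) : M.policyCost π b = M.policyCost π' b :=
  iSup_congr fun n => costUpTo_congr h n hb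

/-- The cost from `M.b₀` depends only on the restriction of the policy to the finitely many
reachable beliefs. -/
theorem finite_range_policyCost [Finite A] [Nonempty A] (hR : {b | M.Reachable b}.Finite) :
    (Set.range fun π : PMF S → A => M.policyCost π M.b₀).Finite := by
  have : Finite {b | M.Reachable b} := hR
  refine (Set.finite_range fun f : {b | M.Reachable b} → A => M.policyCost
    (fun b => if hb : M.Reachable b then f ⟨b, hb⟩ else Classical.arbitrary A) M.b₀).subset ?_
  rintro _ ⟨π, rfl⟩
  refine ⟨fun b => π b, policyCost_congr (fun b hb => ?_) .start⟩
  exact dif_pos hb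

/-- With finitely many reachable beliefs, nearly optimal policies are optimal. -/
theorem exists_gap [Finite A] [Nonempty A] (hR : {b | M.Reachable b}.Finite) :
    ∃ δ : ℝ≥0, 0 < δ ∧ ∀ π, M.policyCost π M.b₀ ≤ M.optCost M.b₀ + δ →
      M.policyCost π M.b₀ = M.optCost M.b₀ := by
  have hlim : Tendsto (fun δ : ℝ≥0 => M.optCost M.b₀ + δ) (𝓝[>] 0) (𝓝 (M.optCost M.b₀)) :=
    ((continuous_const.add ENNReal.continuous_coe).tendsto' 0 _ (by simp)).mono_left
      nhdsWithin_le_nhds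
  have hev : ∀ᶠ δ : ℝ≥0 in 𝓝[>] 0, ∀ v ∈ Set.range fun π : PMF S → A => M.policyCost π M.b₀,
      M.optCost M.b₀ < v → M.optCost M.b₀ + δ < v :=
    (eventually_all_finite (finite_range_policyCost hR)).2 fun v _ =>
      eventually_imp_distrib_left.2 fun hv => hlim.eventually_lt_const hv
  obtain ⟨δ, h, hδ⟩ := (hev.and self_mem_nhdsWithin).exists
  refine ⟨δ, hδ, fun π hπ => ?_⟩
  by_contra hne
  exact hπ.not_gt (h _ ⟨π, rfl⟩ (lt_of_le_of_ne (iInf_le _ π) (Ne.symm hne)))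

theorem exists_isSweep {B : Set (PMF S)} (hB : B.Finite) : ∃ l, M.IsSweep B l :=
  ⟨(hB.subset (Set.sep_subset B fun b => ¬ M.IsGoal b)).toFinset.toList, Finset.nodup_toList _,
    fun b => by simp⟩

/-- Finiteness enters only because a sweep is a finite list; it excludes runs that are stuck without
having returned. -/
theorem LAOInv.exists_step {x : LAOConfig S A} (hx : M.LAOInv sel ε Qinit x)
    (hR : {b | M.Reachable b}.Finite) (hr : x.phase ≠ .returned) : ∃ y, M.LAOStep sel ε x y := by
  obtain ⟨t, g, p⟩ := x
  have hnodes : g.nodes.Finite := hR.subset hx.reachable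
  have hph := hx.phase
  cases p with
  | main =>
    by_cases h : ∃ b, M.IsTip sel t g b
    · obtain ⟨b, hb⟩ := h
      exact ⟨_, .pick t g b hb⟩
    · obtain ⟨l, hl⟩ := exists_isSweep (M := M) hnodes
      exact ⟨_, .noTip t g l (not_exists.1 h) hl⟩
  | expand b =>
    by_cases h : best sel (M.lazyBody sel t b) b = best sel t b
    · obtain ⟨l, hl⟩ := exists_isSweep (M := M) (hnodes.subset (withAncestors_subset (M := M) hph.1))
      exact ⟨_, .expanded t g b l h hl⟩
    · exact ⟨_, .again t g b h⟩
  | improve f B l err =>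
    cases l with
    | nil =>
      by_cases h : ε < err
      · obtain ⟨l, hl⟩ := exists_isSweep (M := M) (hnodes.subset hph.1)
        exact ⟨_, .sweepAgain t g f B l err h hl⟩
      · exact ⟨_, .sweepEnd t g f B err (not_lt.1 h)⟩
    | cons b l =>
      by_cases h : (b, best sel (M.updateQ t b) b) ∈ t.ev
      · exact ⟨_, .backup t g f B b l err h⟩
      · exact ⟨_, .cutOff t g f B b l err h⟩
  | returned => exact absurd rfl hr

theorem IsLAORun.eq_of_returned {x : ℕ → LAOConfig S A} (hx : M.IsLAORun sel ε Qinit heur x)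
    {n : ℕ} (hn : (x n).phase = .returned) : ∀ k ≥ n, x k = x n := by
  intro k hk
  induction k, hk using Nat.le_induction with
  | base => rfl
  | succ k _ ih =>
    rcases hx.2 k with h | ⟨-, h⟩
    · exact absurd h (not_laoStep_of_returned (by rw [ih, hn]))
    · rw [h, ih]

theorem IsComplete.policyCost_eq {g : SolGraph S A} [Fintype A] [Nonempty A]
    (hg : M.IsComplete g)
    (hopt : ∀ b ∈ g.nodes, ¬ M.IsGoal b → ∀ a, g.act b = some a → M.optQ b a = M.optCost b)
    {π : PMF S → A} (hπ : Follows g π) : M.policyCost π M.b₀ = M.optCost M.b₀ := by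
  have hact : ∀ b ∈ g.nodes, ¬ M.IsGoal b → g.act b = some (π b) := fun b hb hbg => by
    obtain ⟨a, ha⟩ := hg.2.1 b hb hbg
    rw [hπ b hb a ha, ha]
  exact M.policyCost_eq_optCost (D := g.nodes)
    (fun b hb hbg z hz => hg.2.2 b _ ⟨hb, _, z, hact b hb hbg, hz, rfl⟩)
    (fun b hb hbg => hopt b hb hbg _ (hact b hb hbg)) hg.1

variable [Fintype A] [Nonempty A]

theorem isEndlessRun_of_isLAORun (hfin : ∀ b, M.Reachable b → M.optCost b ≠ ∞)
    (hsel : ∀ b (q : A → ℝ) a, q (sel b q) ≤ q a)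
    (hQ : ∀ b a, ((Qinit b a : ℝ) : EReal) ≤ ((M.optQ b a : ℝ≥0∞) : EReal))
    (hheur : ∀ b, ((heur b : ℝ) : EReal) ≤ ((M.optCost b : ℝ≥0∞) : EReal))
    (hR : {b | M.Reachable b}.Finite)
    {x : ℕ → LAOConfig S A} (hx : M.IsLAORun sel ε Qinit heur x)
    (hr : ∀ n, (x n).phase ≠ .returned) : M.IsEndlessRun sel ε Qinit x := by
  have hinv := laoInv_of_isLAORun hfin hsel hQ hheur hx
  have hstep : ∀ n, M.LAOStep sel ε (x n) (x (n + 1)) := fun n =>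
    (hx.2 n).resolve_right fun h => by
      obtain ⟨y, hy⟩ := (hinv n).exists_step hR (hr n)
      exact h.1 y hy
  obtain ⟨m, hm⟩ := M.exists_lower_bound_of_finite hR Qinit heur
  refine ⟨hstep, hinv, hR, min m 0, fun n => ?_⟩
  induction n with
  | zero => rw [hx.1]; exact M.boundedBelow_startTables hm
  | succ n ih => exact ih.tableOps ((hinv n).tableOps (hstep n))

/-- Small `ε` matters only for runs that return, where the gap between policy costs turns
near-optimality into optimality. Endless runs are settled by the limit argument for every positive
`ε`. -/
theorem laoStar_of_finite (hpos : ∀ s, s ∉ M.G → ∀ a, 0 < M.c s a)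
    (hfin : ∀ b, M.Reachable b → M.optCost b ≠ ∞)
    (hsel : ∀ b (q : A → ℝ) a, q (sel b q) ≤ q a)
    (hQ : ∀ b a, ((Qinit b a : ℝ) : EReal) ≤ ((M.optQ b a : ℝ≥0∞) : EReal))
    (hheur : ∀ b, ((heur b : ℝ) : EReal) ≤ ((M.optCost b : ℝ≥0∞) : EReal))
    (hR : {b | M.Reachable b}.Finite) :
    ∃ ε₀ : ℝ, 0 < ε₀ ∧ ∀ ε : ℝ, 0 < ε → ε < ε₀ →
      ∀ x : ℕ → LAOConfig S A, M.IsLAORun sel ε Qinit heur x →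
        (∃ᶠ n in atTop, (x n).phase = .main ∨ (x n).phase = .returned) ∧
        (∀ᶠ n in atTop,
          M.IsComplete (x n).graph ∧
          ∀ π, Follows (x n).graph π → M.policyCost π M.b₀ = M.optCost M.b₀) ∧
        ((∀ b, M.Reachable b → ¬ M.IsGoal b → ∀ a a', M.optQ b a = M.optCost b →
            M.optQ b a' = M.optCost b → a = a') →
          ∃ n, (x n).phase = .returned) := by
  obtain ⟨δ, hδ, hgap⟩ := exists_gap hR
  obtain ⟨ε₀, hε₀, hret⟩ := laoStar_returned hpos hfin hsel hQ hheur δ hδ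
  refine ⟨ε₀, hε₀, fun ε hε hεε x hx => ?_⟩
  by_cases hr : ∃ n, (x n).phase = .returned
  · obtain ⟨n, hn⟩ := hr
    have hconst := hx.eq_of_returned hn
    obtain ⟨hcomp, hcost⟩ := hret ε hε hεε x hx n hn
    refine ⟨Eventually.frequently (eventually_atTop.2 ⟨n, fun k hk => ?_⟩),
      eventually_atTop.2 ⟨n, fun k hk => ?_⟩, fun _ => ⟨n, hn⟩⟩
    · rw [hconst k hk]
      exact Or.inr hn
    · rw [hconst k hk]
      exact ⟨hcomp, fun π hπ => hgap π (hcost π hπ)⟩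
  · have hend := isEndlessRun_of_isLAORun hfin hsel hQ hheur hR hx (not_exists.1 hr)
    refine ⟨(hend.frequently_main hpos hsel hε).mono fun n hn => Or.inl hn, ?_, fun huniq =>
      (hend.false_of_unique hpos hfin hsel hε huniq).elim⟩
    exact (hend.eventually_optimal hpos hfin hsel hε).mono fun n hn =>
      ⟨hn.1, fun π hπ => hn.1.policyCost_eq hn.2 hπ⟩

end LAOFinite

end

end GoalPOMDP

theorem mainTheorem1 {S A Z : Type*} [Fintype S] [Fintype A] [Nonempty A] [Fintype Z]
    (M : GoalPOMDP S A Z)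
    -- costs are positive outside the goal states
    (hpos : ∀ s, s ∉ M.G → ∀ a, 0 < M.c s a)
    -- from every reachable belief the goal can be reached at finite expected cost
    (hfin : ∀ b, M.Reachable b → M.optCost b ≠ ∞)
    -- the estimator of the Q-values and the heuristic are underestimates
    (Qinit : PMF S → A → ℝ) (heur : PMF S → ℝ)
    (hQ : ∀ b a, ((Qinit b a : ℝ) : EReal) ≤ ((M.optQ b a : ℝ≥0∞) : EReal))
    (hheur : ∀ b, ((heur b : ℝ) : EReal) ≤ ((M.optCost b : ℝ≥0∞) : EReal))
    -- the rule by which a minimising action is chosen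
    (sel : PMF S → (A → ℝ) → A) (hsel : ∀ b (q : A → ℝ) a, q (sel b q) ≤ q a) :
    -- Lazy RTDP-Bel, any set of reachable beliefs
    (((∃ m : ℝ, ∀ b, M.Reachable b → m ≤ heur b ∧ ∀ a, m ≤ Qinit b a) →
      ∀ᵐ x ∂(M.rtdpLaw sel Qinit heur), ∀ b : PMF S, (∃ᶠ n in atTop, (x n).b = b) →
        Tendsto (fun n => (x n).tab.V b) atTop (𝓝 (M.optCost b).toReal) ∧
        ∀ᶠ n in atTop, M.optQ b (GoalPOMDP.best sel (x n).tab b) = M.optCost b) ∧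
    -- Lazy RTDP-Bel, finitely many reachable beliefs
    ({b | M.Reachable b}.Finite →
      ∀ᵐ x ∂(M.rtdpLaw sel Qinit heur),
        (∃ᶠ n in atTop, M.IsGoal (x n).b) ∧
        Tendsto (fun n => (x n).tab.V M.b₀) atTop (𝓝 (M.optCost M.b₀).toReal) ∧
        ∀ᶠ n in atTop,
          M.policyCost (GoalPOMDP.best sel (x n).tab) M.b₀ = M.optCost M.b₀)) ∧
    -- Lazy LAO*, any set of reachable beliefs
    ((∀ δ : ℝ≥0, 0 < δ → ∃ ε₀ : ℝ, 0 < ε₀ ∧ ∀ ε : ℝ, 0 < ε → ε < ε₀ →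
      ∀ x : ℕ → LAOConfig S A, M.IsLAORun sel ε Qinit heur x →
        ∀ n, (x n).phase = .returned →
          M.IsComplete (x n).graph ∧
          ∀ π, GoalPOMDP.Follows (x n).graph π → M.policyCost π M.b₀ ≤ M.optCost M.b₀ + δ) ∧
    -- Lazy LAO*, finitely many reachable beliefs
    ({b | M.Reachable b}.Finite →
      ∃ ε₀ : ℝ, 0 < ε₀ ∧ ∀ ε : ℝ, 0 < ε → ε < ε₀ →
      ∀ x : ℕ → LAOConfig S A, M.IsLAORun sel ε Qinit heur x →
        (∃ᶠ n in atTop, (x n).phase = .main ∨ (x n).phase = .returned) ∧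
        (∀ᶠ n in atTop,
          M.IsComplete (x n).graph ∧
          ∀ π, GoalPOMDP.Follows (x n).graph π → M.policyCost π M.b₀ = M.optCost M.b₀) ∧
        ((∀ b, M.Reachable b → ¬ M.IsGoal b → ∀ a a', M.optQ b a = M.optCost b →
            M.optQ b a' = M.optCost b → a = a') →
          ∃ n, (x n).phase = .returned))) := by
  refine ⟨⟨fun ⟨m, hm⟩ => ?_, fun hR => ?_⟩,
    GoalPOMDP.laoStar_returned hpos hfin hsel hQ hheur,
    GoalPOMDP.laoStar_of_finite hpos hfin hsel hQ hheur⟩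
  · filter_upwards [M.ae_isFairPath sel Qinit heur] with x hx b hb
    have h0 : M.Admissible Qinit (x 0).tab := hx.1 ▸ M.admissible_startTables hfin hQ hheur
    have hm' : M.BoundedBelow (min m 0) (x 0).tab := hx.1 ▸ M.boundedBelow_startTables hm
    exact ⟨hx.2.tendsto_V hpos hfin hsel h0 hm' hb,
      hx.2.eventually_best_optimal hpos hfin hsel h0 hm' hb⟩
  · obtain ⟨m, hm⟩ := M.exists_lower_bound_of_finite hR Qinit heur
    filter_upwards [M.ae_isFairPath sel Qinit heur] with x hx
    have h0 : M.Admissible Qinit (x 0).tab := hx.1 ▸ M.admissible_startTables hfin hQ hheur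
    have hm' : M.BoundedBelow (min m 0) (x 0).tab := hx.1 ▸ M.boundedBelow_startTables hm
    have hgoal := hx.2.frequently_isGoal hR hpos hfin hsel h0 hm'
    exact ⟨hgoal, hx.2.tendsto_V hpos hfin hsel h0 hm' (hx.2.frequently_start hgoal),
      hx.2.eventually_policyCost_eq hR hpos hfin hsel h0 hm'⟩
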